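/- Let $\phi$ be a CNF formula with $n$ variables and $m$ clauses, $|\phi|=m+n$; its incidence graph has the variables and the clauses as vertices and an edge between a variable and a clause whenever the variable occurs in the clause. For a tree decomposition of the incidence graph let $N$ be its number of nodes, $\mathcal{TW}(\phi)$ its width (the maximal size of a bag minus one), and $d$ the maximal degree of its tree; assume $d\le 3$. All logarithms are to base $2$. **Theorem.** For every $\varepsilon$ with $0<\varepsilon<1$ there is an algorithm that, given a CNF formula $\phi$ together with such a tree decomposition of its incidence graph, always halts and decides whether $\phi$ is satisfiable, and that runs simultaneously in time $O^*\big(d^{\,1.441\,(1-\varepsilon)\,\mathcal{TW}(\phi)\,\log N}\big)$ and in space $O^*\big(2^{2\varepsilon\,\mathcal{TW}(\phi)}\big)$. That is, there are constants $N_0, C, k$, depending only on $\varepsilon$, such that on every input the space (in bits) is at most $$C\,(|\phi|+N)^k\;2^{2\varepsilon\,\mathcal{TW}(\phi)},$$ and on every input whose decomposition has $N\ge N_0$ nodes the time is at most $$C\,(|\phi|+N)^k\;d^{\,1.441\,(1-\varepsilon)\,\mathcal{TW}(\phi)\,\log N}.$$ Time and space are those of a random access machine with logarithmic costs. -/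

import Mathlib

namespace SatTW

/-! ### CNF formulas and incidence graphs -/

/-- A CNF formula with variables `x_0, …, x_{n-1}` and clauses `C_0, …, C_{m-1}`.
A clause is a finite set of literals; the literal `(x, true)` is `x`, the literal `(x, false)`
is the negation of `x`. -/
structure CNF where
  /-- the number of variables -/
  n : ℕ
  /-- the number of clauses -/
  m : ℕ
  clause : Fin m → Finset (Fin n × Bool)

/-- `|φ|`, the number of clauses plus the number of variables. -/
def CNF.size (φ : CNF) : ℕ := φ.m + φ.n

def CNF.Satisfiable (φ : CNF) : Prop :=
  ∃ A : Fin φ.n → Bool, ∀ c : Fin φ.m, ∃ l ∈ φ.clause c, A l.1 = l.2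

/-- The incidence graph: variables on one side, clauses on the other, and an edge whenever the
variable appears (negated or not) in the clause. -/
def CNF.incidenceGraph (φ : CNF) : SimpleGraph (Fin φ.n ⊕ Fin φ.m) :=
  SimpleGraph.fromRel fun u v =>
    ∃ (x : Fin φ.n) (c : Fin φ.m) (b : Bool), u = Sum.inl x ∧ v = Sum.inr c ∧ (x, b) ∈ φ.clause c

/-! ### Tree decompositions -/

/-- A tree decomposition of `G` with `N` nodes. -/
structure TreeDecomposition {V : Type} (G : SimpleGraph V) (N : ℕ) where
  tree : SimpleGraph (Fin N)
  isTree : tree.IsTree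
  bag : Fin N → Finset V
  cover : ∀ v : V, ∃ t, v ∈ bag t
  edge : ∀ u v : V, G.Adj u v → ∃ t, u ∈ bag t ∧ v ∈ bag t
  subtree : ∀ v : V, (tree.induce {t | v ∈ bag t}).Connected

/-- The width: maximal size of a bag, minus one. -/
def TreeDecomposition.width {V : Type} {G : SimpleGraph V} {N : ℕ}
    (D : TreeDecomposition G N) : ℕ :=
  (Finset.univ.sup fun t => (D.bag t).card) - 1

open Classical in
/-- The maximal degree `d` of the tree of the decomposition. -/
noncomputable def TreeDecomposition.maxDegree {V : Type} {G : SimpleGraph V} {N : ℕ}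
    (D : TreeDecomposition G N) : ℕ :=
  D.tree.maxDegree

/-! ### The machine model: a random access machine with logarithmic costs -/

/-- Arithmetic of the machine (natural numbers, truncated subtraction, integer division). -/
inductive Op where
  | add
  | sub
  | mul
  | div

def Op.eval : Op → ℕ → ℕ → ℕ
  | .add, a, b => a + b
  | .sub, a, b => a - b
  | .mul, a, b => a * b
  | .div, a, b => a / b

/-- Programs. `R[i]` is the register with the (fixed) number `i`, `M[a]` the memory cell with
address `a`; `M` is reached only through registers. -/
inductive Prog where
  /-- `R[i] := c` -/
  | const (i c : ℕ)
  /-- `R[i] := R[j] o R[k]` -/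
  | op (o : Op) (i j k : ℕ)
  /-- `R[i] := M[R[j]]` -/
  | load (i j : ℕ)
  /-- `M[R[i]] := R[j]` -/
  | store (i j : ℕ)
  /-- `p; q` -/
  | seq (p q : Prog)
  /-- `if R[i] ≠ 0 then p else q` -/
  | ite (i : ℕ) (p q : Prog)
  /-- `while R[i] ≠ 0 do p` -/
  | loop (i : ℕ) (p : Prog)

/-- A configuration: the contents of the registers and of the memory, both zero almost
everywhere. -/
structure State where
  reg : ℕ →₀ ℕ
  mem : ℕ →₀ ℕ

/-- The number of bits that a configuration occupies: each nonzero register or memory cell is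
charged the bit lengths of its address and of its content. -/
def State.bits (σ : State) : ℕ :=
  (σ.reg.sum fun i v => Nat.size i + Nat.size v) + (σ.mem.sum fun a v => Nat.size a + Nat.size v)

noncomputable def State.setReg (σ : State) (i v : ℕ) : State :=
  { σ with reg := σ.reg.update i v }

noncomputable def State.setMem (σ : State) (a v : ℕ) : State :=
  { σ with mem := σ.mem.update a v }

/-- `Run p σ σ' t s`: started in `σ`, the program `p` halts in `σ'`, its running time is `t` and
its space is `s`. Every instruction and every test is charged according to the bit lengths of the
numbers and addresses it handles (an arithmetic instruction at least the cost of the schoolbook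
method). The space is the maximal number of bits occupied at any moment, with the input included. -/
inductive Run : Prog → State → State → ℕ → ℕ → Prop where
  | const (i c : ℕ) (σ : State) :
      Run (.const i c) σ (σ.setReg i c) (1 + Nat.size c) (max σ.bits (σ.setReg i c).bits)
  | op (o : Op) (i j k : ℕ) (σ : State) :
      Run (.op o i j k) σ (σ.setReg i (o.eval (σ.reg j) (σ.reg k)))
        ((1 + Nat.size (σ.reg j)) * (1 + Nat.size (σ.reg k)))
        (max σ.bits (σ.setReg i (o.eval (σ.reg j) (σ.reg k))).bits)
  | load (i j : ℕ) (σ : State) :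
      Run (.load i j) σ (σ.setReg i (σ.mem (σ.reg j)))
        (1 + Nat.size (σ.reg j) + Nat.size (σ.mem (σ.reg j)))
        (max σ.bits (σ.setReg i (σ.mem (σ.reg j))).bits)
  | store (i j : ℕ) (σ : State) :
      Run (.store i j) σ (σ.setMem (σ.reg i) (σ.reg j))
        (1 + Nat.size (σ.reg i) + Nat.size (σ.reg j))
        (max σ.bits (σ.setMem (σ.reg i) (σ.reg j)).bits)
  | seq {p q : Prog} {σ₁ σ₂ σ₃ : State} {t₁ t₂ s₁ s₂ : ℕ} :
      Run p σ₁ σ₂ t₁ s₁ → Run q σ₂ σ₃ t₂ s₂ → Run (.seq p q) σ₁ σ₃ (t₁ + t₂) (max s₁ s₂)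
  | ite_true {i : ℕ} {p q : Prog} {σ σ' : State} {t s : ℕ} :
      σ.reg i ≠ 0 → Run p σ σ' t s → Run (.ite i p q) σ σ' (1 + Nat.size (σ.reg i) + t) s
  | ite_false {i : ℕ} {p q : Prog} {σ σ' : State} {t s : ℕ} :
      σ.reg i = 0 → Run q σ σ' t s → Run (.ite i p q) σ σ' (1 + t) s
  | loop_done {i : ℕ} {p : Prog} {σ : State} :
      σ.reg i = 0 → Run (.loop i p) σ σ 1 σ.bits
  | loop_step {i : ℕ} {p : Prog} {σ₁ σ₂ σ₃ : State} {t₁ t₂ s₁ s₂ : ℕ} :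
      σ₁.reg i ≠ 0 → Run p σ₁ σ₂ t₁ s₁ → Run (.loop i p) σ₂ σ₃ t₂ s₂ →
      Run (.loop i p) σ₁ σ₃ (1 + Nat.size (σ₁.reg i) + t₁ + t₂) (max s₁ s₂)

/-! ### The input -/

open Classical in
/-- A truth value as a number. -/
noncomputable def bit (p : Prop) : ℕ := if p then 1 else 0

/-- The 0/1 table of a relation, row by row. -/
noncomputable def table {a b : ℕ} (r : Fin a → Fin b → Prop) : List ℕ :=
  List.ofFn fun k : Fin (a * b) => bit (r (finProdFinEquiv.symm k).1 (finProdFinEquiv.symm k).2)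

/-- The input: the numbers of variables, of clauses and of tree nodes, then the 0/1 tables of the
positive and of the negative literals of the clauses, of the adjacency of the tree, and of the
variables and of the clauses in the bags. -/
noncomputable def encode (φ : CNF) {N : ℕ} (D : TreeDecomposition φ.incidenceGraph N) : List ℕ :=
  [φ.n, φ.m, N] ++
    (table fun c x => (x, true) ∈ φ.clause c) ++
    (table fun c x => (x, false) ∈ φ.clause c) ++
    (table fun t t' => D.tree.Adj t t') ++
    (table fun (t : Fin N) (x : Fin φ.n) => Sum.inl x ∈ D.bag t) ++
    (table fun (t : Fin N) (c : Fin φ.m) => Sum.inr c ∈ D.bag t)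

/-- The initial configuration: the input occupies the memory cells `0, 1, 2, …`, and everything
else is zero. -/
noncomputable def initial (φ : CNF) {N : ℕ} (D : TreeDecomposition φ.incidenceGraph N) : State where
  reg := 0
  mem := (encode φ D).toFinsupp

end SatTW

/-! Satisfiability is decided by counting. Let every clause be selected or not; a selected clause
has the weight `-1` if none of its literals is true and `0` otherwise, an unselected clause has the
weight `1`. The two choices add up to `1` for a satisfied clause and to `0` for a falsified one, so
the number of satisfying assignments is the sum, over all assignments and all sets of selected
clauses, of a product of local weights. A node of the decomposition sees a partial assignment of its
bag, coded by at most `w + 1` bits for width `w`; agreement along tree edges makes these local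
states global, and the count becomes a sum-product over the states of all nodes
(`Inst.Valid.sum_states`). All numbers are residues modulo `2 ^ n + 1`: there `-1` is `2 ^ n`, and
the count, which is at most `2 ^ n`, can be read off.

Message passing with full tables would need about `2 ^ w` space. Here the tables keep only the lower
`q = ⌊a w⌋` bits of a state, and the upper `w + 1 - q` bits are guessed, that is, summed over by
loops. To keep the nesting of these loops shallow, every node gets one of `L ≤ log N + 1` ranks such
that two nodes of equal rank are separated by a node of higher rank (`Rooted.ranking`, from the
binary digits of subtree sizes). From any node at most one node of each rank is visible through
lower ranks (`Model.same_rank_unique`). Hence a counter with one digit per rank suffices: all nodes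
of a rank share the digit and run through their guesses simultaneously. For each value of digit `r`
the ranks below `r` are run completely. `Model.block` shows by induction on `r` that such a run
yields the messages that leave the region of ranks below `r`. The number of events is below `(4 G) ^
L` with `G = 2 ^ (w + 1 - q)`.

The procedure is written in a small language of bounded loops over arrays, verified by a program
logic, and compiled to the machine with overheads that depend on the program only (`Ex.code_spec`,
`Cm.code_spec`). With `s` the input size and `T = s * 2 ^ q`, an event costs at most `κ * T ^ κ`
instructions and the arrays have `O(T)` cells (`satProg_run`).

Finally `a = p / r` is a rational number with `a ≤ 2 ε` and `1 - a < 1.441 (1 - ε)`. The first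
inequality is the space bound. The time is `2` to the power `(1 - a) w log N + O(w + log N)`; the
term `O(log N)` is polynomial, and `O(w)` disappears for large `N` in the gap of the second
inequality. Since `d ≥ 2` for `N ≥ 3`, powers of `2` are bounded by powers of `d`. -/

namespace SatTW

/-! ### Bounded configurations -/

/-- Only registers below `D` and memory cells below `Y` are used, and all contents have at most
`V` bits. -/
def State.Within (D V Y : ℕ) (σ : State) : Prop :=
  (∀ i, D ≤ i → σ.reg i = 0) ∧ (∀ i, σ.reg i < 2 ^ V) ∧
    (∀ a, Y ≤ a → σ.mem a = 0) ∧ (∀ a, σ.mem a < 2 ^ V)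

theorem finsupp_bits_le (f : ℕ →₀ ℕ) {D V : ℕ} (hD : D ≤ 2 ^ V) (h0 : ∀ i, D ≤ i → f i = 0)
    (hV : ∀ i, f i < 2 ^ V) : (f.sum fun i v => Nat.size i + Nat.size v) ≤ D * (2 * V) := by
  have hs : f.support ⊆ Finset.range D := by
    intro i hi
    rw [Finset.mem_range]
    by_contra h
    exact (Finsupp.mem_support_iff.1 hi) (h0 i (not_lt.1 h))
  calc (f.sum fun i v => Nat.size i + Nat.size v)
      ≤ ∑ _i ∈ f.support, 2 * V := by
        refine Finset.sum_le_sum fun i hi => ?_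
        have h1 : Nat.size i ≤ V :=
          Nat.size_le.2 (lt_of_lt_of_le (Finset.mem_range.1 (hs hi)) hD)
        have h2 : Nat.size (f i) ≤ V := Nat.size_le.2 (hV i)
        dsimp only
        omega
    _ = f.support.card * (2 * V) := by rw [Finset.sum_const, smul_eq_mul]
    _ ≤ D * (2 * V) := by
        refine Nat.mul_le_mul_right _ ?_
        simpa using Finset.card_le_card hs

theorem State.Within.bits_le {D V Y : ℕ} {σ : State} (h : σ.Within D V Y) (hD : D ≤ 2 ^ V)
    (hY : Y ≤ 2 ^ V) : σ.bits ≤ (D + Y) * (2 * V) := by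
  have h1 := finsupp_bits_le σ.reg hD h.1 h.2.1
  have h2 := finsupp_bits_le σ.mem hY h.2.2.1 h.2.2.2
  unfold State.bits
  rw [Nat.add_mul]
  omega

@[simp] theorem State.setReg_reg (σ : State) (i v j : ℕ) :
    (σ.setReg i v).reg j = if j = i then v else σ.reg j := by
  simp [State.setReg, Finsupp.update_apply]

@[simp] theorem State.setReg_mem (σ : State) (i v : ℕ) : (σ.setReg i v).mem = σ.mem := rfl

@[simp] theorem State.setMem_mem (σ : State) (i v j : ℕ) :
    (σ.setMem i v).mem j = if j = i then v else σ.mem j := by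
  simp [State.setMem, Finsupp.update_apply]

@[simp] theorem State.setMem_reg (σ : State) (i v : ℕ) : (σ.setMem i v).reg = σ.reg := rfl

theorem State.Within.setReg {D V Y i v : ℕ} {σ : State} (h : σ.Within D V Y) (hi : i < D)
    (hv : v < 2 ^ V) : (σ.setReg i v).Within D V Y := by
  refine ⟨fun j hj => ?_, fun j => ?_, h.2.2.1, h.2.2.2⟩
  · rw [State.setReg_reg, if_neg (by omega)]
    exact h.1 j hj
  · rw [State.setReg_reg]
    split
    · exact hv
    · exact h.2.1 j

theorem State.Within.setMem {D V Y i v : ℕ} {σ : State} (h : σ.Within D V Y) (hi : i < Y)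
    (hv : v < 2 ^ V) : (σ.setMem i v).Within D V Y := by
  refine ⟨h.1, h.2.1, fun j hj => ?_, fun j => ?_⟩
  · rw [State.setMem_mem, if_neg (by omega)]
    exact h.2.2.1 j hj
  · rw [State.setMem_mem]
    split
    · exact hv
    · exact h.2.2.2 j

/-- The bounds on a computation: number of registers, bits per cell, number of memory cells. -/
structure Bounds where
  D : ℕ
  V : ℕ
  Y : ℕ
  hD : D ≤ 2 ^ V
  hY : Y ≤ 2 ^ V

/-- `p` leads from `σ` to `σ'` with at most `n` instructions and tests, within the bounds. -/
def Exec (b : Bounds) (p : Prog) (σ σ' : State) (n : ℕ) : Prop :=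
  σ'.Within b.D b.V b.Y ∧
    ∃ t s, Run p σ σ' t s ∧ t ≤ n * (b.V + 1) ^ 2 ∧ s ≤ (b.D + b.Y) * (2 * b.V)

section
variable {b : Bounds} {σ σ₁ σ₂ σ₃ : State} {p q : Prog} {n n₁ n₂ : ℕ}

theorem Exec.mono (h : Exec b p σ σ₁ n₁) (hn : n₁ ≤ n₂) : Exec b p σ σ₁ n₂ := by
  obtain ⟨hw, t, s, hr, ht, hs⟩ := h
  exact ⟨hw, t, s, hr, ht.trans (Nat.mul_le_mul_right _ hn), hs⟩

theorem State.Within.bits_le' (h : σ.Within b.D b.V b.Y) :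
    σ.bits ≤ (b.D + b.Y) * (2 * b.V) := h.bits_le b.hD b.hY

theorem Exec.const {i c : ℕ} (h : σ.Within b.D b.V b.Y) (hi : i < b.D) (hc : c < 2 ^ b.V) :
    Exec b (.const i c) σ (σ.setReg i c) 1 := by
  have h' := h.setReg hi hc
  refine ⟨h', _, _, Run.const i c σ, ?_, max_le h.bits_le' h'.bits_le'⟩
  have := Nat.size_le.2 hc
  nlinarith

/-- Arithmetic is charged by a product of two bit lengths; this is the origin of the factor `(b.V +
1) ^ 2` per instruction in `Exec`. -/
theorem Exec.op {o : Op} {i j k : ℕ} (h : σ.Within b.D b.V b.Y) (hi : i < b.D)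
    (hc : o.eval (σ.reg j) (σ.reg k) < 2 ^ b.V) :
    Exec b (.op o i j k) σ (σ.setReg i (o.eval (σ.reg j) (σ.reg k))) 1 := by
  have h' := h.setReg hi hc
  refine ⟨h', _, _, Run.op o i j k σ, ?_, max_le h.bits_le' h'.bits_le'⟩
  have h1 := Nat.size_le.2 (h.2.1 j)
  have h2 := Nat.size_le.2 (h.2.1 k)
  rw [one_mul, sq]
  exact Nat.mul_le_mul (by omega) (by omega)

theorem Exec.load {i j : ℕ} (h : σ.Within b.D b.V b.Y) (hi : i < b.D) :
    Exec b (.load i j) σ (σ.setReg i (σ.mem (σ.reg j))) 1 := by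
  have h' := h.setReg hi (h.2.2.2 (σ.reg j))
  refine ⟨h', _, _, Run.load i j σ, ?_, max_le h.bits_le' h'.bits_le'⟩
  have h1 := Nat.size_le.2 (h.2.1 j)
  have h2 := Nat.size_le.2 (h.2.2.2 (σ.reg j))
  nlinarith

theorem Exec.store {i j : ℕ} (h : σ.Within b.D b.V b.Y) (hi : σ.reg i < b.Y) :
    Exec b (.store i j) σ (σ.setMem (σ.reg i) (σ.reg j)) 1 := by
  have h' := h.setMem hi (h.2.1 j)
  refine ⟨h', _, _, Run.store i j σ, ?_, max_le h.bits_le' h'.bits_le'⟩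
  have h1 := Nat.size_le.2 (h.2.1 j)
  have h2 := Nat.size_le.2 (h.2.1 i)
  nlinarith

theorem Exec.seq (h₁ : Exec b p σ₁ σ₂ n₁) (h₂ : Exec b q σ₂ σ₃ n₂) :
    Exec b (.seq p q) σ₁ σ₃ (n₁ + n₂) := by
  obtain ⟨_, t, s, hr, ht, hs⟩ := h₁
  obtain ⟨hw, t', s', hr', ht', hs'⟩ := h₂
  refine ⟨hw, _, _, Run.seq hr hr', ?_, max_le hs hs'⟩
  rw [Nat.add_mul]
  omega

theorem size_reg_le (h : σ.Within b.D b.V b.Y) (i : ℕ) :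
    1 + Nat.size (σ.reg i) ≤ (b.V + 1) ^ 2 := by
  have h1 := Nat.size_le.2 (h.2.1 i)
  nlinarith

theorem Exec.ite_true {i : ℕ} (hw : σ.Within b.D b.V b.Y) (hi : σ.reg i ≠ 0)
    (h : Exec b p σ σ₁ n) : Exec b (.ite i p q) σ σ₁ (n + 1) := by
  obtain ⟨hw', t, s, hr, ht, hs⟩ := h
  refine ⟨hw', _, _, Run.ite_true hi hr, ?_, hs⟩
  have := size_reg_le hw i
  rw [Nat.add_mul]
  omega

theorem Exec.ite_false {i : ℕ} (hi : σ.reg i = 0)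
    (h : Exec b q σ σ₁ n) : Exec b (.ite i p q) σ σ₁ (n + 1) := by
  obtain ⟨hw', t, s, hr, ht, hs⟩ := h
  refine ⟨hw', _, _, Run.ite_false hi hr, ?_, hs⟩
  have : 1 ≤ (b.V + 1) ^ 2 := Nat.one_le_pow _ _ (by omega)
  rw [Nat.add_mul]
  omega

theorem Exec.loop_done {i : ℕ} (hw : σ.Within b.D b.V b.Y) (hi : σ.reg i = 0) :
    Exec b (.loop i p) σ σ 1 := by
  refine ⟨hw, _, _, Run.loop_done hi, ?_, hw.bits_le'⟩
  have : 1 ≤ (b.V + 1) ^ 2 := Nat.one_le_pow _ _ (by omega)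
  omega

theorem Exec.loop_step {i : ℕ} (hw : σ₁.Within b.D b.V b.Y) (hi : σ₁.reg i ≠ 0)
    (h₁ : Exec b p σ₁ σ₂ n₁) (h₂ : Exec b (.loop i p) σ₂ σ₃ n₂) :
    Exec b (.loop i p) σ₁ σ₃ (n₁ + n₂ + 1) := by
  obtain ⟨_, t, s, hr, ht, hs⟩ := h₁
  obtain ⟨hw', t', s', hr', ht', hs'⟩ := h₂
  refine ⟨hw', _, _, Run.loop_step hi hr hr', ?_, max_le hs hs'⟩
  have := size_reg_le hw i
  rw [Nat.add_mul, Nat.add_mul]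
  omega

/-- A loop that counts register `i` down from `c`, with an invariant. -/
theorem Exec.loop_countdown {i c m : ℕ} (Inv : ℕ → State → Prop)
    (hInv : ∀ k σ, Inv k σ → σ.Within b.D b.V b.Y ∧ σ.reg i = c - k)
    (hstep : ∀ k σ, k < c → Inv k σ → ∃ σ', Exec b p σ σ' m ∧ Inv (k + 1) σ')
    (h0 : Inv 0 σ) :
    ∃ σ', Exec b (.loop i p) σ σ' (c * (m + 1) + 1) ∧ Inv c σ' := by
  have key : ∀ j k σ, k + j = c → Inv k σ →
      ∃ σ', Exec b (.loop i p) σ σ' (j * (m + 1) + 1) ∧ Inv c σ' := by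
    intro j
    induction j with
    | zero =>
      intro k σ hk hI
      obtain rfl : k = c := by omega
      obtain ⟨hw, hr⟩ := hInv _ _ hI
      exact ⟨σ, by simpa using Exec.loop_done hw (by omega), hI⟩
    | succ j ih =>
      intro k σ hk hI
      obtain ⟨hw, hr⟩ := hInv _ _ hI
      obtain ⟨σ', he, hI'⟩ := hstep k σ (by omega) hI
      obtain ⟨σ'', he', hI''⟩ := ih (k + 1) σ' (by omega) hI'
      refine ⟨σ'', (Exec.loop_step hw (by omega) he he').mono ?_, hI''⟩
      rw [Nat.add_mul]
      omega
  exact key c 0 σ (by omega) h0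

/-- Copying a register. -/
def Prog.move (i j : ℕ) : Prog := .seq (.const i 0) (.op .add i i j)

theorem Exec.move {i j : ℕ} (h : σ.Within b.D b.V b.Y) (hi : i < b.D) (hij : j ≠ i) :
    ∃ σ', Exec b (.move i j) σ σ' 2 ∧ σ'.mem = σ.mem ∧
      ∀ r, σ'.reg r = if r = i then σ.reg j else σ.reg r := by
  have h1 := Exec.const (c := 0) h hi (by positivity)
  have h2 := Exec.op (o := .add) (i := i) (j := i) (k := j) h1.1 hi (by
    simpa [Op.eval, hij] using h.2.1 j)
  refine ⟨_, h1.seq h2, rfl, fun r => ?_⟩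
  by_cases hr : r = i <;> simp [Op.eval, hij, hr]

end

end SatTW

namespace SatTW

/-! ### A language of bounded loops over arrays, and its compilation -/

/-- `iterN n a f` is `f (n-1) (… (f 1 (f 0 a)))`. -/
def iterN {α : Type} : ℕ → α → (ℕ → α → α) → α
  | 0, a, _ => a
  | n + 1, a, f => f n (iterN n a f)

@[simp] theorem iterN_zero {α : Type} (a : α) (f : ℕ → α → α) : iterN 0 a f = a := rfl

theorem iterN_succ {α : Type} (n : ℕ) (a : α) (f : ℕ → α → α) :
    iterN (n + 1) a f = f n (iterN n a f) := rfl

/-- Number of arrays. -/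
abbrev numArr : ℕ := 16

/-- Bound for the names of variables. -/
abbrev nameLimit : ℕ := 300

/-- Expressions: variables, array elements, input cells, and bounded iteration;
`iter x n a b` binds the counter to the variable `x` and the accumulator to the variable `x + 1`
in `b`. -/
inductive Ex where
  | const (c : ℕ)
  | var (x : ℕ)
  | op (o : Op) (a b : Ex)
  | arr (j : ℕ) (a : Ex)
  | inp (a : Ex)
  | iter (x : ℕ) (n a b : Ex)

/-- Assigning a value to a variable. -/
def upd (env : ℕ → ℕ) (x v : ℕ) : ℕ → ℕ := fun y => if y = x then v else env y

@[simp] theorem upd_apply (env : ℕ → ℕ) (x v y : ℕ) :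
    upd env x v y = if y = x then v else env y := rfl

def Ex.ev (I : ℕ → ℕ) (A : ℕ → ℕ → ℕ) : Ex → (ℕ → ℕ) → ℕ
  | .const c, _ => c
  | .var x, env => env x
  | .op o a b, env => o.eval (a.ev I A env) (b.ev I A env)
  | .arr j a, env => A j (a.ev I A env)
  | .inp a, env => I (a.ev I A env)
  | .iter x n a b, env =>
      iterN (n.ev I A env) (a.ev I A env) fun i acc => b.ev I A (upd (upd env x i) (x + 1) acc)

/-- The variables are those below the scope, and binders bind the next variables. -/
def Ex.WF : Ex → ℕ → Prop
  | .const _, _ => True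
  | .var x, sc => x < sc
  | .op _ a b, sc => a.WF sc ∧ b.WF sc
  | .arr j a, sc => j < numArr ∧ a.WF sc
  | .inp a, sc => a.WF sc
  | .iter x n a b, sc => x = sc ∧ x + 3 ≤ nameLimit ∧ n.WF sc ∧ a.WF sc ∧ b.WF (x + 2)

/-- Accumulators stay below `2 ^ β`, numbers of rounds are at most `T`, and only the first `len`
input cells are read. -/
def Ex.Safe (I : ℕ → ℕ) (len β T : ℕ) (A : ℕ → ℕ → ℕ) : Ex → (ℕ → ℕ) → Prop
  | .const _, _ => True
  | .var _, _ => True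
  | .op _ a b, env => a.Safe I len β T A env ∧ b.Safe I len β T A env
  | .arr _ a, env => a.Safe I len β T A env
  | .inp a, env => a.Safe I len β T A env ∧ a.ev I A env < len
  | .iter x n a b, env =>
      n.Safe I len β T A env ∧ a.Safe I len β T A env ∧ n.ev I A env ≤ T ∧
      (∀ k, k ≤ n.ev I A env → iterN k (a.ev I A env)
          (fun i acc => b.ev I A (upd (upd env x i) (x + 1) acc)) < 2 ^ β) ∧
      ∀ k, k < n.ev I A env → b.Safe I len β T A (upd (upd env x k) (x + 1)
        (iterN k (a.ev I A env) fun i acc => b.ev I A (upd (upd env x i) (x + 1) acc)))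

/-- The code of an expression; the value is left in register `d`. The variable `x` lives in register
`x + 1`, and register `0` holds the address where the arrays begin. -/
def Ex.code : Ex → ℕ → Prog
  | .const c, d => .const d c
  | .var x, d => .move d (x + 1)
  | .op o a b, d => .seq (a.code d) (.seq (b.code (d + 1)) (.op o d d (d + 1)))
  | .arr j a, d => .seq (a.code d) (.seq (.const (d + 1) numArr) (.seq (.op .mul d d (d + 1))
      (.seq (.const (d + 1) j) (.seq (.op .add d d (d + 1)) (.seq (.op .add d 0 d) (.load d d))))))
  | .inp a, d => .seq (a.code d) (.load d d)
  | .iter x n a b, d => .seq (n.code d) (.seq (a.code (d + 1)) (.seq (.move (x + 2) (d + 1))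
      (.seq (.const (x + 1) 0) (.seq
        (.loop d (.seq (b.code (d + 1)) (.seq (.move (x + 2) (d + 1)) (.seq (.const (d + 1) 1)
          (.seq (.op .add (x + 1) (x + 1) (d + 1)) (.op .sub d d (d + 1)))))))
        (.move d (x + 2))))))

/-- The parameters of a compilation: machine bounds `b`; bit length `β` of variables and array
elements; bound `T` on the rounds of inner loops; length `X` of the arrays, which begin at address
`base`; and the read-only input `I` of `len` cells. -/
structure Ctx where
  b : Bounds
  β : ℕ
  T : ℕ
  X : ℕ
  base : ℕ
  len : ℕ
  I : ℕ → ℕ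

/-- Intermediate values may exceed `2 ^ β`, but between two variables, array elements, input cells
or accumulators there are only boundedly many operations. So `κ * β` bits are enough, with `κ`
depending on the expression alone. -/
structure Ctx.Ok (cx : Ctx) (κ : ℕ) : Prop where
  β : 1 ≤ cx.β
  T : 1 ≤ cx.T
  Tlt : cx.T < 2 ^ cx.β
  base : cx.base < 2 ^ cx.β
  V : κ * cx.β ≤ cx.b.V
  I : ∀ a, a < cx.len → cx.I a < 2 ^ cx.β

theorem Ctx.Ok.mono {cx : Ctx} {κ κ' : ℕ} (h : cx.Ok κ) (hk : κ' ≤ κ) : cx.Ok κ' :=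
  { h with V := (Nat.mul_le_mul_right _ hk).trans h.V }

/-- The configuration `σ` represents the arrays `A` and the values `env` of the variables. -/
structure Represents (cx : Ctx) (sc : ℕ) (env : ℕ → ℕ) (A : ℕ → ℕ → ℕ) (σ : State) : Prop where
  within : σ.Within cx.b.D cx.b.V cx.b.Y
  base : σ.reg 0 = cx.base
  vars : ∀ x, x < sc → σ.reg (x + 1) = env x
  vars_lt : ∀ x, x < sc → env x < 2 ^ cx.β
  inp : ∀ a, a < cx.len → σ.mem a = cx.I a
  -- The arrays are interleaved, so addresses do not depend on the length of the arrays, which is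
  -- known only at run time.
  arr : ∀ j, j < numArr → ∀ i, σ.mem (cx.base + (i * numArr + j)) = A j i
  arr_lt : ∀ j, j < numArr → ∀ i, A j i < 2 ^ cx.β

theorem Represents.of_eq {cx : Ctx} {sc : ℕ} {env : ℕ → ℕ} {A : ℕ → ℕ → ℕ} {σ σ' : State}
    (h : Represents cx sc env A σ) (hw : σ'.Within cx.b.D cx.b.V cx.b.Y) (hm : σ'.mem = σ.mem)
    (hr : ∀ i, i ≤ sc → σ'.reg i = σ.reg i) : Represents cx sc env A σ' where
  within := hw
  base := by rw [hr 0 (Nat.zero_le _), h.base]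
  vars x hx := by rw [hr _ hx, h.vars x hx]
  vars_lt := h.vars_lt
  inp := by rw [hm]; exact h.inp
  arr := by rw [hm]; exact h.arr
  arr_lt := h.arr_lt

theorem add_lt_two_pow {x y a c β κ : ℕ} (hβ : 1 ≤ β) (hx : x < 2 ^ (a * β)) (hy : y < 2 ^ (c * β))
    (hκ : a + c + 1 ≤ κ) : x + y < 2 ^ (κ * β) := by
  have h1 : 2 ^ (a * β) ≤ 2 ^ ((a + c) * β) :=
    Nat.pow_le_pow_right (by norm_num) (Nat.mul_le_mul_right _ (by omega))
  have h2 : 2 ^ (c * β) ≤ 2 ^ ((a + c) * β) :=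
    Nat.pow_le_pow_right (by norm_num) (Nat.mul_le_mul_right _ (by omega))
  have h3 : 2 ^ ((a + c) * β + 1) ≤ 2 ^ (κ * β) :=
    Nat.pow_le_pow_right (by norm_num) (by nlinarith)
  rw [pow_succ] at h3
  omega

theorem mul_lt_two_pow {x y a c β κ : ℕ} (hx : x < 2 ^ (a * β)) (hy : y < 2 ^ (c * β))
    (hκ : a + c ≤ κ) : x * y < 2 ^ (κ * β) := by
  calc x * y < 2 ^ (a * β) * 2 ^ (c * β) := Nat.mul_lt_mul'' hx hy
    _ = 2 ^ ((a + c) * β) := by rw [← pow_add, Nat.add_mul]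
    _ ≤ _ := Nat.pow_le_pow_right (by norm_num) (Nat.mul_le_mul_right _ hκ)

theorem lt_two_pow_mono {x a β κ : ℕ} (hx : x < 2 ^ (a * β)) (hκ : a ≤ κ) : x < 2 ^ (κ * β) :=
  hx.trans_le (Nat.pow_le_pow_right (by norm_num) (Nat.mul_le_mul_right _ hκ))

theorem const_lt_two_pow (c : ℕ) {β κ : ℕ} (hβ : 1 ≤ β) (hκ : c ≤ κ) : c < 2 ^ (κ * β) :=
  (Nat.lt_two_pow_self).trans_le (Nat.pow_le_pow_right (by norm_num) (by nlinarith))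

theorem Op.eval_lt {o : Op} {x y a c β κ : ℕ} (hβ : 1 ≤ β) (hx : x < 2 ^ (a * β))
    (hy : y < 2 ^ (c * β)) (hκ : a + c + 1 ≤ κ) : o.eval x y < 2 ^ (κ * β) := by
  cases o with
  | add => exact add_lt_two_pow hβ hx hy hκ
  | sub => exact (Nat.sub_le x y).trans_lt (lt_two_pow_mono hx (by omega))
  | mul => exact mul_lt_two_pow hx hy (by omega)
  | div => exact (Nat.div_le_self x y).trans_lt (lt_two_pow_mono hx (by omega))

/-- The effect of the code of an expression with value `v`. -/
def ExSpec (cx : Ctx) (κ n sc d : ℕ) (p : Prog) (v : ℕ) (σ : State) : Prop :=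
  v < 2 ^ (κ * cx.β) ∧ ∃ σ', Exec cx.b p σ σ' n ∧ σ'.mem = σ.mem ∧ σ'.reg d = v ∧
    (∀ i, i ≤ sc → σ'.reg i = σ.reg i) ∧ ∀ i, nameLimit ≤ i → i < d → σ'.reg i = σ.reg i

theorem coeff_pow_le {a k κ T : ℕ} (hT : 1 ≤ T) (hk : k ≤ κ) : a * T ^ k ≤ a * T ^ κ :=
  Nat.mul_le_mul_left _ (Nat.pow_le_pow_right hT hk)

/-- Structural induction. One constant `κ` bounds three things: the word length in units of `β`, the
number of registers used from `d` on, and the running time `κ * T ^ κ`, in which each nested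
iteration costs one more factor `T`. Registers from `nameLimit` on form a stack: code for `d` leaves
the stack below `d` and the variables in scope untouched, which lets the specifications of
subexpressions be combined. -/
theorem Ex.code_spec (e : Ex) : ∃ κ, ∀ (cx : Ctx) (A : ℕ → ℕ → ℕ) (env : ℕ → ℕ) (sc d : ℕ)
    (σ : State), cx.Ok κ → e.WF sc → sc < nameLimit → nameLimit ≤ d → d + κ ≤ cx.b.D →
    Represents cx sc env A σ →
    e.Safe cx.I cx.len cx.β cx.T A env →
    ExSpec cx κ (κ * cx.T ^ κ) sc d (e.code d) (e.ev cx.I A env) σ := by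
  induction e with
  | const c =>
    refine ⟨c + 1, fun cx A env sc d σ hok hwf hsc hd hD hrel hs => ?_⟩
    have hc : c < 2 ^ ((c + 1) * cx.β) := const_lt_two_pow c hok.β (by omega)
    have h := Exec.const (i := d) hrel.within (by omega)
      (hc.trans_le (Nat.pow_le_pow_right (by norm_num) hok.V))
    refine ⟨hc, _, h.mono ?_, rfl, by simp [Ex.ev], fun i hi => ?_, fun i _ hi => ?_⟩
    · have := Nat.one_le_pow (c + 1) cx.T hok.T
      nlinarith
    · simp; omega
    · simp; omega
  | var x =>
    refine ⟨2, fun cx A env sc d σ hok hwf hsc hd hD hrel hs => ?_⟩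
    simp only [Ex.WF] at hwf
    obtain ⟨σ', h, hm, hr⟩ := Exec.move (i := d) (j := x + 1) hrel.within (by omega) (by omega)
    refine ⟨lt_two_pow_mono (a := 1) (by simpa [Ex.ev] using hrel.vars_lt x hwf) (by omega), _, h.mono ?_, hm,
      ?_, fun i hi => ?_, fun i _ hi => ?_⟩
    · have := Nat.one_le_pow 2 cx.T hok.T
      omega
    · rw [hr, if_pos rfl, hrel.vars x hwf]; rfl
    · rw [hr, if_neg (by omega)]
    · rw [hr, if_neg (by omega)]
  | op o a b iha ihb =>
    obtain ⟨κa, iha⟩ := iha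
    obtain ⟨κb, ihb⟩ := ihb
    refine ⟨κa + κb + 1, fun cx A env sc d σ hok hwf hsc hd hD hrel hs => ?_⟩
    obtain ⟨hwa, hwb⟩ := hwf
    obtain ⟨hsa, hsb⟩ := hs
    obtain ⟨hva, σ₁, h1, hm1, hr1, hl1, hh1⟩ :=
      iha cx A env sc d σ (hok.mono (by omega)) hwa hsc hd (by omega) hrel hsa
    have hrel1 := hrel.of_eq h1.1 hm1 hl1
    obtain ⟨hvb, σ₂, h2, hm2, hr2, hl2, hh2⟩ :=
      ihb cx A env sc (d + 1) σ₁ (hok.mono (by omega)) hwb hsc (by omega) (by omega) hrel1 hsb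
    have hv : (Ex.op o a b).ev cx.I A env < 2 ^ ((κa + κb + 1) * cx.β) :=
      Op.eval_lt hok.β hva hvb le_rfl
    have hv' := hv.trans_le (Nat.pow_le_pow_right (by norm_num) hok.V)
    have hd2 : σ₂.reg d = a.ev cx.I A env := by rw [hh2 d hd (by omega), hr1]
    have h3 := Exec.op (o := o) (i := d) (j := d) (k := d + 1) h2.1 (by omega)
      (by rw [hd2, hr2]; exact hv')
    refine ⟨hv, _, (h1.seq (h2.seq h3)).mono ?_, ?_, ?_, fun i hi => ?_, fun i hi hid => ?_⟩
    · have e1 := coeff_pow_le (a := κa) (k := κa) (κ := κa + κb + 1) hok.T (by omega)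
      have e2 := coeff_pow_le (a := κb) (k := κb) (κ := κa + κb + 1) hok.T (by omega)
      have := Nat.one_le_pow (κa + κb + 1) cx.T hok.T
      rw [Nat.add_mul, Nat.add_mul]
      omega
    · simp [hm2, hm1]
    · simp [hd2, hr2, Ex.ev]
    · rw [State.setReg_reg, if_neg (by omega), hl2 i hi, hl1 i hi]
    · rw [State.setReg_reg, if_neg (by omega), hh2 i hi (by omega), hh1 i hi hid]
  | arr j a iha =>
    obtain ⟨κa, iha⟩ := iha
    refine ⟨κa + 50, fun cx A env sc d σ hok hwf hsc hd hD hrel hs => ?_⟩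
    obtain ⟨hj, hwa⟩ := hwf
    obtain ⟨hva, σ₁, h1, hm1, hr1, hl1, hh1⟩ :=
      iha cx A env sc d σ (hok.mono (by omega)) hwa hsc hd (by omega) hrel hs
    have hrel1 := hrel.of_eq h1.1 hm1 hl1
    have hVle : 2 ^ ((κa + 50) * cx.β) ≤ 2 ^ cx.b.V := Nat.pow_le_pow_right (by norm_num) hok.V
    have hc16 : numArr < 2 ^ (16 * cx.β) := const_lt_two_pow 16 hok.β (by omega)
    have hcj : j < 2 ^ (16 * cx.β) := const_lt_two_pow j hok.β (le_of_lt hj)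
    have hmul : a.ev cx.I A env * numArr < 2 ^ ((κa + 16) * cx.β) := mul_lt_two_pow hva hc16 le_rfl
    have hadd : a.ev cx.I A env * numArr + j < 2 ^ ((κa + 16 + 16 + 1) * cx.β) :=
      add_lt_two_pow hok.β hmul hcj le_rfl
    have hadd2 : cx.base + (a.ev cx.I A env * numArr + j) < 2 ^ ((κa + 50) * cx.β) :=
      add_lt_two_pow (a := 1) hok.β (by simpa using hok.base) hadd (by omega)
    have h2 := Exec.const (i := d + 1) (c := numArr) h1.1 (by omega)
      ((lt_two_pow_mono hc16 (by omega)).trans_le hVle)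
    have h3 := Exec.op (o := .mul) (i := d) (j := d) (k := d + 1) h2.1 (by omega)
      (by simpa [hr1, Op.eval] using (lt_two_pow_mono hmul (by omega)).trans_le hVle)
    have h4 := Exec.const (i := d + 1) (c := j) h3.1 (by omega)
      ((lt_two_pow_mono hcj (by omega)).trans_le hVle)
    have h5 := Exec.op (o := .add) (i := d) (j := d) (k := d + 1) h4.1 (by omega)
      (by simpa [hr1, Op.eval] using (lt_two_pow_mono hadd (by omega)).trans_le hVle)
    have hd0 : (0 : ℕ) ≠ d := by omega
    have h6 := Exec.op (o := .add) (i := d) (j := 0) (k := d) h5.1 (by omega)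
      (by simpa [hr1, Op.eval, hd0, hl1, hrel.base] using hadd2.trans_le hVle)
    have h7 := Exec.load (i := d) (j := d) h6.1 (by omega)
    have hlt := hrel.arr_lt j hj (a.ev cx.I A env)
    refine ⟨lt_two_pow_mono (a := 1) (by simpa [Ex.ev] using hlt) (by omega), _,
      (h1.seq (h2.seq (h3.seq (h4.seq (h5.seq (h6.seq h7)))))).mono ?_, ?_, ?_, fun i hi => ?_,
      fun i hi hid => ?_⟩
    · have e1 := coeff_pow_le (a := κa) (k := κa) (κ := κa + 50) hok.T (by omega)
      have := Nat.one_le_pow (κa + 50) cx.T hok.T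
      rw [Nat.add_mul]
      omega
    · simp [hm1]
    · simp [hr1, Op.eval, hd0, hl1, hrel.base, hm1, Ex.ev, hrel.arr j hj]
    · have h1 : i ≠ d := by omega
      have h2 : i ≠ d + 1 := by omega
      simp [h1, h2, hl1 i hi]
    · have h1 : i ≠ d := by omega
      have h2 : i ≠ d + 1 := by omega
      simp [h1, h2, hh1 i hi hid]
  | inp a iha =>
    obtain ⟨κa, iha⟩ := iha
    refine ⟨κa + 2, fun cx A env sc d σ hok hwf hsc hd hD hrel hs => ?_⟩
    obtain ⟨hsa, hlen⟩ := hs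
    obtain ⟨hva, σ₁, h1, hm1, hr1, hl1, hh1⟩ :=
      iha cx A env sc d σ (hok.mono (by omega)) hwf hsc hd (by omega) hrel hsa
    have h2 := Exec.load (i := d) (j := d) h1.1 (by omega)
    refine ⟨lt_two_pow_mono (a := 1) (by simpa [Ex.ev] using hok.I _ hlen) (by omega), _,
      (h1.seq h2).mono ?_, ?_, ?_, fun i hi => ?_, fun i hi hid => ?_⟩
    · have e1 := coeff_pow_le (a := κa) (k := κa) (κ := κa + 2) hok.T (by omega)
      have := Nat.one_le_pow (κa + 2) cx.T hok.T
      rw [Nat.add_mul]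
      omega
    · simp [hm1]
    · simp [hr1, hm1, Ex.ev, hrel.inp _ hlen]
    · rw [State.setReg_reg, if_neg (by omega), hl1 i hi]
    · rw [State.setReg_reg, if_neg (by omega), hh1 i hi hid]
  | iter x n a b ihn iha ihb =>
    obtain ⟨κn, ihn⟩ := ihn
    obtain ⟨κa, iha⟩ := iha
    obtain ⟨κb, ihb⟩ := ihb
    refine ⟨κn + κa + κb + 20, fun cx A env sc d σ hok hwf hsc hd hD hrel hs => ?_⟩
    obtain ⟨rfl, hlim, hwn, hwa, hwb⟩ := hwf
    obtain ⟨hsn, hsa, hT, hacc, hsb⟩ := hs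
    have hVle : 2 ^ ((κn + κa + κb + 20) * cx.β) ≤ 2 ^ cx.b.V :=
      Nat.pow_le_pow_right (by norm_num) hok.V
    have h1V : 1 < 2 ^ cx.b.V := (const_lt_two_pow 1 hok.β (by omega)).trans_le hVle
    have hβV : 2 ^ cx.β ≤ 2 ^ cx.b.V :=
      le_trans (Nat.pow_le_pow_right (by norm_num) (by nlinarith [hok.β])) hVle
    obtain ⟨hvn, σ₁, h1, hm1, hr1, hl1, hh1⟩ :=
      ihn cx A env x d σ (hok.mono (by omega)) hwn hsc hd (by omega) hrel hsn
    have hrel1 := hrel.of_eq h1.1 hm1 hl1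
    obtain ⟨hva, σ₂, h2, hm2, hr2, hl2, hh2⟩ :=
      iha cx A env x (d + 1) σ₁ (hok.mono (by omega)) hwa hsc (by omega) (by omega) hrel1 hsa
    obtain ⟨σ₃, h3, hm3, hr3⟩ :=
      Exec.move (i := x + 2) (j := d + 1) h2.1 (by omega) (by omega)
    have h4 := Exec.const (i := x + 1) (c := 0) h3.1 (by omega) (by positivity)
    set nv := n.ev cx.I A env with hnv
    set f : ℕ → ℕ → ℕ := fun i acc => b.ev cx.I A (upd (upd env x i) (x + 1) acc) with hf
    set av := a.ev cx.I A env with hav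
    -- After `k` rounds the bound variables hold `k` and the `k`-th accumulator, while register `d`
    -- counts down the remaining rounds. The body runs from `d + 1` on and so preserves that
    -- register.
    let Inv : ℕ → State → Prop := fun k τ => k ≤ nv ∧
      Represents cx (x + 2) (upd (upd env x k) (x + 1) (iterN k av f)) A τ ∧ τ.reg d = nv - k ∧
      τ.mem = σ.mem ∧ (∀ i, i ≤ x → τ.reg i = σ.reg i) ∧
      ∀ i, nameLimit ≤ i → i < d → τ.reg i = σ.reg i
    obtain ⟨σ₅, h5, -, hrel5, -, hm5, hl5, hh5⟩ := Exec.loop_countdown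
      (b := cx.b) (p := (.seq (b.code (d + 1)) (.seq (.move (x + 2) (d + 1)) (.seq (.const (d + 1) 1)
          (.seq (.op .add (x + 1) (x + 1) (d + 1)) (.op .sub d d (d + 1)))))))
      (σ := σ₃.setReg (x + 1) 0) (i := d) (c := nv) (m := κb * cx.T ^ κb + 5) Inv
      (fun k τ h => ⟨h.2.1.within, h.2.2.1⟩)
      (by
        rintro k τ hk ⟨-, hrel, hrd, hmem, hlow, hhigh⟩
        obtain ⟨hvb, τ₁, g1, gm1, gr1, gl1, gh1⟩ :=
          ihb cx A _ (x + 2) (d + 1) τ (hok.mono (by omega)) hwb (by omega) (by omega) (by omega)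
            hrel (hsb k hk)
        obtain ⟨τ₂, g2, gm2, gr2⟩ :=
          Exec.move (i := x + 2) (j := d + 1) g1.1 (by omega) (by omega)
        have g3 := Exec.const (i := d + 1) (c := 1) g2.1 (by omega) h1V
        have hx1 : τ₁.reg (x + 1) = k := by
          rw [gl1 _ (by omega), hrel.vars x (by omega)]; simp
        have n1 : x + 1 ≠ d + 1 := by omega
        have n2 : d ≠ d + 1 := by omega
        have n3 : d ≠ x + 1 := by omega
        have n4 : d ≠ x + 2 := by omega
        have n5 : x + 1 ≠ x + 2 := by omega
        have hk1 : k + 1 < 2 ^ cx.β := by have := hok.Tlt; omega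
        have g4 := Exec.op (o := .add) (i := x + 1) (j := x + 1) (k := d + 1) g3.1 (by omega) (by
          have : ¬ x = d := by omega
          simpa [Op.eval, gr2, hx1, this] using hk1.trans_le hβV)
        have hd1 : τ₁.reg d = nv - k := by rw [gh1 d hd (by omega), hrd]
        have g5 := Exec.op (o := .sub) (i := d) (j := d) (k := d + 1) g4.1 (by omega) (by
          have e1 : ¬ d = x := by omega
          have := (g4.1).2.1 d
          simp only [Op.eval]
          exact (Nat.sub_le _ _).trans_lt this)
        refine ⟨_, (g1.seq (g2.seq (g3.seq (g4.seq g5)))).mono (by omega), by omega, ⟨g5.1, ?_, ?_,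
          ?_, ?_, ?_, hrel.arr_lt⟩, ?_, ?_, ?_, ?_⟩
        · have e1 : (0 : ℕ) ≠ d := by omega
          simp [e1, gr2, gl1 0 (by omega), hrel.base]
        · intro y hy
          have e1 : y + 1 ≠ d := by omega
          have e2 : y ≠ d := by omega
          by_cases hy1 : y = x
          · subst hy1
            simp [e1, e2, Op.eval, gr2, hx1]
          · by_cases hy2 : y = x + 1
            · subst hy2
              have e3 : x + 1 + 1 ≠ d := by omega
              have e4 : x + 1 ≠ d := by omega
              simp [e3, e4, gr2, iterN_succ, gr1, hf]
            · have e5 : y + 1 ≠ x + 2 := by omega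
              rw [State.setReg_reg, if_neg e1, State.setReg_reg, if_neg (by omega),
                State.setReg_reg, if_neg (by omega), gr2, if_neg e5, gl1 _ (by omega),
                hrel.vars y hy]
              simp [upd, hy1, hy2]
        · intro y hy
          by_cases hy1 : y = x + 1
          · subst hy1
            simpa [upd] using hacc (k + 1) hk
          · by_cases hy2 : y = x
            · subst hy2
              simpa [upd] using hk1
            · have := hrel.vars_lt y hy
              simpa [upd, hy1, hy2] using this
        · intro c hc
          simp [gm2, gm1, hrel.inp c hc]
        · intro j hj i
          simp [gm2, gm1, hrel.arr j hj i]
        · have e1 : ¬ d = x := by omega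
          have e2 : ¬ x = d := by omega
          simp [Op.eval, n3, e1, e2, gr2, n4, hd1]
          omega
        · simp [gm2, gm1, hmem]
        · intro i hi
          rw [State.setReg_reg, if_neg (by omega), State.setReg_reg, if_neg (by omega),
            State.setReg_reg, if_neg (by omega), gr2, if_neg (by omega), gl1 i (by omega), hlow i hi]
        · intro i hi hid
          rw [State.setReg_reg, if_neg (by omega), State.setReg_reg, if_neg (by omega),
            State.setReg_reg, if_neg (by omega), gr2, if_neg (by omega), gh1 i hi (by omega),
            hhigh i hi hid])
      (by
        refine ⟨Nat.zero_le _, ⟨h4.1, ?_, ?_, ?_, ?_, ?_, hrel.arr_lt⟩, ?_, ?_, ?_, ?_⟩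
        · simp [hr3, hl2, hl1, hrel.base]
        · intro y hy
          by_cases hy1 : y = x
          · subst hy1; simp
          · by_cases hy2 : y = x + 1
            · subst hy2
              simp [hr3, hr2, hav]
            · rw [State.setReg_reg, if_neg (by omega), hr3, if_neg (by omega), hl2 _ (by omega),
                hl1 _ (by omega), hrel.vars y (by omega)]
              simp [upd, hy1, hy2]
        · intro y hy
          by_cases hy1 : y = x + 1
          · subst hy1
            simpa [upd] using hacc 0 (Nat.zero_le _)
          · by_cases hy2 : y = x
            · subst hy2
              simp [upd]
            · simpa [upd, hy1, hy2] using hrel.vars_lt y (by omega)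
        · intro c hc
          simp [hm3, hm2, hm1, hrel.inp c hc]
        · intro j hj i
          simp [hm3, hm2, hm1, hrel.arr j hj i]
        · rw [State.setReg_reg, if_neg (by omega), hr3, if_neg (by omega), hh2 d hd (by omega), hr1]
          rfl
        · simp [hm3, hm2, hm1]
        · intro i hi
          rw [State.setReg_reg, if_neg (by omega), hr3, if_neg (by omega), hl2 i hi, hl1 i hi]
        · intro i hi hid
          rw [State.setReg_reg, if_neg (by omega), hr3, if_neg (by omega), hh2 i hi (by omega),
            hh1 i hi hid])
    obtain ⟨σ₆, h6, hm6, hr6⟩ :=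
      Exec.move (i := d) (j := x + 2) h5.1 (by omega) (by omega)
    refine ⟨lt_two_pow_mono (a := 1) (by rw [one_mul]; exact hacc nv le_rfl) (by omega), σ₆,
      (h1.seq (h2.seq (h3.seq (h4.seq (h5.seq h6))))).mono ?_, by rw [hm6, hm5], ?_, fun i hi => ?_,
      fun i hi hid => ?_⟩
    · have e1 := coeff_pow_le (a := κn) (k := κn) (κ := κn + κa + κb + 20) hok.T (by omega)
      have e2 := coeff_pow_le (a := κa) (k := κa) (κ := κn + κa + κb + 20) hok.T (by omega)
      -- The exponent `κb + 1`: at most `T` rounds, each of cost `κb * T ^ κb`.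
      have e3 := coeff_pow_le (a := κb) (k := κb + 1) (κ := κn + κa + κb + 20) hok.T (by omega)
      have e4 := coeff_pow_le (a := 6) (k := 1) (κ := κn + κa + κb + 20) hok.T (by omega)
      have e5 := Nat.one_le_pow (κn + κa + κb + 20) cx.T hok.T
      have e6 : nv * (κb * cx.T ^ κb + 5 + 1) ≤ κb * cx.T ^ (κb + 1) + 6 * cx.T ^ 1 := by
        calc nv * (κb * cx.T ^ κb + 5 + 1) ≤ cx.T * (κb * cx.T ^ κb + 5 + 1) :=
              Nat.mul_le_mul_right _ hT
          _ = _ := by ring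
      rw [Nat.add_mul, Nat.add_mul, Nat.add_mul]
      omega
    · rw [hr6, if_pos rfl, hrel5.vars (x + 1) (by omega)]
      simp [upd, Ex.ev]
      rfl
    · rw [hr6, if_neg (by omega), hl5 i hi]
    · rw [hr6, if_neg (by omega), hh5 i hi hid]

end SatTW

/-! ### Commands on arrays and their compilation -/

namespace SatTW

/-- Commands: assignment to an array element, composition, branching, bounded loops. -/
inductive Cm where
  | store (j : ℕ) (a b : Ex)
  | seq (c₁ c₂ : Cm)
  | ite (e : Ex) (c₁ c₂ : Cm)
  | loop (x : ℕ) (n : Ex) (c : Cm)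

/-- Assigning a value to an array element. -/
def updArr (A : ℕ → ℕ → ℕ) (j i v : ℕ) : ℕ → ℕ → ℕ :=
  fun j' i' => if j' = j ∧ i' = i then v else A j' i'

theorem updArr_apply (A : ℕ → ℕ → ℕ) (j i v j' i' : ℕ) :
    updArr A j i v j' i' = if j' = j ∧ i' = i then v else A j' i' := rfl

@[simp] theorem updArr_same (A : ℕ → ℕ → ℕ) (j i v i' : ℕ) :
    updArr A j i v j i' = if i' = i then v else A j i' := by simp [updArr]

theorem updArr_ne (A : ℕ → ℕ → ℕ) (j i v : ℕ) {j' : ℕ} (h : j' ≠ j) :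
    updArr A j i v j' = A j' := by funext i'; simp [updArr, h]

def Cm.run (I : ℕ → ℕ) : Cm → (ℕ → ℕ) → (ℕ → ℕ → ℕ) → ℕ → ℕ → ℕ
  | .store j a b, env, A => updArr A j (a.ev I A env) (b.ev I A env)
  | .seq c₁ c₂, env, A => c₂.run I env (c₁.run I env A)
  | .ite e c₁ c₂, env, A => if e.ev I A env ≠ 0 then c₁.run I env A else c₂.run I env A
  | .loop x n c, env, A => iterN (n.ev I A env) A fun i B => c.run I (upd env x i) B

def Cm.WF : Cm → ℕ → Prop
  | .store j a b, sc => j < numArr ∧ a.WF sc ∧ b.WF sc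
  | .seq c₁ c₂, sc => c₁.WF sc ∧ c₂.WF sc
  | .ite e c₁ c₂, sc => e.WF sc ∧ c₁.WF sc ∧ c₂.WF sc
  | .loop x n c, sc => x = sc ∧ x + 3 ≤ nameLimit ∧ n.WF sc ∧ c.WF (x + 1)

/-- In addition to the requirements on expressions, array indices are below `X`, and stored values
are below `2 ^ β`. -/
def Cm.Safe (I : ℕ → ℕ) (len β T X : ℕ) : Cm → (ℕ → ℕ) → (ℕ → ℕ → ℕ) → Prop
  | .store _ a b, env, A => a.Safe I len β T A env ∧ b.Safe I len β T A env ∧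
      a.ev I A env < X ∧ b.ev I A env < 2 ^ β
  | .seq c₁ c₂, env, A =>
      c₁.Safe I len β T X env A ∧ c₂.Safe I len β T X env (c₁.run I env A)
  | .ite e c₁ c₂, env, A => e.Safe I len β T A env ∧
      (e.ev I A env ≠ 0 → c₁.Safe I len β T X env A) ∧
      (e.ev I A env = 0 → c₂.Safe I len β T X env A)
  | .loop x n c, env, A => n.Safe I len β T A env ∧ n.ev I A env ≤ T ∧
      ∀ k, k < n.ev I A env → c.Safe I len β T X (upd env x k)
        (iterN k A fun i B => c.run I (upd env x i) B)

def Cm.code : Cm → ℕ → Prog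
  | .store j a b, d => .seq (a.code d) (.seq (b.code (d + 1)) (.seq (.const (d + 2) numArr)
      (.seq (.op .mul d d (d + 2)) (.seq (.const (d + 2) j) (.seq (.op .add d d (d + 2))
        (.seq (.op .add d 0 d) (.store d (d + 1))))))))
  | .seq c₁ c₂, d => .seq (c₁.code d) (c₂.code d)
  | .ite e c₁ c₂, d => .seq (e.code d) (.ite d (c₁.code d) (c₂.code d))
  | .loop x n c, d => .seq (n.code d) (.seq (.const (x + 1) 0)
      (.loop d (.seq (c.code (d + 1)) (.seq (.const (d + 1) 1)
          (.seq (.op .add (x + 1) (x + 1) (d + 1)) (.op .sub d d (d + 1)))))))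

/-- The arrays are outside of the input and within the memory. -/
structure Ctx.Fits (cx : Ctx) : Prop where
  len : cx.len ≤ cx.base
  Y : cx.base + cx.X * numArr ≤ cx.b.Y

/-- The effect of the code of a command that leads to the arrays `B`. -/
def CmSpec (cx : Ctx) (n sc d : ℕ) (env : ℕ → ℕ) (p : Prog) (B : ℕ → ℕ → ℕ) (σ : State) : Prop :=
  ∃ σ', Exec cx.b p σ σ' n ∧ Represents cx sc env B σ' ∧
    ∀ i, nameLimit ≤ i → i < d → σ'.reg i = σ.reg i

theorem Represents.restrict {cx : Ctx} {x v : ℕ} {env : ℕ → ℕ} {A : ℕ → ℕ → ℕ} {σ : State}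
    (h : Represents cx (x + 1) (upd env x v) A σ) : Represents cx x env A σ :=
  { h with
    vars := fun y hy => by
      rw [h.vars y (by omega)]; simp; intro h; omega
    vars_lt := fun y hy => by
      have := h.vars_lt y (by omega)
      rwa [upd_apply, if_neg (by omega)] at this }

/-- The loop over commands, given the effect of its body and an upper bound `m` on the cost of a
round; the number of rounds is only limited by the word length. -/
theorem Cm.loop_spec (κn : ℕ) (n : Ex) (c : Cm) (cx : Ctx) (A : ℕ → ℕ → ℕ) (env : ℕ → ℕ)
    (x d m : ℕ) (σ : State) (hok : cx.Ok (κn + 5)) (hlim : x + 3 ≤ nameLimit)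
    (hd : nameLimit ≤ d) (hD : d + (κn + 5) ≤ cx.b.D)
    (hrel : Represents cx x env A σ) (hlt : n.ev cx.I A env < 2 ^ cx.β)
    (hn : ExSpec cx κn (κn * cx.T ^ κn) x d (n.code d) (n.ev cx.I A env) σ)
    (hbody : ∀ k τ, k < n.ev cx.I A env →
      Represents cx (x + 1) (upd env x k) (iterN k A fun i B => c.run cx.I (upd env x i) B) τ →
      CmSpec cx m (x + 1) (d + 1) (upd env x k) (c.code (d + 1))
        (iterN (k + 1) A fun i B => c.run cx.I (upd env x i) B) τ) :
    CmSpec cx (κn * cx.T ^ κn + 2 + n.ev cx.I A env * (m + 4)) x d env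
      ((Cm.loop x n c).code d) ((Cm.loop x n c).run cx.I env A) σ := by
  have hVle : 2 ^ ((κn + 5) * cx.β) ≤ 2 ^ cx.b.V := Nat.pow_le_pow_right (by norm_num) hok.V
  have h1V : 1 < 2 ^ cx.b.V := (const_lt_two_pow 1 hok.β (by omega)).trans_le hVle
  have hβV : 2 ^ cx.β ≤ 2 ^ cx.b.V :=
    le_trans (Nat.pow_le_pow_right (by norm_num) (by nlinarith [hok.β])) hVle
  obtain ⟨hvn, σ₁, h1, hm1, hr1, hl1, hh1⟩ := hn
  have hrel1 := hrel.of_eq h1.1 hm1 hl1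
  have h4 := Exec.const (i := x + 1) (c := 0) h1.1 (by omega) (by positivity)
  set nv := n.ev cx.I A env with hnv
  set f : ℕ → (ℕ → ℕ → ℕ) → ℕ → ℕ → ℕ := fun i B => c.run cx.I (upd env x i) B with hf
  let Inv : ℕ → State → Prop := fun k τ => k ≤ nv ∧
    Represents cx (x + 1) (upd env x k) (iterN k A f) τ ∧ τ.reg d = nv - k ∧
    ∀ i, nameLimit ≤ i → i < d → τ.reg i = σ.reg i
  obtain ⟨σ₅, h5, -, hrel5, -, hh5⟩ := Exec.loop_countdown
    (b := cx.b) (p := (.seq (c.code (d + 1)) (.seq (.const (d + 1) 1)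
          (.seq (.op .add (x + 1) (x + 1) (d + 1)) (.op .sub d d (d + 1))))))
    (σ := σ₁.setReg (x + 1) 0) (i := d) (c := nv) (m := m + 3) Inv
    (fun k τ h => ⟨h.2.1.within, h.2.2.1⟩)
    (by
      rintro k τ hk ⟨-, hrel, hrd, hhigh⟩
      obtain ⟨τ₁, g1, grel, gh1⟩ := hbody k τ hk hrel
      have g3 := Exec.const (i := d + 1) (c := 1) g1.1 (by omega) h1V
      have hx1 : τ₁.reg (x + 1) = k := by
        rw [grel.vars x (by omega)]; simp
      have n1 : x + 1 ≠ d + 1 := by omega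
      have n2 : d ≠ d + 1 := by omega
      have n3 : d ≠ x + 1 := by omega
      have n6 : ¬ x = d := by omega
      have n7 : ¬ d = x := by omega
      have hk1 : k + 1 < 2 ^ cx.β := by omega
      have g4 := Exec.op (o := .add) (i := x + 1) (j := x + 1) (k := d + 1) g3.1 (by omega) (by
        simpa [Op.eval, hx1, n6] using hk1.trans_le hβV)
      have hd1 : τ₁.reg d = nv - k := by rw [gh1 d hd (by omega), hrd]
      have g5 := Exec.op (o := .sub) (i := d) (j := d) (k := d + 1) g4.1 (by omega) (by
        have := (g4.1).2.1 d
        simp only [Op.eval]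
        exact (Nat.sub_le _ _).trans_lt this)
      refine ⟨_, (g1.seq (g3.seq (g4.seq g5))).mono (by omega), by omega,
        ⟨g5.1, ?_, ?_, ?_, ?_, ?_, grel.arr_lt⟩, ?_, ?_⟩
      · have e1 : (0 : ℕ) ≠ d := by omega
        simp [e1, grel.base]
      · intro y hy
        have e1 : y + 1 ≠ d := by omega
        have e2 : y ≠ d := by omega
        by_cases hy1 : y = x
        · subst hy1
          simp [e1, e2, Op.eval, hx1]
        · rw [State.setReg_reg, if_neg e1, State.setReg_reg, if_neg (by omega),
            State.setReg_reg, if_neg (by omega), grel.vars y hy]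
          simp [hy1]
      · intro y hy
        by_cases hy1 : y = x
        · subst hy1
          simpa using hk1
        · have := hrel.vars_lt y hy
          simpa [hy1] using this
      · intro a ha
        simp [grel.inp a ha]
      · intro j hj i
        simp [grel.arr j hj i]
      · simp [Op.eval, n3, n6, n7, hd1]
        omega
      · intro i hi hid
        rw [State.setReg_reg, if_neg (by omega), State.setReg_reg, if_neg (by omega),
          State.setReg_reg, if_neg (by omega), gh1 i hi (by omega), hhigh i hi hid])
    (by
      refine ⟨Nat.zero_le _, ⟨h4.1, ?_, ?_, ?_, ?_, ?_, hrel.arr_lt⟩, ?_, ?_⟩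
      · simp [hl1, hrel.base]
      · intro y hy
        by_cases hy1 : y = x
        · subst hy1; simp
        · rw [State.setReg_reg, if_neg (by omega), hl1 _ (by omega), hrel.vars y (by omega)]
          simp [hy1]
      · intro y hy
        by_cases hy1 : y = x
        · subst hy1; simp
        · simpa [hy1] using hrel.vars_lt y (by omega)
      · intro a ha
        simp [hm1, hrel.inp a ha]
      · intro j hj i
        simp [hm1, hrel.arr j hj i]
      · rw [State.setReg_reg, if_neg (by omega), hr1]
        rfl
      · intro i hi hid
        rw [State.setReg_reg, if_neg (by omega), hh1 i hi hid])
  refine ⟨σ₅, (h1.seq (h4.seq h5)).mono (le_of_eq (by ring)), hrel5.restrict, hh5⟩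

/-- The same induction as for expressions. All loops covered here have at most `T` rounds, so the
cost stays polynomial in `T`. The one loop with exponentially more rounds, over the events of the
counter, is handled by `Cm.loop_spec`. -/
theorem Cm.code_spec (c : Cm) : ∃ κ, ∀ (cx : Ctx) (A : ℕ → ℕ → ℕ) (env : ℕ → ℕ) (sc d : ℕ)
    (σ : State), cx.Ok κ → cx.Fits → c.WF sc → sc < nameLimit → nameLimit ≤ d → d + κ ≤ cx.b.D →
    Represents cx sc env A σ → c.Safe cx.I cx.len cx.β cx.T cx.X env A →
    CmSpec cx (κ * cx.T ^ κ) sc d env (c.code d) (c.run cx.I env A) σ := by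
  induction c with
  | store j a b =>
    obtain ⟨κa, iha⟩ := a.code_spec
    obtain ⟨κb, ihb⟩ := b.code_spec
    refine ⟨κa + κb + 50, fun cx A env sc d σ hok hfit hwf hsc hd hD hrel hs => ?_⟩
    obtain ⟨hj, hwa, hwb⟩ := hwf
    obtain ⟨hsa, hsb, hX, hlt⟩ := hs
    obtain ⟨hva, σ₁, h1, hm1, hr1, hl1, hh1⟩ :=
      iha cx A env sc d σ (hok.mono (by omega)) hwa hsc hd (by omega) hrel hsa
    have hrel1 := hrel.of_eq h1.1 hm1 hl1
    obtain ⟨hvb, σ₂, h2, hm2, hr2, hl2, hh2⟩ :=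
      ihb cx A env sc (d + 1) σ₁ (hok.mono (by omega)) hwb hsc (by omega) (by omega) hrel1 hsb
    have hVle : 2 ^ ((κa + κb + 50) * cx.β) ≤ 2 ^ cx.b.V :=
      Nat.pow_le_pow_right (by norm_num) hok.V
    have hd2 : σ₂.reg d = a.ev cx.I A env := by rw [hh2 d hd (by omega), hr1]
    have hc16 : numArr < 2 ^ (16 * cx.β) := const_lt_two_pow 16 hok.β (by omega)
    have hcj : j < 2 ^ (16 * cx.β) := const_lt_two_pow j hok.β (le_of_lt hj)
    have hmul : a.ev cx.I A env * numArr < 2 ^ ((κa + 16) * cx.β) := mul_lt_two_pow hva hc16 le_rfl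
    have hadd : a.ev cx.I A env * numArr + j < 2 ^ ((κa + 16 + 16 + 1) * cx.β) :=
      add_lt_two_pow hok.β hmul hcj le_rfl
    have hadd2 : cx.base + (a.ev cx.I A env * numArr + j) < 2 ^ ((κa + κb + 50) * cx.β) :=
      add_lt_two_pow (a := 1) hok.β (by simpa using hok.base) hadd (by omega)
    have n1 : ¬ d = d + 2 := by omega
    have h3 := Exec.const (i := d + 2) (c := numArr) h2.1 (by omega)
      ((lt_two_pow_mono hc16 (by omega)).trans_le hVle)
    have h4 := Exec.op (o := .mul) (i := d) (j := d) (k := d + 2) h3.1 (by omega)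
      (by simpa [hd2, Op.eval] using (lt_two_pow_mono hmul (by omega)).trans_le hVle)
    have h5 := Exec.const (i := d + 2) (c := j) h4.1 (by omega)
      ((lt_two_pow_mono hcj (by omega)).trans_le hVle)
    have h6 := Exec.op (o := .add) (i := d) (j := d) (k := d + 2) h5.1 (by omega)
      (by simpa [hd2, Op.eval] using (lt_two_pow_mono hadd (by omega)).trans_le hVle)
    have hd0 : (0 : ℕ) ≠ d := by omega
    have h7 := Exec.op (o := .add) (i := d) (j := 0) (k := d) h6.1 (by omega)
      (by simpa [hd2, Op.eval, hd0, hl1, hl2, hrel.base] using hadd2.trans_le hVle)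
    have h8 := Exec.store (i := d) (j := d + 1) h7.1 (by
      simp only [Op.eval, State.setReg_reg, hd2, hd0, hl2 0 (Nat.zero_le _), hl1 0 (Nat.zero_le _),
        hrel.base, if_true, if_false, n1, show ¬ (0 = d + 2) by omega]
      have := hfit.Y
      have h' : (a.ev cx.I A env + 1) * numArr ≤ cx.X * numArr := Nat.mul_le_mul_right _ hX
      rw [Nat.add_mul] at h'
      omega)
    refine ⟨_, (h1.seq (h2.seq (h3.seq (h4.seq (h5.seq (h6.seq (h7.seq h8))))))).mono ?_,
      ⟨h8.1, ?_, ?_, hrel.vars_lt, ?_, ?_, ?_⟩, ?_⟩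
    · have e1 := coeff_pow_le (a := κa) (k := κa) (κ := κa + κb + 50) hok.T (by omega)
      have e2 := coeff_pow_le (a := κb) (k := κb) (κ := κa + κb + 50) hok.T (by omega)
      have := Nat.one_le_pow (κa + κb + 50) cx.T hok.T
      rw [Nat.add_mul, Nat.add_mul]
      omega
    · simp [hd0, hl2, hl1, hrel.base]
    · intro y hy
      have e1 : y + 1 ≠ d := by omega
      have e2 : y ≠ d + 1 := by omega
      have e3 : y + 1 ≠ d + 2 := by omega
      simp [e1, e2, hl2 (y + 1) (by omega), hl1 (y + 1) (by omega), hrel.vars y hy]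
    · intro y hy
      have : ¬ (y = cx.base + (a.ev cx.I A env * numArr + j)) := by
        have := hfit.len
        omega
      simp [hd2, hd0, Op.eval, hl2, hl1, hrel.base, this, hm2, hm1, hrel.inp y hy]
    · intro j' hj' i
      -- Uniqueness of division with remainder by `numArr`: the store changes no other element of
      -- any array.
      have : (i * numArr + j' = a.ev cx.I A env * numArr + j) ↔ (j' = j ∧ i = a.ev cx.I A env) := by
        simp only [numArr] at hj hj' ⊢
        omega
      simp [hd2, hd0, Op.eval, hl2, hl1, hrel.base, hm2, hm1, hrel.arr j' hj', hr2, Cm.run,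
        updArr_apply, this]
    · intro j' hj' i
      simp only [Cm.run, updArr_apply]
      split
      · exact hlt
      · exact hrel.arr_lt j' hj' i
    · intro i hi hid
      have e1 : i ≠ d := by omega
      have e2 : i ≠ d + 1 := by omega
      have e3 : i ≠ d + 2 := by omega
      simp [e1, e3, hh2 i hi (by omega), hh1 i hi hid]
  | seq c₁ c₂ ih₁ ih₂ =>
    obtain ⟨κ₁, ih₁⟩ := ih₁
    obtain ⟨κ₂, ih₂⟩ := ih₂
    refine ⟨κ₁ + κ₂, fun cx A env sc d σ hok hfit hwf hsc hd hD hrel hs => ?_⟩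
    obtain ⟨σ₁, h1, hrel1, hh1⟩ :=
      ih₁ cx A env sc d σ (hok.mono (by omega)) hfit hwf.1 hsc hd (by omega) hrel hs.1
    obtain ⟨σ₂, h2, hrel2, hh2⟩ :=
      ih₂ cx _ env sc d σ₁ (hok.mono (by omega)) hfit hwf.2 hsc hd (by omega) hrel1 hs.2
    refine ⟨σ₂, (h1.seq h2).mono ?_, hrel2, fun i hi hid => by rw [hh2 i hi hid, hh1 i hi hid]⟩
    have e1 := coeff_pow_le (a := κ₁) (k := κ₁) (κ := κ₁ + κ₂) hok.T (by omega)
    have e2 := coeff_pow_le (a := κ₂) (k := κ₂) (κ := κ₁ + κ₂) hok.T (by omega)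
    rw [Nat.add_mul]
    omega
  | ite e c₁ c₂ ih₁ ih₂ =>
    obtain ⟨κ₁, ih₁⟩ := ih₁
    obtain ⟨κ₂, ih₂⟩ := ih₂
    obtain ⟨κe, ihe⟩ := e.code_spec
    refine ⟨κe + κ₁ + κ₂ + 1, fun cx A env sc d σ hok hfit hwf hsc hd hD hrel hs => ?_⟩
    obtain ⟨hve, σ₁, h1, hm1, hr1, hl1, hh1⟩ :=
      ihe cx A env sc d σ (hok.mono (by omega)) hwf.1 hsc hd (by omega) hrel hs.1
    have hrel1 := hrel.of_eq h1.1 hm1 hl1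
    have e1 := coeff_pow_le (a := κ₁) (k := κ₁) (κ := κe + κ₁ + κ₂ + 1) hok.T (by omega)
    have e2 := coeff_pow_le (a := κ₂) (k := κ₂) (κ := κe + κ₁ + κ₂ + 1) hok.T (by omega)
    have e3 := coeff_pow_le (a := κe) (k := κe) (κ := κe + κ₁ + κ₂ + 1) hok.T (by omega)
    have e4 := Nat.one_le_pow (κe + κ₁ + κ₂ + 1) cx.T hok.T
    by_cases he : e.ev cx.I A env = 0
    · obtain ⟨σ₂, h2, hrel2, hh2⟩ := ih₂ cx A env sc d σ₁ (hok.mono (by omega)) hfit hwf.2.2 hsc hd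
        (by omega) hrel1 (hs.2.2 he)
      refine ⟨σ₂, (h1.seq (Exec.ite_false (by rw [hr1, he]) h2)).mono ?_, ?_,
        fun i hi hid => by rw [hh2 i hi hid, hh1 i hi hid]⟩
      · rw [Nat.add_mul, Nat.add_mul, Nat.add_mul]
        omega
      · simpa [Cm.run, he] using hrel2
    · obtain ⟨σ₂, h2, hrel2, hh2⟩ := ih₁ cx A env sc d σ₁ (hok.mono (by omega)) hfit hwf.2.1 hsc hd
        (by omega) hrel1 (hs.2.1 he)
      refine ⟨σ₂, (h1.seq (Exec.ite_true h1.1 (by rwa [hr1]) h2)).mono ?_, ?_,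
        fun i hi hid => by rw [hh2 i hi hid, hh1 i hi hid]⟩
      · rw [Nat.add_mul, Nat.add_mul, Nat.add_mul]
        omega
      · simpa [Cm.run, he] using hrel2
  | loop x n c ih =>
    obtain ⟨κ, ih⟩ := ih
    obtain ⟨κn, ihn⟩ := n.code_spec
    refine ⟨κn + κ + 6, fun cx A env sc d σ hok hfit hwf hsc hd hD hrel hs => ?_⟩
    obtain ⟨rfl, hlim, hwn, hwc⟩ := hwf
    obtain ⟨hsn, hT, hsc'⟩ := hs
    obtain ⟨σ', h1, h2, h3⟩ := Cm.loop_spec κn n c cx A env x d (κ * cx.T ^ κ) σ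
      (hok.mono (by omega)) hlim hd
      (by omega) hrel (hT.trans_lt hok.Tlt)
      (ihn cx A env x d σ (hok.mono (by omega)) hwn hsc hd (by omega) hrel hsn)
      (fun k τ hk hrel' => ih cx _ _ (x + 1) (d + 1) τ (hok.mono (by omega)) hfit hwc (by omega)
        (by omega) (by omega) hrel' (hsc' k hk))
    refine ⟨σ', h1.mono ?_, h2, h3⟩
    have e1 := coeff_pow_le (a := κn) (k := κn) (κ := κn + κ + 6) hok.T (by omega)
    have e2 := coeff_pow_le (a := κ) (k := κ + 1) (κ := κn + κ + 6) hok.T (by omega)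
    have e3 := coeff_pow_le (a := 4) (k := 1) (κ := κn + κ + 6) hok.T (by omega)
    have e4 := Nat.one_le_pow (κn + κ + 6) cx.T hok.T
    have e5 : n.ev cx.I A env * (κ * cx.T ^ κ + 4) ≤ κ * cx.T ^ (κ + 1) + 4 * cx.T ^ 1 := by
      calc n.ev cx.I A env * (κ * cx.T ^ κ + 4) ≤ cx.T * (κ * cx.T ^ κ + 4) :=
            Nat.mul_le_mul_right _ hT
        _ = _ := by ring
    rw [Nat.add_mul, Nat.add_mul]
    omega

end SatTW

namespace SatTW

/-! ### Sum-product message passing on a ranked rooted tree -/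

/-- A rooted tree on the nodes `0, …, N - 1` with the additional node `N` above the root, with node
weights `φ t x` and edge weights `ψ t x x'` (between `t` and its parent) for states
`x, x' < G * H`, and with a ranking of the nodes: between two nodes of the same rank there is a
node of higher rank. -/
structure Model (R : Type) [CommRing R] where
  N : ℕ
  G : ℕ
  H : ℕ
  L : ℕ
  par : ℕ → ℕ
  dep : ℕ → ℕ
  rk : ℕ → ℕ
  φ : ℕ → ℕ → R
  ψ : ℕ → ℕ → ℕ → R
  H_pos : 0 < H
  par_N : par N = N
  par_le : ∀ t, t < N → par t ≤ N
  dep_par : ∀ t, t < N → dep t = dep (par t) + 1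
  dep_le : ∀ t, t < N → dep t ≤ N
  rk_lt : ∀ t, t < N → rk t < L
  rk_N : rk N = L
  ranking : ∀ r, ∃ f : ℕ → ℕ, (∀ v, f v ≤ 1) ∧ ∀ v, v < N → rk v ≤ r →
    (∑ y ∈ (Finset.range N).filter (fun y => par y = v), f y) + (if rk v = r then 1 else 0) ≤ f v

namespace Model

variable {R : Type} [CommRing R] (M : Model R)

def ch (t : ℕ) : Finset ℕ := (Finset.range M.N).filter fun y => M.par y = t

theorem mem_ch {t y : ℕ} : y ∈ M.ch t ↔ y < M.N ∧ M.par y = t := by simp [ch]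

theorem lt_of_par_lt {t : ℕ} (ht : t ≤ M.N) (h : M.par t < M.N) : t < M.N := by
  rcases Nat.lt_or_ge t M.N with h' | h'
  · exact h'
  · obtain rfl : t = M.N := le_antisymm ht h'
    rw [M.par_N] at h
    exact absurd h (lt_irrefl _)

theorem iterate_le {k d : ℕ} (hd : d ≤ M.N) : M.par^[k] d ≤ M.N := by
  induction k with
  | zero => exact hd
  | succ k ih =>
    rw [Function.iterate_succ_apply']
    rcases Nat.lt_or_ge (M.par^[k] d) M.N with h | h
    · exact M.par_le _ h
    · rw [le_antisymm ih h, M.par_N]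

theorem iterate_lt {k j d : ℕ} (hd : d ≤ M.N) (h : M.par^[k] d < M.N) (hj : j ≤ k) :
    M.par^[j] d < M.N := by
  induction k with
  | zero =>
    obtain rfl : j = 0 := by omega
    exact h
  | succ k ih =>
    rw [Function.iterate_succ_apply'] at h
    have h' := M.lt_of_par_lt (M.iterate_le hd) h
    rcases Nat.lt_or_ge k j with hk | hk
    · obtain rfl : j = k + 1 := by omega
      rwa [Function.iterate_succ_apply']
    · exact ih h' hk

theorem dep_iterate {k d : ℕ} (hd : d ≤ M.N) (h : M.par^[k] d < M.N) :
    M.dep d = M.dep (M.par^[k] d) + k := by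
  induction k with
  | zero => rfl
  | succ k ih =>
    have h' := M.iterate_lt hd h (Nat.le_succ k)
    rw [ih h', M.dep_par _ h', Function.iterate_succ_apply']
    omega

theorem dep_ch {t y : ℕ} (hy : y ∈ M.ch t) : M.dep y = M.dep t + 1 := by
  obtain ⟨h, rfl⟩ := M.mem_ch.1 hy
  exact M.dep_par y h

def dpAux (Φ : ℕ → ℕ → R) : ℕ → ℕ → ℕ → R
  | 0, t, x => Φ t x
  | k + 1, t, x => Φ t x * ∏ y ∈ M.ch t, ∑ x' ∈ Finset.range (M.G * M.H),
      M.ψ y x' x * dpAux Φ k y x'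

/-- The weight of the subtree below `t`, given the state `x` of `t`, for the node weights `Φ`. -/
def dp (Φ : ℕ → ℕ → R) (t x : ℕ) : R := M.dpAux Φ (M.N - M.dep t) t x

theorem dp_eq (Φ : ℕ → ℕ → R) (t x : ℕ) :
    M.dp Φ t x = Φ t x * ∏ y ∈ M.ch t, ∑ x' ∈ Finset.range (M.G * M.H),
      M.ψ y x' x * M.dp Φ y x' := by
  unfold dp
  rcases hk : M.N - M.dep t with _ | k
  · have : M.ch t = ∅ := by
      rw [Finset.eq_empty_iff_forall_notMem]
      intro y hy
      have h1 := M.dep_ch hy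
      have h2 := M.dep_le y (M.mem_ch.1 hy).1
      omega
    rw [this]
    simp [dpAux]
  · rw [dpAux]
    congr 1
    refine Finset.prod_congr rfl fun y hy => ?_
    have h1 := M.dep_ch hy
    have h2 : M.N - M.dep y = k := by omega
    rw [h2]

theorem dp_induction {P : ℕ → Prop} (h : ∀ t, (∀ y ∈ M.ch t, P y) → P t) (t : ℕ) : P t := by
  have key : ∀ k t, M.N - M.dep t = k → P t := by
    intro k
    induction k with
    | zero =>
      intro t ht
      refine h t fun y hy => ?_
      have h1 := M.dep_ch hy
      have h2 := M.dep_le y (M.mem_ch.1 hy).1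
      omega
    | succ k ih =>
      intro t ht
      refine h t fun y hy => ih y ?_
      have h1 := M.dep_ch hy
      omega
  exact key _ t rfl

theorem dp_congr {Φ Φ' : ℕ → ℕ → R} (t : ℕ) (ht : t < M.N)
    (h : ∀ d k, d < M.N → M.par^[k] d = t → ∀ x, x < M.G * M.H → Φ d x = Φ' d x) :
    ∀ x, x < M.G * M.H → M.dp Φ t x = M.dp Φ' t x := by
  revert ht h
  refine M.dp_induction (P := fun t => t < M.N → (∀ d k, d < M.N → M.par^[k] d = t →
    ∀ x, x < M.G * M.H → Φ d x = Φ' d x) → ∀ x, x < M.G * M.H → M.dp Φ t x = M.dp Φ' t x)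
    (fun t ih ht h x hx => ?_) t
  rw [M.dp_eq, M.dp_eq, h t 0 ht rfl x hx]
  congr 1
  refine Finset.prod_congr rfl fun y hy => Finset.sum_congr rfl fun x' hx' => ?_
  rw [ih y hy (M.mem_ch.1 hy).1 _ x' (Finset.mem_range.1 hx')]
  intro d k hdN hd
  refine h d (k + 1) hdN ?_
  rw [Function.iterate_succ_apply', hd, (M.mem_ch.1 hy).2]

/-- Depth falls by one per step to the parent and siblings have equal depth, so `c` needs the same
number of steps to `y` and to `y'`. Thus subtrees of different children are disjoint. -/
theorem ch_unique {t c y y' i j : ℕ} (hc : c ≤ M.N) (hy : y ∈ M.ch t) (hy' : y' ∈ M.ch t)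
    (hi : M.par^[i] c = y) (hj : M.par^[j] c = y') : y = y' := by
  have h1 := M.dep_iterate hc (by rw [hi]; exact (M.mem_ch.1 hy).1)
  have h2 := M.dep_iterate hc (by rw [hj]; exact (M.mem_ch.1 hy').1)
  have h3 := M.dep_ch hy
  have h4 := M.dep_ch hy'
  rw [hi] at h1
  rw [hj] at h2
  obtain rfl : i = j := by omega
  rw [← hi, hj]

/-- The weight of a subtree is additive in the weight of each of its nodes. -/
theorem dp_sum {ι : Type} (s : Finset ι) (f : ι → ℕ → R) (Φ : ℕ → ℕ → R) {c : ℕ} (hc : c < M.N) :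
    ∀ j t, t < M.N → M.par^[j] c = t → ∀ x, x < M.G * M.H →
      M.dp (fun d x => if d = c then ∑ g ∈ s, f g x else Φ d x) t x =
        ∑ g ∈ s, M.dp (fun d x => if d = c then f g x else Φ d x) t x := by
  intro j
  induction j with
  | zero =>
    intro t ht htc x hx
    obtain rfl : c = t := htc
    rw [M.dp_eq, if_pos rfl, Finset.sum_mul]
    refine Finset.sum_congr rfl fun g _ => ?_
    rw [M.dp_eq, if_pos rfl]
    congr 1
    refine Finset.prod_congr rfl fun y hy => Finset.sum_congr rfl fun x' hx' => ?_
    congr 1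
    refine M.dp_congr y (M.mem_ch.1 hy).1 (fun d k _ hd z _ => ?_) x' (Finset.mem_range.1 hx')
    have : d ≠ c := by
      rintro rfl
      have h1 := M.dep_iterate hc.le (by rw [hd]; exact (M.mem_ch.1 hy).1)
      have h2 := M.dep_ch hy
      rw [hd] at h1
      omega
    simp [this]
  | succ j ih =>
    intro t ht htc x hx
    rw [Function.iterate_succ_apply'] at htc
    set y₀ := M.par^[j] c with hy₀
    have hlt : y₀ < M.N := M.lt_of_par_lt (M.iterate_le hc.le) (by rw [htc]; exact ht)
    have hmem : y₀ ∈ M.ch t := M.mem_ch.2 ⟨hlt, htc⟩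
    have hne : t ≠ c := by
      rintro rfl
      have h1 := M.dep_iterate (k := j) hc.le hlt
      have h2 := M.dep_ch hmem
      rw [← hy₀] at h1
      omega
    -- The weight of `c` enters only through the child `y₀` whose subtree contains `c`. So the
    -- weight of `t` is linear in the message from `y₀`, and the other factors do not depend on the
    -- weight of `c`.
    have hother : ∀ y ∈ (M.ch t).erase y₀, ∀ (F F' : ℕ → R) (x' : ℕ), x' < M.G * M.H →
        M.dp (fun d x => if d = c then F x else Φ d x) y x' =
          M.dp (fun d x => if d = c then F' x else Φ d x) y x' := by
      intro y hy F F' x' hx'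
      refine M.dp_congr y (M.mem_ch.1 (Finset.mem_of_mem_erase hy)).1 (fun d k _ hd z _ => ?_) x' hx'
      have : d ≠ c := by
        rintro rfl
        exact (Finset.mem_erase.1 hy).1
          (M.ch_unique hc.le (Finset.mem_erase.1 hy).2 hmem hd hy₀.symm)
      simp [this]
    have hL : ∀ F : ℕ → R, M.dp (fun d x => if d = c then F x else Φ d x) t x =
        (∑ x' ∈ Finset.range (M.G * M.H), M.ψ y₀ x' x *
          M.dp (fun d x => if d = c then F x else Φ d x) y₀ x') *
        (Φ t x * ∏ y ∈ (M.ch t).erase y₀, ∑ x' ∈ Finset.range (M.G * M.H),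
          M.ψ y x' x * M.dp (fun d x => if d = c then 0 else Φ d x) y x') := by
      intro F
      rw [M.dp_eq, if_neg hne, ← Finset.mul_prod_erase _ _ hmem, mul_left_comm]
      congr 2
      refine Finset.prod_congr rfl fun y hy => Finset.sum_congr rfl fun x' hx' => ?_
      rw [hother y hy F (fun _ => 0) x' (Finset.mem_range.1 hx')]
    rw [hL fun x => ∑ g ∈ s, f g x]
    simp_rw [hL (f _)]
    rw [← Finset.sum_mul]
    congr 1
    rw [Finset.sum_comm]
    refine Finset.sum_congr rfl fun x' hx' => ?_
    rw [ih y₀ hlt rfl x' (Finset.mem_range.1 hx'), Finset.mul_sum]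

/-! #### Rankings -/

/-- The function `f` of the ranking for `r` is at least `1` at `d`, does not decrease on the way up
through ranks at most `r`, and must increase by one more at `c`. This contradicts `f ≤ 1`. -/
theorem same_rank_above {c d k r : ℕ} (hc : c < M.N) (hd : d < M.N) (hk : 1 ≤ k)
    (h : M.par^[k] d = c) (hpath : ∀ j, 1 ≤ j → j < k → M.rk (M.par^[j] d) ≤ r)
    (hrd : M.rk d = r) (hrc : M.rk c = r) : False := by
  obtain ⟨f, hf1, hf⟩ := M.ranking r
  have step : ∀ v y, v < M.N → y < M.N → M.par y = v → M.rk v ≤ r →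
      f y + (if M.rk v = r then 1 else 0) ≤ f v := by
    intro v y hv hy hyv hr
    have := hf v hv hr
    have h2 := Finset.single_le_sum (f := f) (s := M.ch v) (fun _ _ => Nat.zero_le _)
      (M.mem_ch.2 ⟨hy, hyv⟩)
    unfold ch at h2
    omega
  have hlt : ∀ j, j ≤ k → M.par^[j] d < M.N := fun j hj =>
    M.iterate_lt hd.le (by rw [h]; exact hc) hj
  have hpos : ∀ j, j < k → 1 ≤ f (M.par^[j] d) := by
    intro j
    induction j with
    | zero =>
      intro _
      have := hf d hd hrd.le
      rw [if_pos hrd] at this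
      simp only [Function.iterate_zero, id]
      omega
    | succ j ih =>
      intro hj
      have h1 := step (M.par^[j + 1] d) (M.par^[j] d) (hlt _ hj.le) (hlt _ (by omega))
        (Function.iterate_succ_apply' _ _ _).symm (hpath _ (by omega) hj)
      have := ih (by omega)
      omega
  obtain ⟨k, rfl⟩ : ∃ k', k = k' + 1 := ⟨k - 1, by omega⟩
  have h1 := step c (M.par^[k] d) hc (hlt _ (by omega))
    (by rw [← h, Function.iterate_succ_apply']) hrc.le
  rw [if_pos hrc] at h1
  have := hpos k (by omega)
  have := hf1 c
  omega

/-- Where two paths from different nodes of rank `r` meet, coming from two children with `f ≥ 1`,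
`f` would have to be at least `2`; if one node lies above the other, `same_rank_above` applies.
Hence a guess can be indexed by the rank of its node: from a given `t` at most one node of each rank
is visible. -/
theorem same_rank_unique {r : ℕ} : ∀ i j b c t, b < M.N → c < M.N → t < M.N →
    M.rk b = r → M.rk c = r → M.par^[i] b = t → M.par^[j] c = t →
    (∀ l, 1 ≤ l → l ≤ i → M.rk (M.par^[l] b) ≤ r) →
    (∀ l, 1 ≤ l → l ≤ j → M.rk (M.par^[l] c) ≤ r) → b = c := by
  obtain ⟨f, hf1, hf⟩ := M.ranking r
  have hpos : ∀ b, b < M.N → M.rk b = r → ∀ i, M.par^[i] b < M.N →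
      (∀ l, 1 ≤ l → l ≤ i → M.rk (M.par^[l] b) ≤ r) → 1 ≤ f (M.par^[i] b) := by
    intro b hb hr i
    induction i with
    | zero =>
      intro _ _
      have := hf b hb hr.le
      rw [if_pos hr] at this
      simp only [Function.iterate_zero, id]
      omega
    | succ i ih =>
      intro hlt hl
      have hlt' := M.iterate_lt hb.le hlt (Nat.le_succ i)
      have h1 := ih hlt' fun l h1 h2 => hl l h1 (by omega)
      have h2 := hf _ hlt (hl _ (by omega) le_rfl)
      have h3 := Finset.single_le_sum (f := f) (s := M.ch (M.par^[i + 1] b))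
        (fun _ _ => Nat.zero_le _)
        (M.mem_ch.2 ⟨hlt', (Function.iterate_succ_apply' M.par i b).symm⟩)
      unfold ch at h3
      omega
  intro i
  induction i with
  | zero =>
    intro j b c t hb hc ht hrb hrc hbt hct hlb hlc
    obtain rfl : b = t := hbt
    rcases Nat.eq_zero_or_pos j with rfl | hj
    · exact hct.symm
    · exact (M.same_rank_above hb hc hj hct (fun l h1 h2 => hlc l h1 h2.le) hrc hrb).elim
  | succ i ih =>
    intro j b c t hb hc ht hrb hrc hbt hct hlb hlc
    rcases Nat.eq_zero_or_pos j with rfl | hj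
    · obtain rfl : c = t := hct
      exact (M.same_rank_above hc hb (Nat.succ_pos i) hbt (fun l h1 h2 => hlb l h1 h2.le)
        hrb hrc).elim
    · obtain ⟨j, rfl⟩ : ∃ j', j = j' + 1 := ⟨j - 1, by omega⟩
      have hbl := M.iterate_lt (k := i + 1) (j := i) hb.le (by rw [hbt]; exact ht) (by omega)
      have hcl := M.iterate_lt (k := j + 1) (j := j) hc.le (by rw [hct]; exact ht) (by omega)
      have h1 := hpos b hb hrb i hbl fun l h1 h2 => hlb l h1 (by omega)
      have h2 := hpos c hc hrc j hcl fun l h1 h2 => hlc l h1 (by omega)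
      rcases eq_or_ne (M.par^[i] b) (M.par^[j] c) with he | he
      · exact ih j b c _ hb hc hbl hrb hrc rfl he.symm (fun l h1 h2 => hlb l h1 (by omega))
          (fun l h1 h2 => hlc l h1 (by omega))
      · exfalso
        have hrt : M.rk t ≤ r := by rw [← hbt]; exact hlb _ (by omega) le_rfl
        have h3 := hf t ht hrt
        have h4 : ∑ y ∈ {M.par^[i] b, M.par^[j] c}, f y ≤
            ∑ y ∈ (Finset.range M.N).filter (fun y => M.par y = t), f y := by
          refine Finset.sum_le_sum_of_subset fun y hy => ?_
          rw [Finset.mem_insert, Finset.mem_singleton] at hy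
          rw [Finset.mem_filter, Finset.mem_range]
          rcases hy with rfl | rfl
          · exact ⟨hbl, by rw [← Function.iterate_succ_apply' M.par, hbt]⟩
          · exact ⟨hcl, by rw [← Function.iterate_succ_apply' M.par, hct]⟩
        rw [Finset.sum_pair he] at h4
        have := hf1 t
        omega

/-- The highest ancestor of `c` that is reached through nodes of smaller rank. -/
def top (c : ℕ) : ℕ := iterN M.N c fun _ a => if M.rk (M.par a) < M.rk c then M.par a else a

/-- The ascent stops below a node of rank at least that of `c`. Equality is impossible: by
`same_rank_above` inside the tree, and because `N` has the rank `L`, above all others. So the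
message of `top c` leaves the region of ranks up to that of `c`. -/
theorem top_spec {c : ℕ} (hc : c < M.N) : M.top c < M.N ∧ M.rk c < M.rk (M.par (M.top c)) ∧
    ∃ k, M.par^[k] c = M.top c ∧ ∀ j, 1 ≤ j → j ≤ k → M.rk (M.par^[j] c) < M.rk c := by
  have key : ∀ i, ∃ k, (iterN i c fun _ a => if M.rk (M.par a) < M.rk c then M.par a else a) =
      M.par^[k] c ∧ M.par^[k] c < M.N ∧ (∀ j, 1 ≤ j → j ≤ k → M.rk (M.par^[j] c) < M.rk c) ∧
      (k = i ∨ M.rk c ≤ M.rk (M.par (M.par^[k] c))) := by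
    intro i
    induction i with
    | zero => exact ⟨0, rfl, hc, fun j h1 h2 => by omega, Or.inl rfl⟩
    | succ i ih =>
      obtain ⟨k, h1, h2, h3, h4⟩ := ih
      rw [iterN_succ, h1]
      by_cases hlt : M.rk (M.par (M.par^[k] c)) < M.rk c
      · rw [if_pos hlt]
        refine ⟨k + 1, (Function.iterate_succ_apply' _ _ _).symm, ?_, fun j hj1 hj2 => ?_, ?_⟩
        · rw [Function.iterate_succ_apply']
          rcases (M.par_le _ h2).lt_or_eq with h | h
          · exact h
          · rw [h, M.rk_N] at hlt
            have := M.rk_lt c hc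
            omega
        · rcases Nat.lt_or_ge k j with h | h
          · obtain rfl : j = k + 1 := by omega
            rwa [Function.iterate_succ_apply']
          · exact h3 j hj1 h
        · rcases h4 with h4 | h4
          · exact Or.inl (by omega)
          · omega
      · rw [if_neg hlt]
        exact ⟨k, rfl, h2, h3, Or.inr (not_lt.1 hlt)⟩
  obtain ⟨k, h1, h2, h3, h4⟩ := key M.N
  have h1' : M.par^[k] c = M.top c := h1.symm
  have h5 : M.rk c ≤ M.rk (M.par (M.par^[k] c)) := by
    rcases h4 with rfl | h4
    -- If all `N` steps went up, the depth of `c` would exceed `N`.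
    · exfalso
      have e1 := M.dep_iterate hc.le h2
      have e2 := M.dep_le c hc
      have e3 := M.dep_par _ h2
      omega
    · exact h4
  rw [h1'] at h5 h2
  refine ⟨h2, lt_of_le_of_ne h5 fun heq => ?_, k, h1', h3⟩
  rcases (M.par_le _ h2).lt_or_eq with h | h
  · refine M.same_rank_above (k := k + 1) h hc (by omega)
      (by rw [Function.iterate_succ_apply', h1']) (fun j hj1 hj2 => (h3 j hj1 (by omega)).le) rfl
      heq.symm
  · rw [h, M.rk_N] at heq
    have := M.rk_lt c hc
    omega

theorem top_unique {c t k : ℕ} (hc : c < M.N) (h : M.par^[k] c = t)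
    (hpath : ∀ j, 1 ≤ j → j ≤ k → M.rk (M.par^[j] c) < M.rk c) (ht : M.rk c ≤ M.rk (M.par t)) :
    M.top c = t := by
  obtain ⟨-, h1, k', h2, h3⟩ := M.top_spec hc
  rcases lt_trichotomy k k' with hk | hk | hk
  · have := h3 (k + 1) (by omega) hk
    rw [Function.iterate_succ_apply', h] at this
    omega
  · rw [← h2, ← h, hk]
  · have := hpath (k' + 1) (by omega) hk
    rw [Function.iterate_succ_apply', h2] at this
    omega

end Model

end SatTW

/-! ### The counter over the guesses and the meaning of its tables -/

namespace SatTW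

/-- The working state of the evaluation: the current rank, the digits of the counter, and the
tables. -/
structure Work (R : Type) where
  lev : ℕ
  dig : ℕ → ℕ
  U : ℕ → ℕ → R
  MSG : ℕ → ℕ → R
  ACC : ℕ → ℕ → R

namespace Model

variable {R : Type} [CommRing R] (M : Model R)

/-- The message from `y` to its parent according to the table of `y`. -/
def msgU (s : Work R) (y h : ℕ) : R := ∑ h' ∈ Finset.range M.H,
  M.ψ y (s.dig (M.rk y) / 2 * M.H + h') (s.dig (M.rk (M.par y)) / 2 * M.H + h) * s.U y h'

/-- The new entries of the table of `c`. -/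
def comb (s : Work R) (c h : ℕ) : R := M.φ c (s.dig (M.rk c) / 2 * M.H + h) *
  ∏ y ∈ M.ch c, if M.rk c < M.rk y then M.msgU s y h else s.MSG y h

/-- One event of the evaluation. -/
def step (s : Work R) : Work R :=
  if s.lev < M.L then
    if s.dig s.lev < 2 * M.G then
      -- The digits `2 g` and `2 g + 1` both stand for the guess `g`. At `2 g` the messages into the
      -- nodes of this rank are ready and give their tables; setting `lev` to `0` runs the lower
      -- ranks again. At `2 g + 1` this second run has carried the tables up to the tops, and the
      -- resulting messages are accumulated. At `2 G` the accumulated sums become messages and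
      -- control passes to the next rank.
      if s.dig s.lev % 2 = 0 then
        { s with
          U := fun c h => if c < M.N ∧ h < M.H ∧ M.rk c = s.lev then M.comb s c h else s.U c h
          dig := upd s.dig s.lev (s.dig s.lev + 1)
          lev := 0 }
      else
        { s with
          ACC := fun c h => if c < M.N ∧ h < M.H ∧ M.rk c = s.lev then
              s.ACC c h + (if M.top c = c then M.msgU s c h else s.MSG (M.top c) h) else s.ACC c h
          dig := upd s.dig s.lev (s.dig s.lev + 1)
          lev := 0 }
    else
      { s with
        MSG := fun t h => if t < M.N ∧ h < M.H then iterN M.N (s.MSG t h) fun c a =>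
          if M.rk c = s.lev ∧ M.top c = t then s.ACC c h else a else s.MSG t h
        ACC := fun c h => if c < M.N ∧ h < M.H ∧ M.rk c = s.lev then 0 else s.ACC c h
        dig := upd s.dig s.lev 0
        lev := s.lev + 1 }
  else s

/-- The number of events in a complete run of the ranks below `r`. -/
def events : ℕ → ℕ
  | 0 => 0
  -- Each of the `2 G + 1` values of digit `r` is reached by a run of the lower ranks and followed
  -- by one event of rank `r`.
  | r + 1 => (2 * M.G + 1) * (events r + 1)

/-- The nodes below `t` whose guess is fixed: those of rank at least `r` and of higher rank than
every node between them and `t`. -/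
def Fixed (r t d : ℕ) : Prop :=
  r ≤ M.rk d ∧ ∃ k, M.par^[k] d = t ∧ ∀ j, 1 ≤ j → j ≤ k → M.rk (M.par^[j] d) < M.rk d

open Classical in
/-- The node weights with fixed guesses. -/
noncomputable def fixW (γ : ℕ → ℕ) (r t d x : ℕ) : R :=
  if M.Fixed r t d ∧ x / M.H ≠ γ (M.rk d) then 0 else M.φ d x

noncomputable def W (γ : ℕ → ℕ) (r t x : ℕ) : R := M.dp (M.fixW γ r t) t x

noncomputable def msg (γ : ℕ → ℕ) (r t x : ℕ) : R :=
  ∑ x' ∈ Finset.range (M.G * M.H), M.ψ t x' x * M.W γ r t x'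

/-- `b` is one of the highest nodes of rank at least `r` strictly below `t`. -/
def Vis (r t b : ℕ) : Prop :=
  b < M.N ∧ r ≤ M.rk b ∧ ∃ k, 1 ≤ k ∧ M.par^[k] b = t ∧
    ∀ j, 1 ≤ j → j ≤ k → M.rk (M.par^[j] b) < r

abbrev guess (s : Work R) : ℕ → ℕ := fun i => s.dig i / 2

/-- Only the `H` states that agree with the current guess are stored; all other states of `b` have
weight `0` by `W_eq_zero`. -/
def GoodU (s : Work R) (b : ℕ) : Prop :=
  guess s (M.rk b) < M.G ∧
    ∀ h, h < M.H → s.U b h = M.W (guess s) (M.rk b) b (guess s (M.rk b) * M.H + h)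

theorem index_lt {g h : ℕ} (hg : g < M.G) (hh : h < M.H) : g * M.H + h < M.G * M.H := by
  calc g * M.H + h < (g + 1) * M.H := by rw [Nat.add_mul]; omega
    _ ≤ M.G * M.H := Nat.mul_le_mul_right _ hg

theorem index_div {g h : ℕ} (hh : h < M.H) : (g * M.H + h) / M.H = g := by
  rw [Nat.add_comm, Nat.add_mul_div_right _ _ M.H_pos, Nat.div_eq_of_lt hh, zero_add]

theorem fixed_self {r t : ℕ} (h : r ≤ M.rk t) : M.Fixed r t t :=
  ⟨h, 0, rfl, fun j h1 h2 => by omega⟩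

theorem W_congr {γ γ' : ℕ → ℕ} {r r' t : ℕ} (ht : t < M.N) (h : ∀ i, r ≤ i → γ i = γ' i)
    (hF : ∀ d, d < M.N → (M.Fixed r t d ↔ M.Fixed r' t d)) {x : ℕ} (hx : x < M.G * M.H) :
    M.W γ r t x = M.W γ' r' t x := by
  refine M.dp_congr t ht (fun d k hdN hd z hz => ?_) x hx
  unfold fixW
  by_cases hf : M.Fixed r t d
  · have hf' := (hF d hdN).1 hf
    simp [hf, hf', h _ hf.1]
  · have hf' : ¬ M.Fixed r' t d := fun h => hf ((hF d hdN).2 h)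
    simp [hf, hf']

theorem msg_congr {γ γ' : ℕ → ℕ} {r r' t : ℕ} (ht : t < M.N) (h : ∀ i, r ≤ i → γ i = γ' i)
    (hF : ∀ d, d < M.N → (M.Fixed r t d ↔ M.Fixed r' t d)) (x : ℕ) :
    M.msg γ r t x = M.msg γ' r' t x :=
  Finset.sum_congr rfl fun x' hx' => by rw [M.W_congr ht h hF (Finset.mem_range.1 hx')]

theorem W_eq_zero {γ : ℕ → ℕ} {r t x : ℕ} (h : r ≤ M.rk t) (hx : x / M.H ≠ γ (M.rk t)) :
    M.W γ r t x = 0 := by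
  unfold W
  rw [M.dp_eq, fixW, if_pos ⟨M.fixed_self h, hx⟩, zero_mul]

theorem GoodU.congr {s s' : Work R} {b : ℕ} (hb : b < M.N) (h : M.GoodU s b)
    (hU : ∀ x, s'.U b x = s.U b x)
    (hd : ∀ i, M.rk b ≤ i → guess s' i = guess s i) : M.GoodU s' b := by
  refine ⟨by rw [hd _ le_rfl]; exact h.1, fun x hx => ?_⟩
  rw [hU, h.2 x hx, hd _ le_rfl]
  exact M.W_congr hb (fun i hi => (hd i hi).symm) (fun d _ => Iff.rfl) (M.index_lt h.1 hx)

/-- The sum over all `G * H` states of `b` collapses to the `H` stored ones, since `b` itself is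
fixed. -/
theorem msgU_eq {s : Work R} {b : ℕ} (hb : M.GoodU s b) (h : ℕ) :
    M.msgU s b h =
      M.msg (guess s) (M.rk b) b (guess s (M.rk (M.par b)) * M.H + h) := by
  unfold msgU msg
  rw [← Finset.sum_subset (s₁ := (Finset.range M.H).image fun h' => guess s (M.rk b) * M.H + h')
    (s₂ := Finset.range (M.G * M.H)),
    Finset.sum_image fun a _ c _ hac => by simpa using hac]
  · exact Finset.sum_congr rfl fun h' hh' => by rw [hb.2 h' (Finset.mem_range.1 hh')]
  · intro x hx
    obtain ⟨h', hh', rfl⟩ := Finset.mem_image.1 hx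
    exact Finset.mem_range.2 (M.index_lt hb.1 (Finset.mem_range.1 hh'))
  · intro x _ hx'
    rw [M.W_eq_zero le_rfl, mul_zero]
    intro hx
    refine hx' (Finset.mem_image.2 ⟨x % M.H, Finset.mem_range.2 (Nat.mod_lt _ M.H_pos), ?_⟩)
    rw [← hx, Nat.div_add_mod']

/-- Fixed nodes below a child `y` of `c`. -/
theorem fixed_ch {c y d k : ℕ} (hc : c < M.N) (hy : y ∈ M.ch c) (hd : d < M.N)
    (hk : M.par^[k] d = y) :
    M.Fixed (M.rk c) c d ↔ M.Fixed (if M.rk c < M.rk y then M.rk y else M.rk c) y d := by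
  obtain ⟨hyN, hyc⟩ := M.mem_ch.1 hy
  have hdk : M.par^[k + 1] d = c := by rw [Function.iterate_succ_apply', hk, hyc]
  have e1 := M.dep_iterate hd.le (by rw [hk]; exact hyN)
  have e2 := M.dep_ch hy
  rw [hk] at e1
  -- A node `d` below `y` has higher rank than `y`, or is `y`, or is hidden by `y`. So whatever is
  -- visible from a child of higher rank than `c` has at least the rank of this child, and the
  -- threshold can be raised to it.
  have hyd : M.rk y < M.rk d ∨ k = 0 ∧ d = y ∨ ∃ j, 1 ≤ j ∧ j ≤ k ∧
      M.rk d ≤ M.rk (M.par^[j] d) := by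
    rcases Nat.eq_zero_or_pos k with rfl | hpos
    · exact Or.inr (Or.inl ⟨rfl, hk⟩)
    · rcases Nat.lt_or_ge (M.rk y) (M.rk d) with h | h
      · exact Or.inl h
      · exact Or.inr (Or.inr ⟨k, hpos, le_rfl, by rwa [hk]⟩)
  constructor
  · rintro ⟨h1, k', h2, h3⟩
    have e3 := M.dep_iterate (k := k') hd.le (by rw [h2]; exact hc)
    rw [h2] at e3
    obtain rfl : k' = k + 1 := by omega
    refine ⟨?_, k, hk, fun j hj1 hj2 => h3 j hj1 (by omega)⟩
    split
    · rcases hyd with h | ⟨-, rfl⟩ | ⟨j, hj1, hj2, hj3⟩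
      · exact h.le
      · exact le_rfl
      · have := h3 j hj1 (by omega)
        omega
    · exact h1
  · rintro ⟨h1, k', h2, h3⟩
    have e3 := M.dep_iterate (k := k') hd.le (by rw [h2]; exact hyN)
    rw [h2] at e3
    obtain rfl : k' = k := by omega
    have hle : M.rk c ≤ M.rk d := by
      split at h1 <;> omega
    refine ⟨hle, k' + 1, hdk, fun j hj1 hj2 => ?_⟩
    rcases Nat.lt_or_ge k' j with hj | hj
    · obtain rfl : j = k' + 1 := by omega
      rw [hdk]
      refine lt_of_le_of_ne hle fun heq => ?_
      exact M.same_rank_above hc hd (by omega) hdk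
        (fun j hj1 hj2 => (h3 j hj1 (by omega)).le) rfl heq
    · exact h3 j hj1 hj

/-- The recursion for the table of `c`, with the thresholds of `fixed_ch`: a child of higher rank
contributes through its own table, a child of lower rank through a stored message. -/
theorem W_unfold {γ : ℕ → ℕ} {c h : ℕ} (hc : c < M.N) (hh : h < M.H) :
    M.W γ (M.rk c) c (γ (M.rk c) * M.H + h) = M.φ c (γ (M.rk c) * M.H + h) *
      ∏ y ∈ M.ch c, M.msg γ (if M.rk c < M.rk y then M.rk y else M.rk c) y
        (γ (M.rk c) * M.H + h) := by
  unfold W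
  rw [M.dp_eq]
  congr 1
  · rw [fixW, if_neg]
    rintro ⟨-, h2⟩
    exact h2 (M.index_div hh)
  · refine Finset.prod_congr rfl fun y hy => Finset.sum_congr rfl fun x' hx' => ?_
    congr 1
    refine M.dp_congr y (M.mem_ch.1 hy).1 (fun d k hdN hd z hz => ?_) x' (Finset.mem_range.1 hx')
    unfold fixW
    rw [M.fixed_ch hc hy hdN hd]

/-- Summing over the guess of the node of rank `r`. -/
theorem msg_succ_of_rank {γ : ℕ → ℕ} {r t c k : ℕ} (ht : t < M.N) (hc : c < M.N)
    (hk : M.par^[k] c = t) (hr : M.rk c = r)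
    (hpath : ∀ j, 1 ≤ j → j ≤ k → M.rk (M.par^[j] c) < r) (x : ℕ) :
    M.msg γ (r + 1) t x = ∑ g ∈ Finset.range M.G, M.msg (upd γ r g) r t x := by
  unfold msg
  rw [Finset.sum_comm]
  refine Finset.sum_congr rfl fun x' hx' => ?_
  rw [← Finset.mul_sum]
  congr 1
  have hx'' := Finset.mem_range.1 hx'
  have hfc : M.Fixed r t c := ⟨hr.ge, k, hk, fun j h1 h2 => by rw [hr]; exact hpath j h1 h2⟩
  -- When the threshold rises from `r` to `r + 1`, `c` is the only node whose guess is released. Its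
  -- weight is the sum over `g` of its weights restricted to the guess `g`, and `dp_sum` carries
  -- this sum through the message.
  have huniq : ∀ d, d < M.N → M.Fixed r t d → M.rk d = r → d = c := by
    rintro d hd ⟨-, k', hk', hp'⟩ hrd
    exact M.same_rank_unique k' k d c t hd hc ht hrd hr hk' hk
      (fun l h1 h2 => by have := hp' l h1 h2; omega) (fun l h1 h2 => (hpath l h1 h2).le)
  have h1 := M.dp_sum (Finset.range M.G) (fun g z => if z / M.H ≠ g then 0 else M.φ c z)
    (M.fixW γ (r + 1) t) hc k t ht hk x' hx''
  have h2 : M.W γ (r + 1) t x' = M.dp (fun d z => if d = c then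
      ∑ g ∈ Finset.range M.G, (if z / M.H ≠ g then 0 else M.φ c z)
      else M.fixW γ (r + 1) t d z) t x' := by
    refine M.dp_congr t ht (fun d k' hdN hd z hz => ?_) x' hx''
    by_cases hdc : d = c
    · subst hdc
      have hnf : ¬ M.Fixed (r + 1) t d := fun h => by have := h.1; omega
      have hz' : z / M.H < M.G := Nat.div_lt_of_lt_mul (by rwa [mul_comm])
      simp only [fixW, hnf, false_and, if_false, if_true, ne_eq, ite_not]
      rw [Finset.sum_ite_eq, if_pos (Finset.mem_range.2 hz')]
    · simp [hdc]
  rw [h2, h1]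
  refine Finset.sum_congr rfl fun g hg => ?_
  refine M.dp_congr t ht (fun d k' hdN hd z hz => ?_) x' hx''
  by_cases hdc : d = c
  · subst hdc
    simp [fixW, hfc, hr]
  · have hiff : M.Fixed (r + 1) t d ↔ M.Fixed r t d := by
      constructor
      · rintro ⟨h1, h2⟩
        exact ⟨by omega, h2⟩
      · intro h
        have : M.rk d ≠ r := fun he => hdc (huniq d hdN h he)
        exact ⟨by have := h.1; omega, h.2⟩
    rw [if_neg hdc]
    unfold fixW
    rw [hiff]
    by_cases hf : M.Fixed r t d
    · have : M.rk d ≠ r := fun he => hdc (huniq d hdN hf he)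
      rw [show upd γ r g (M.rk d) = γ (M.rk d) from if_neg this]
    · simp [hf]

/-- No guess is released, so the same nodes are fixed for both thresholds, and the value of the
digit of rank `r` is irrelevant. -/
theorem msg_succ_of_no_rank {γ γ' : ℕ → ℕ} {r t : ℕ} (ht : t < M.N)
    (hγ : ∀ i, r + 1 ≤ i → γ' i = γ i)
    (h : ∀ d, d < M.N → M.Fixed r t d → M.rk d ≠ r) (x : ℕ) :
    M.msg γ (r + 1) t x = M.msg γ' r t x := by
  refine M.msg_congr ht (fun i hi => (hγ i hi).symm) (fun d hd => ?_) x
  constructor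
  · rintro ⟨h1, h2⟩
    exact ⟨by omega, h2⟩
  · intro hf
    have := h d hd hf
    exact ⟨by have := hf.1; omega, hf.2⟩

end Model
end SatTW

/-! ### Correctness of the counter, by induction on the rank -/

namespace SatTW

theorem iterN_ite_none {α : Type} (n : ℕ) (a : α) (p : ℕ → Prop) [DecidablePred p] (f : ℕ → α)
    (h : ∀ c, c < n → ¬ p c) : iterN n a (fun c acc => if p c then f c else acc) = a := by
  induction n with
  | zero => rfl
  | succ n ih =>
    rw [iterN_succ, if_neg (h n (Nat.lt_succ_self n)), ih fun c hc => h c (by omega)]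

theorem iterN_ite_unique {α : Type} (n : ℕ) (a : α) (p : ℕ → Prop) [DecidablePred p] (f : ℕ → α)
    {c : ℕ} (hc : c < n) (hp : p c) (h : ∀ c', c' < n → p c' → c' = c) :
    iterN n a (fun c acc => if p c then f c else acc) = f c := by
  induction n with
  | zero => omega
  | succ n ih =>
    rw [iterN_succ]
    by_cases hn : p n
    · rw [if_pos hn, h n (Nat.lt_succ_self n) hn]
    · rw [if_neg hn]
      have : c ≠ n := by rintro rfl; exact hn hp
      exact ih (by omega) fun c' hc' => h c' (by omega)

namespace Model

variable {R : Type} [CommRing R] (M : Model R)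

/-- Only digits and accumulators below `r` have to be clear; messages, and tables of lower rank, may
be left over from earlier guesses because a run recomputes what it uses. -/
structure Start (r : ℕ) (s : Work R) : Prop where
  lev : s.lev = 0
  dig : ∀ i, i < r → s.dig i = 0
  ACC : ∀ c h, c < M.N → h < M.H → M.rk c < r → s.ACC c h = 0

/-- The effect of a complete run of the ranks below `r`. -/
structure Block (r : ℕ) (s s' : Work R) : Prop where
  lev : s'.lev = r
  dig : s'.dig = s.dig
  ACC : s'.ACC = s.ACC
  U : ∀ c, c < M.N → r ≤ M.rk c → ∀ h, s'.U c h = s.U c h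
  -- Correctness is claimed only for messages that leave the region of ranks below `r`, and only if
  -- the tables at the lower boundary of that region are correct. The condition is needed: in the
  -- first of the two runs for a guess, the tables of rank `r` are still stale.
  MSG : ∀ t, t < M.N → M.rk t < r → r ≤ M.rk (M.par t) → (∀ b, M.Vis r t b → M.GoodU s b) →
    ∀ h, h < M.H → s'.MSG t h = M.msg (guess s) r t (guess s (M.rk (M.par t)) * M.H + h)

/-- The state after `j` of the guesses for rank `r`. -/
structure Mid (r j : ℕ) (s s' : Work R) : Prop where
  lev : s'.lev = 0
  dig : s'.dig = upd s.dig r (2 * j)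
  ACC_same : ∀ c h, ¬ (c < M.N ∧ h < M.H ∧ M.rk c = r) → s'.ACC c h = s.ACC c h
  ACC : ∀ c, c < M.N → M.rk c = r → (∀ b, M.Vis (r + 1) (M.top c) b → M.GoodU s b) →
    ∀ h, h < M.H → s'.ACC c h = ∑ g ∈ Finset.range j,
      M.msg (upd (guess s) r g) r (M.top c) (guess s (M.rk (M.par (M.top c))) * M.H + h)
  U : ∀ c, c < M.N → r + 1 ≤ M.rk c → ∀ h, s'.U c h = s.U c h

/-- Paths are joined at `c`: what a child of `c` sees through ranks below `r` is seen from `t`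
through ranks below `r + 1`. The tables assumed correct for rank `r + 1` are therefore those that
the inner run below `c` needs. -/
theorem vis_of_ch {r t b c k y : ℕ} (hc : c < M.N) (hr : M.rk c = r) (hy : y ∈ M.ch c)
    (hv : M.Vis r y b)
    (hk : M.par^[k] c = t) (hp : ∀ j, 1 ≤ j → j ≤ k → M.rk (M.par^[j] c) < r) :
    M.Vis (r + 1) t b := by
  obtain ⟨hyN, hyc⟩ := M.mem_ch.1 hy
  obtain ⟨hb, hrb, k', hk1, hk', hp'⟩ := hv
  have hbc : M.par^[k' + 1] b = c := by rw [Function.iterate_succ_apply', hk', hyc]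
  refine ⟨hb, ?_, k + (k' + 1), by omega, by rw [Function.iterate_add_apply, hbc, hk],
    fun j hj1 hj2 => ?_⟩
  · refine Nat.lt_of_le_of_ne hrb fun heq => ?_
    exact M.same_rank_above hc hb (by omega) hbc (fun j hj1 hj2 => (hp' j hj1 (by omega)).le)
      heq.symm hr
  · rcases Nat.lt_or_ge k' j with h | h
    · rcases Nat.eq_or_lt_of_le h with h | h
      · rw [← h, Nat.succ_eq_add_one, hbc]
        omega
      · obtain ⟨i, rfl⟩ : ∃ i, j = i + (k' + 1) := ⟨j - (k' + 1), by omega⟩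
        rw [Function.iterate_add_apply, hbc]
        have := hp i (by omega) (by omega)
        omega
    · have := hp' j hj1 h
      omega

theorem vis_ch {r t c k y : ℕ} (hr : M.rk c = r) (hy : y ∈ M.ch c)
    (hyr : r < M.rk y) (hk : M.par^[k] c = t)
    (hp : ∀ j, 1 ≤ j → j ≤ k → M.rk (M.par^[j] c) < r) : M.Vis (r + 1) t y := by
  obtain ⟨hyN, hyc⟩ := M.mem_ch.1 hy
  refine ⟨hyN, hyr, k + 1, by omega, by rw [Function.iterate_succ_apply, hyc, hk],
    fun j hj1 hj2 => ?_⟩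
  obtain ⟨i, rfl⟩ : ∃ i, j = i + 1 := ⟨j - 1, by omega⟩
  rw [Function.iterate_succ_apply, hyc]
  rcases Nat.eq_zero_or_pos i with rfl | hi
  · simp only [Function.iterate_zero, id]
    omega
  · have := hp i hi (by omega)
    omega

/-- The tables of a node of rank `r` whose children are settled. -/
theorem comb_eq {s : Work R} {c h : ℕ} (hc : c < M.N) (hh : h < M.H)
    (h1 : ∀ y ∈ M.ch c, M.rk c < M.rk y → M.GoodU s y)
    (h2 : ∀ y ∈ M.ch c, M.rk y < M.rk c →
      s.MSG y h = M.msg (guess s) (M.rk c) y (guess s (M.rk c) * M.H + h)) :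
    M.comb s c h = M.W (guess s) (M.rk c) c (guess s (M.rk c) * M.H + h) := by
  rw [M.W_unfold hc hh]
  unfold comb
  congr 1
  refine Finset.prod_congr rfl fun y hy => ?_
  obtain ⟨hyN, hyc⟩ := M.mem_ch.1 hy
  by_cases hlt : M.rk c < M.rk y
  · rw [if_pos hlt, if_pos hlt, M.msgU_eq (h1 y hy hlt), hyc]
  · rw [if_neg hlt, if_neg hlt, h2 y hy]
    refine lt_of_le_of_ne (not_lt.1 hlt) fun heq => ?_
    exact M.same_rank_above (k := 1) hc hyN le_rfl hyc (fun j h1 h2 => by omega) heq rfl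

/-- One guess takes two inner runs. The first supplies the messages into each `c` of rank `r`, and
the even event combines them into the table of `c`. Only then can the nodes between `c` and `top c`
use this table: the second run carries it up, and the odd event adds the message of `top c` to the
accumulator of `c`. Guesses of higher rank stay fixed meanwhile. -/
theorem Mid.next {r j : ℕ} {s σ : Work R} (hr : r < M.L) (hj : j < M.G)
    (ih : ∀ s, M.Start r s → M.Block r s (M.step^[M.events r] s))
    (hs : M.Start (r + 1) s) (hm : M.Mid r j s σ) :
    M.Mid r (j + 1) s (M.step (M.step^[M.events r] (M.step (M.step^[M.events r] σ)))) := by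
  have hstart : M.Start r σ := by
    refine ⟨hm.lev, fun i hi => ?_, fun c h hc hh hrc => ?_⟩
    · rw [hm.dig, upd_apply, if_neg (by omega), hs.dig i (by omega)]
    · rw [hm.ACC_same c h (by omega), hs.ACC c h hc hh (by omega)]
  have hb := ih σ hstart
  set τ := M.step^[M.events r] σ with hτ
  have hτd : τ.dig r = 2 * j := by rw [hb.dig, hm.dig]; simp
  have hstep : M.step τ = { τ with
      U := fun c h => if c < M.N ∧ h < M.H ∧ M.rk c = r then M.comb τ c h else τ.U c h
      dig := upd τ.dig r (2 * j + 1)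
      lev := 0 } := by
    unfold step
    rw [hb.lev, if_pos hr, hτd, if_pos (by omega), if_pos (by omega)]
  set σ' := M.step τ with hσ'
  have hσ'dig : σ'.dig = upd s.dig r (2 * j + 1) := by
    rw [hstep]
    funext i
    simp only [hb.dig, hm.dig, upd_apply]
    split <;> rfl
  have hσ'ACC : σ'.ACC = σ.ACC := by rw [hstep]; exact hb.ACC
  have hgσ' : guess σ' = upd (guess s) r j := by
    funext i
    simp only [guess, hσ'dig, upd_apply]
    split <;> omega
  have hgτ : guess τ = upd (guess s) r j := by
    funext i
    simp only [guess, hb.dig, hm.dig, upd_apply]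
    split <;> omega
  have hgσ : guess σ = upd (guess s) r j := by
    funext i
    simp only [guess, hm.dig, upd_apply]
    split <;> omega
  have hstart' : M.Start r σ' := by
    refine ⟨by rw [hstep], fun i hi => ?_, fun c h hc hh hrc => ?_⟩
    · rw [hσ'dig, upd_apply, if_neg (by omega), hs.dig i (by omega)]
    · rw [hσ'ACC, hstart.ACC c h hc hh hrc]
  have hb' := ih σ' hstart'
  set τ' := M.step^[M.events r] σ' with hτ'
  have hτ'd : τ'.dig r = 2 * j + 1 := by rw [hb'.dig, hσ'dig]; simp
  have hstep' : M.step τ' = { τ' with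
      ACC := fun c h => if c < M.N ∧ h < M.H ∧ M.rk c = r then
        τ'.ACC c h + (if M.top c = c then M.msgU τ' c h else τ'.MSG (M.top c) h) else τ'.ACC c h
      dig := upd τ'.dig r (2 * j + 2)
      lev := 0 } := by
    unfold step
    rw [hb'.lev, if_pos hr, hτ'd, if_pos (by omega), if_neg (by omega)]
  have hσU : ∀ c, c < M.N → r + 1 ≤ M.rk c → ∀ h, σ'.U c h = s.U c h := by
    intro c hc hrc h
    rw [hstep]
    have : ¬ (c < M.N ∧ h < M.H ∧ M.rk c = r) := by omega
    simp only [this, if_false]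
    rw [hb.U c hc (by omega), hm.U c hc hrc]
  have hgood : ∀ w : Work R, guess w = upd (guess s) r j →
      (∀ c, c < M.N → r + 1 ≤ M.rk c → ∀ h, w.U c h = s.U c h) →
      ∀ b, b < M.N → r + 1 ≤ M.rk b → M.GoodU s b → M.GoodU w b := by
    intro w hw hwU b hb hrb hgb
    refine GoodU.congr M hb hgb (hwU b hb hrb) fun i hi => ?_
    rw [hw, upd_apply, if_neg (by omega)]
  rw [hstep']
  refine ⟨rfl, ?_, fun c h hch => ?_, fun c hc hrc hvis h hh => ?_, fun c hc hrc h => ?_⟩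
  · funext i
    simp only [hb'.dig, hσ'dig, upd_apply]
    split
    · omega
    · rfl
  · simp only [hch, if_false]
    rw [hb'.ACC, hσ'ACC, hm.ACC_same c h hch]
  · simp only [hc, hh, hrc, true_and, if_true]
    rw [hb'.ACC, hσ'ACC, hm.ACC c hc hrc hvis h hh, Finset.sum_range_succ]
    congr 1
    obtain ⟨htN, htr, k, hk, hp⟩ := M.top_spec hc
    rw [hrc] at htr hp
    have hgc : M.GoodU σ' c := by
      refine ⟨by rw [hgσ', hrc]; simpa using hj, fun h' hh' => ?_⟩
      have e1 : σ'.U c h' = M.comb τ c h' := by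
        rw [hstep]
        simp [hc, hh', hrc]
      rw [e1, M.comb_eq hc hh', hgτ, hgσ']
      · intro y hy hlt
        have hv := M.vis_ch hrc hy (by omega) hk hp
        exact hgood τ hgτ (fun c hc hrc h => by rw [hb.U c hc (by omega), hm.U c hc hrc]) y
          (M.mem_ch.1 hy).1 (by omega) (hvis y hv)
      · intro y hy hlt
        obtain ⟨hyN, hyc⟩ := M.mem_ch.1 hy
        rw [hb.MSG y hyN (by omega) (by rw [hyc]; omega) _ h' hh', hgσ, hgτ, hyc, hrc]
        intro b hv
        have hv' := M.vis_of_ch hc hrc hy hv hk hp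
        exact hgood σ hgσ hm.U b hv'.1 hv'.2.1 (hvis b hv')
    have hgτ' : guess τ' = upd (guess s) r j := by
      rw [← hgσ']
      funext i
      simp only [guess, hb'.dig]
    have hne : M.rk (M.par (M.top c)) ≠ r := by omega
    -- If the parent of `c` has higher rank, no run of lower ranks writes the message of `c`, and it
    -- is taken directly from the new table.
    by_cases htc : M.top c = c
    · rw [if_pos htc]
      have hgc' : M.GoodU τ' c := GoodU.congr M hc hgc (hb'.U c hc (by omega))
        fun i _ => by rw [hgτ', hgσ']
      rw [M.msgU_eq hgc', hgτ', hrc, htc]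
      congr 2
      rw [htc] at hne
      simp [hne]
    · rw [if_neg htc]
      have hrt : M.rk (M.top c) < r := by
        rcases Nat.eq_zero_or_pos k with rfl | hpos
        · exact absurd hk.symm htc
        · have := hp k hpos le_rfl
          rwa [hk] at this
      rw [hb'.MSG _ htN hrt (by omega) _ h hh, hgσ']
      · congr 2
        simp [hne]
      · intro b hv
        obtain ⟨hbN, hrb, kb, hkb1, hkb, hpb⟩ := hv
        -- The nodes of rank at least `r` visible from `top c` are `c`, whose table has just been
        -- computed, and nodes of higher rank, whose tables are correct by assumption.
        rcases Nat.eq_or_lt_of_le hrb with heq | hlt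
        · obtain rfl : b = c := M.same_rank_unique kb k b c _ hbN hc htN heq.symm hrc hkb hk
            (fun l h1 h2 => (hpb l h1 h2).le) (fun l h1 h2 => (hp l h1 h2).le)
          exact hgc
        · refine hgood σ' hgσ' hσU b hbN hlt (hvis b ⟨hbN, hlt, kb, hkb1, hkb, fun l h1 h2 => ?_⟩)
          have := hpb l h1 h2
          omega
  · show τ'.U c h = s.U c h
    rw [hb'.U c hc (by omega), hσU c hc hrc]

/-- The digits below `2 G` of rank `r` are treated by `Mid.next`. The run for the last digit `2 G`
belongs to no guess; it supplies the messages of those `t` from which no node of rank `r` is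
visible, and these do not depend on that digit. The last event then overwrites the messages of the
tops by the sums over all guesses and clears digit and accumulators. -/
theorem block : ∀ r, r ≤ M.L → ∀ s, M.Start r s → M.Block r s (M.step^[M.events r] s) := by
  intro r
  induction r with
  | zero =>
    intro _ s hs
    exact ⟨hs.lev, rfl, rfl, fun _ _ _ _ => rfl, fun t _ h => by omega⟩
  | succ r ih =>
    intro hr s hs
    have ih' := ih (by omega)
    set F : Work R → Work R := M.step^[M.events r + 1] with hF
    have hFa : ∀ w, F w = M.step (M.step^[M.events r] w) := fun w =>
      Function.iterate_succ_apply' _ _ _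
    have hmid : ∀ j, j ≤ M.G → M.Mid r j s (F^[2 * j] s) := by
      intro j
      induction j with
      | zero =>
        intro _
        refine ⟨hs.lev, ?_, fun _ _ _ => rfl, fun c hc hrc _ h hh => ?_, fun _ _ _ _ => rfl⟩
        · funext i
          by_cases hi : i = r
          · subst hi
            simp [hs.dig]
          · simp [hi]
        · simpa using hs.ACC c h hc hh (by omega)
      | succ j ihj =>
        intro hj
        have := Mid.next M (by omega) (by omega) ih' hs (ihj (by omega))
        rw [show 2 * (j + 1) = 2 * j + 1 + 1 by ring, Function.iterate_succ_apply',
          Function.iterate_succ_apply', hFa, hFa]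
        exact this
    have hm := hmid M.G le_rfl
    have hall : M.step^[M.events (r + 1)] s = F (F^[2 * M.G] s) := by
      rw [events, mul_comm, Function.iterate_mul, ← hF, Function.iterate_succ_apply']
    rw [hall, hFa]
    set σ := F^[2 * M.G] s with hσ
    have hstart : M.Start r σ := by
      refine ⟨hm.lev, fun i hi => ?_, fun c h hc hh hrc => ?_⟩
      · rw [hm.dig, upd_apply, if_neg (by omega), hs.dig i (by omega)]
      · rw [hm.ACC_same c h (by omega), hs.ACC c h hc hh (by omega)]
    have hb := ih' σ hstart
    set τ := M.step^[M.events r] σ with hτ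
    have hτd : τ.dig r = 2 * M.G := by rw [hb.dig, hm.dig]; simp
    have hstep : M.step τ = { τ with
        MSG := fun t h => if t < M.N ∧ h < M.H then iterN M.N (τ.MSG t h) fun c a =>
          if M.rk c = r ∧ M.top c = t then τ.ACC c h else a else τ.MSG t h
        ACC := fun c h => if c < M.N ∧ h < M.H ∧ M.rk c = r then 0 else τ.ACC c h
        dig := upd τ.dig r 0
        lev := r + 1 } := by
      unfold step
      rw [hb.lev, if_pos (by omega), hτd, if_neg (by omega)]
    rw [hstep]
    refine ⟨rfl, ?_, ?_, fun c hc hrc h => ?_, fun t ht hrt hrp hvis h hh => ?_⟩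
    · funext i
      simp only [hb.dig, hm.dig, upd_apply]
      split
      · rename_i hi
        rw [hi, hs.dig r (by omega)]
      · rfl
    · funext c h
      simp only [hb.ACC]
      split
      · rename_i hch
        rw [hs.ACC c h hch.1 hch.2.1 (by omega)]
      · rename_i hch
        exact hm.ACC_same c h hch
    · show τ.U c h = s.U c h
      rw [hb.U c hc (by omega), hm.U c hc hrc]
    · simp only [ht, hh, true_and, if_true]
      -- Either a unique node of rank `r` has `t` as its top, and its accumulated sum is the message
      -- by `msg_succ_of_rank`, or the message left by the last inner run is already right.
      by_cases hex : ∃ c, c < M.N ∧ M.rk c = r ∧ M.top c = t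
      · obtain ⟨c, hc, hrc, htc⟩ := hex
        obtain ⟨-, -, k, hk, hp⟩ := M.top_spec hc
        rw [hrc] at hp
        rw [htc] at hk
        rw [iterN_ite_unique M.N _ (fun c => M.rk c = r ∧ M.top c = t) (fun c => τ.ACC c h) hc
          ⟨hrc, htc⟩]
        · rw [hb.ACC, hm.ACC c hc hrc (by rwa [htc]) h hh, htc]
          exact (M.msg_succ_of_rank ht hc hk hrc hp _).symm
        · rintro c' hc' ⟨hrc', htc'⟩
          obtain ⟨-, -, k', hk', hp'⟩ := M.top_spec hc'
          rw [hrc'] at hp'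
          rw [htc'] at hk'
          exact M.same_rank_unique k' k c' c t hc' hc ht hrc' hrc hk' hk
            (fun l h1 h2 => (hp' l h1 h2).le) (fun l h1 h2 => (hp l h1 h2).le)
      · rw [iterN_ite_none M.N _ (fun c => M.rk c = r ∧ M.top c = t) (fun c => τ.ACC c h)
          fun c hc hh => hex ⟨c, hc, hh⟩]
        have hno : ∀ d, d < M.N → M.Fixed r t d → M.rk d ≠ r := by
          rintro d hd ⟨-, k, hk, hp⟩ heq
          exact hex ⟨d, hd, heq, M.top_unique hd hk hp (by omega)⟩
        have hrt' : M.rk t ≠ r := fun heq => hno t ht (M.fixed_self heq.ge) heq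
        have hγ : ∀ i, r + 1 ≤ i → guess σ i = guess s i := by
          intro i hi
          simp only [guess, hm.dig, upd_apply]
          rw [if_neg (by omega)]
        rw [hb.MSG t ht (by omega) (by omega) _ h hh, hγ _ hrp,
          M.msg_succ_of_no_rank ht hγ hno]
        rintro b ⟨hbN, hrb, k, hk1, hk, hp⟩
        have hne : M.rk b ≠ r := hno b hbN ⟨hrb, k, hk, fun j h1 h2 => by
          have := hp j h1 h2; omega⟩
        refine GoodU.congr M hbN (hvis b ⟨hbN, by omega, k, hk1, hk, fun j h1 h2 => by
          have := hp j h1 h2; omega⟩) (hm.U b hbN (by omega)) fun i hi => hγ i (by omega)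

end Model
end SatTW

/-! ### The message from the root as a sum over the states of all nodes -/

namespace SatTW

namespace Model

variable {R : Type} [CommRing R] (M : Model R)

open Classical in
/-- The nodes of the subtree below `t`. -/
noncomputable def sub (t : ℕ) : Finset ℕ :=
  (Finset.range M.N).filter fun d => ∃ k, M.par^[k] d = t

theorem mem_sub {t d : ℕ} : d ∈ M.sub t ↔ d < M.N ∧ ∃ k, M.par^[k] d = t := by
  classical
  simp [sub]

theorem prod_sub (f : ℕ → R) {t : ℕ} (ht : t < M.N) :
    ∏ d ∈ M.sub t, f d = f t * ∏ y ∈ M.ch t, ∏ d ∈ M.sub y, f d := by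
  classical
  have h1 : M.sub t = insert t ((M.ch t).biUnion M.sub) := by
    ext d
    rw [Finset.mem_insert, Finset.mem_biUnion, M.mem_sub]
    constructor
    · rintro ⟨hd, k, hk⟩
      rcases Nat.eq_zero_or_pos k with rfl | hpos
      · exact Or.inl hk
      · obtain ⟨k, rfl⟩ : ∃ j, k = j + 1 := ⟨k - 1, by omega⟩
        have hlt := M.iterate_lt (j := k) hd.le (by rw [hk]; exact ht) (by omega)
        rw [Function.iterate_succ_apply'] at hk
        exact Or.inr ⟨_, M.mem_ch.2 ⟨hlt, hk⟩, M.mem_sub.2 ⟨hd, k, rfl⟩⟩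
    · rintro (rfl | ⟨y, hy, hd⟩)
      · exact ⟨ht, 0, rfl⟩
      · obtain ⟨hdN, k, hk⟩ := M.mem_sub.1 hd
        refine ⟨hdN, k + 1, ?_⟩
        rw [Function.iterate_succ_apply', hk, (M.mem_ch.1 hy).2]
  rw [h1, Finset.prod_insert, Finset.prod_biUnion]
  · intro y hy y' hy' hne
    rw [Function.onFun, Finset.disjoint_left]
    intro d hd hd'
    obtain ⟨hdN, k, hk⟩ := M.mem_sub.1 hd
    obtain ⟨-, k', hk'⟩ := M.mem_sub.1 hd'
    exact hne (M.ch_unique hdN.le hy hy' hk hk')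
  · rw [Finset.mem_biUnion]
    rintro ⟨y, hy, hd⟩
    obtain ⟨hdN, k, hk⟩ := M.mem_sub.1 hd
    have h1 := M.dep_iterate hdN.le (by rw [hk]; exact (M.mem_ch.1 hy).1)
    have h2 := M.dep_ch hy
    rw [hk] at h1
    omega

/-- Extension of an assignment of states by `0`. -/
def ext {m K : ℕ} (X : Fin m → Fin K) (t : ℕ) : ℕ := if h : t < m then X ⟨t, h⟩ else 0

theorem ext_lt {m K : ℕ} (X : Fin m → Fin K) {t : ℕ} (h : t < m) : ext X t < K := by
  simp [ext, h]

/-- The node weights with the states of the first `m` nodes prescribed. -/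
def pin (m : ℕ) (X : ℕ → ℕ) (d x : ℕ) : R := if d < m ∧ x ≠ X d then 0 else M.φ d x

/-- With all states prescribed, every sum has a single nonzero term. The weight of the edge to the
parent is included so that the induction from the leaves closes. -/
theorem dp_pin_all (X : ℕ → ℕ) (hX : ∀ t, t < M.N → X t < M.G * M.H) (t : ℕ) (ht : t < M.N) (x : ℕ) :
    M.ψ t x (X (M.par t)) * M.dp (M.pin M.N X) t x = if x = X t then
      ∏ d ∈ M.sub t, M.φ d (X d) * M.ψ d (X d) (X (M.par d)) else 0 := by
  revert ht x
  refine M.dp_induction (P := fun t => t < M.N → ∀ x,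
    M.ψ t x (X (M.par t)) * M.dp (M.pin M.N X) t x = if x = X t then
      ∏ d ∈ M.sub t, M.φ d (X d) * M.ψ d (X d) (X (M.par d)) else 0) (fun t ih ht x => ?_) t
  rw [M.dp_eq]
  split
  · rename_i hx
    subst hx
    rw [M.prod_sub _ ht, pin, if_neg (by simp)]
    have : ∀ y ∈ M.ch t, ∑ x' ∈ Finset.range (M.G * M.H), M.ψ y x' (X t) * M.dp (M.pin M.N X) y x' =
        ∏ d ∈ M.sub y, M.φ d (X d) * M.ψ d (X d) (X (M.par d)) := by
      intro y hy
      obtain ⟨hyN, hyt⟩ := M.mem_ch.1 hy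
      have h1 := ih y hy hyN
      rw [hyt] at h1
      rw [Finset.sum_congr rfl fun x' _ => h1 x', Finset.sum_ite_eq',
        if_pos (Finset.mem_range.2 (hX y hyN))]
    rw [Finset.prod_congr rfl this]
    ring
  · rename_i hx
    rw [pin, if_pos ⟨ht, hx⟩, zero_mul, mul_zero]

/-- The nodes are pinned one after the other: the weight of node `m` is the sum of its restrictions
to single states, and `dp_sum` moves this sum to the outside. -/
theorem dp_eq_sum_pin {ρ : ℕ} (hρ : ρ < M.N) (hreach : ∀ d, d < M.N → ∃ k, M.par^[k] d = ρ)
    {m : ℕ} (hm : m ≤ M.N) {x : ℕ} (hx : x < M.G * M.H) :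
    M.dp M.φ ρ x = ∑ X : Fin m → Fin (M.G * M.H), M.dp (M.pin m (ext X)) ρ x := by
  induction m with
  | zero =>
    rw [Fintype.sum_unique]
    congr 1
  | succ m ih =>
    obtain ⟨k, hk⟩ := hreach m hm
    rw [ih (by omega), ← (Fin.snocEquiv fun _ : Fin (m + 1) => Fin (M.G * M.H)).sum_comp,
      Fintype.sum_prod_type, Finset.sum_comm]
    refine Finset.sum_congr rfl fun X _ => ?_
    have h1 := M.dp_sum (Finset.univ : Finset (Fin (M.G * M.H)))
      (fun g z => if z ≠ g then 0 else M.φ m z) (M.pin m (ext X)) (c := m) hm k ρ hρ hk x hx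
    have h2 : M.dp (M.pin m (ext X)) ρ x = M.dp (fun d z => if d = m then
        ∑ g : Fin (M.G * M.H), (if z ≠ g then 0 else M.φ m z) else M.pin m (ext X) d z) ρ x := by
      refine M.dp_congr ρ hρ (fun d k' hdN hd z hz => ?_) x hx
      by_cases hdc : d = m
      · subst hdc
        rw [if_pos rfl, Finset.sum_eq_single (⟨z, hz⟩ : Fin (M.G * M.H))]
        · simp [pin]
        · intro b _ hb
          rw [if_pos]
          intro h
          exact hb (Fin.ext h.symm)
        · simp
      · simp [hdc]
    rw [h2, h1]
    refine Finset.sum_congr rfl fun g _ => ?_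
    congr 1
    funext d z
    by_cases hdc : d = m
    · subst hdc
      simp [pin, ext, Fin.snocEquiv, Fin.snoc]
    · rw [if_neg hdc]
      unfold pin
      by_cases hd : d < m
      · have : d < m + 1 := by omega
        simp [hd, this, ext, Fin.snocEquiv, Fin.snoc]
      · have : ¬ d < m + 1 := by omega
        simp [hd, this]

/-- Message passing computes the sum over all states of all nodes. -/
theorem total_eq_sum {ρ : ℕ} (hρ : ρ < M.N) (hpar : M.par ρ = M.N)
    (hreach : ∀ d, d < M.N → ∃ k, M.par^[k] d = ρ) :
    ∑ x ∈ Finset.range (M.G * M.H), M.ψ ρ x 0 * M.dp M.φ ρ x =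
      ∑ X : Fin M.N → Fin (M.G * M.H),
        ∏ d ∈ Finset.range M.N, M.φ d (ext X d) * M.ψ d (ext X d) (ext X (M.par d)) := by
  have h1 : ∀ x ∈ Finset.range (M.G * M.H), M.ψ ρ x 0 * M.dp M.φ ρ x =
      ∑ X : Fin M.N → Fin (M.G * M.H), if x = ext X ρ then
        ∏ d ∈ Finset.range M.N, M.φ d (ext X d) * M.ψ d (ext X d) (ext X (M.par d)) else 0 := by
    intro x hx
    rw [M.dp_eq_sum_pin hρ hreach le_rfl (Finset.mem_range.1 hx), Finset.mul_sum]
    refine Finset.sum_congr rfl fun X _ => ?_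
    have h2 := M.dp_pin_all (ext X) (fun t ht => ext_lt X ht) ρ hρ x
    have h3 : ext X (M.par ρ) = 0 := by rw [hpar]; simp [ext]
    rw [h3] at h2
    rw [h2]
    congr 2
    ext d
    rw [M.mem_sub, Finset.mem_range]
    exact ⟨fun h => h.1, fun h => ⟨h, hreach d h⟩⟩
  rw [Finset.sum_congr rfl h1, Finset.sum_comm]
  refine Finset.sum_congr rfl fun X _ => ?_
  rw [Finset.sum_ite_eq', if_pos (Finset.mem_range.2 (ext_lt X hρ))]

end Model

/-! ### Codes of partial assignments -/

section Codes

variable (b : ℕ → ℕ)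

/-- The place value of the element `v` of the set with indicator function `b`. -/
def place (v : ℕ) : ℕ := ∏ u ∈ Finset.range v, (1 + b u)

theorem place_pos (v : ℕ) : 0 < place b v := Finset.prod_pos fun _ _ => by omega

theorem place_succ (v : ℕ) : place b (v + 1) = place b v * (1 + b v) := Finset.prod_range_succ _ _

/-- The value that the code `x` gives to `v`. -/
def digit (v x : ℕ) : ℕ := x / place b v % 2

theorem digit_le (v x : ℕ) : digit b v x ≤ 1 := by
  unfold digit
  omega

/-- The code of the assignment `σ` on the elements below `S`. -/
def codeOf (σ : ℕ → ℕ) (S : ℕ) : ℕ := ∑ v ∈ Finset.range S, b v * σ v * place b v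

theorem codeOf_succ (σ : ℕ → ℕ) (S : ℕ) :
    codeOf b σ (S + 1) = codeOf b σ S + b S * σ S * place b S := Finset.sum_range_succ _ _

variable {b}

theorem codeOf_lt (hb : ∀ v, b v ≤ 1) {σ : ℕ → ℕ} (hσ : ∀ v, σ v ≤ 1) (S : ℕ) :
    codeOf b σ S < place b S := by
  induction S with
  | zero => simp [codeOf, place]
  | succ S ih =>
    rw [codeOf_succ, place_succ]
    have h1 := hb S
    have h2 := hσ S
    have h3 : b S * σ S ≤ b S := by nlinarith
    nlinarith

theorem place_dvd {v S : ℕ} (h : v ≤ S) : place b v ∣ place b S :=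
  Finset.prod_dvd_prod_of_subset _ _ _ (Finset.range_subset_range.2 h)

theorem codeOf_mod (hb : ∀ v, b v ≤ 1) {σ : ℕ → ℕ} (hσ : ∀ v, σ v ≤ 1) {v S : ℕ} (h : v ≤ S) :
    codeOf b σ S % place b v = codeOf b σ v := by
  induction S with
  | zero =>
    obtain rfl : v = 0 := by omega
    exact Nat.mod_eq_of_lt (codeOf_lt hb hσ 0)
  | succ S ih =>
    rcases Nat.eq_or_lt_of_le h with rfl | h
    · exact Nat.mod_eq_of_lt (codeOf_lt hb hσ _)
    · have hdvd : place b v ∣ b S * σ S * place b S :=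
        Dvd.dvd.mul_left (place_dvd (by omega)) _
      rw [codeOf_succ, Nat.add_mod, Nat.mod_eq_zero_of_dvd hdvd,
        add_zero, Nat.mod_mod, ih (by omega)]

theorem digit_codeOf (hb : ∀ v, b v ≤ 1) {σ : ℕ → ℕ} (hσ : ∀ v, σ v ≤ 1) {v S : ℕ} (h : v < S)
    (hv : b v = 1) : digit b v (codeOf b σ S) = σ v := by
  have h1 := codeOf_mod hb hσ (v := v + 1) (S := S) h
  have h2 := codeOf_mod hb hσ (v := v) (S := S) h.le
  rw [place_succ, hv, show 1 + 1 = 2 from rfl, Nat.mod_mul, h2, codeOf_succ, hv, one_mul] at h1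
  have h3 := place_pos b v
  unfold digit
  have h4 : place b v * (codeOf b σ S / place b v % 2) = place b v * σ v := by
    rw [mul_comm (σ v)] at h1
    exact Nat.add_left_cancel h1
  exact Nat.eq_of_mul_eq_mul_left h3 h4

/-- A mixed-radix expansion: elements of the bag have radix `2`, all others radix `1`. So the codes
are exactly the numbers below `2 ^ k` for a bag of `k` elements, and no list of the bag has to be
stored to decode them. -/
theorem codeOf_digit (hb : ∀ v, b v ≤ 1) (x S : ℕ) :
    codeOf b (fun v => digit b v x) S = x % place b S := by
  induction S with
  | zero => simp [codeOf, place, Nat.mod_one]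
  | succ S ih =>
    rw [codeOf_succ, ih, place_succ]
    have := hb S
    rcases (show b S = 0 ∨ b S = 1 by omega) with h | h
    · simp [h]
    · rw [h, show 1 + 1 = 2 from rfl, Nat.mod_mul, one_mul, digit, mul_comm (place b S)]

theorem codeOf_congr {σ σ' : ℕ → ℕ} {S : ℕ} (h : ∀ v, v < S → b v = 1 → σ v = σ' v)
    (hb : ∀ v, b v ≤ 1) : codeOf b σ S = codeOf b σ' S := by
  refine Finset.sum_congr rfl fun v hv => ?_
  have := hb v
  rcases (show b v = 0 ∨ b v = 1 by omega) with h' | h'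
  · simp [h']
  · rw [h v (Finset.mem_range.1 hv) h']

end Codes

end SatTW

namespace SatTW

/-! ### The number of satisfying assignments as a sum over the states of the nodes -/

/-- A formula (`pos c x`, `neg c x`: the literals of clause `c`) with the bags (`bag t v`, where the
variable `x` is the element `x` and the clause `c` is the element `n + c`) of a tree decomposition
with parent function `par`, as 0/1 tables. -/
structure Inst where
  n : ℕ
  m : ℕ
  N : ℕ
  pos : ℕ → ℕ → ℕ
  neg : ℕ → ℕ → ℕ
  bag : ℕ → ℕ → ℕ
  par : ℕ → ℕ

namespace Inst

variable (I : Inst)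

/-- `conn` expresses connectedness of the set of nodes whose bags contain `v` in the form in which
it is used: a function that agrees along all edges inside the set is constant on it. The additional
node `N` above the root has an empty bag, so its edge imposes no condition. -/
structure Valid : Prop where
  pos_le : ∀ c x, I.pos c x ≤ 1
  neg_le : ∀ c x, I.neg c x ≤ 1
  bag_le : ∀ t v, I.bag t v ≤ 1
  bag_N : ∀ v, I.bag I.N v = 0
  par_le : ∀ t, t < I.N → I.par t ≤ I.N
  cover : ∀ v, v < I.n + I.m → ∃ t, t < I.N ∧ I.bag t v = 1
  edge : ∀ c x, c < I.m → x < I.n → I.pos c x = 1 ∨ I.neg c x = 1 →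
    ∃ t, t < I.N ∧ I.bag t x = 1 ∧ I.bag t (I.n + c) = 1
  conn : ∀ v, v < I.n + I.m → ∀ g : ℕ → ℕ,
    (∀ t, t < I.N → I.par t < I.N → I.bag t v = 1 → I.bag (I.par t) v = 1 → g t = g (I.par t)) →
    ∀ t t', t < I.N → t' < I.N → I.bag t v = 1 → I.bag t' v = 1 → g t = g t'

/-- Whether the literal of `x` in clause `c` is true if `x` has the value `b`. -/
def lit (c x b : ℕ) : ℕ := b * I.pos c x + (1 - b) * I.neg c x

/-- Whether `t` is the first node whose bag contains `v`. -/
def first (t v : ℕ) : ℕ := ∏ u ∈ Finset.range t, (1 - I.bag u v)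

/-- The contribution of clause `c` to the weight of the state `x` of the node `t`. -/
def clauseW (t c x : ℕ) : ℕ :=
  if I.bag t (I.n + c) * digit (I.bag t) (I.n + c) x = 1 then
    -- The sign `-1` of a selected clause, as the residue `2 ^ n` modulo `2 ^ n + 1`. Only the first
    -- node that contains the clause carries it, so it occurs exactly once.
    (if I.first t (I.n + c) = 1 then 2 ^ I.n else 1) *
      ∏ v ∈ Finset.range I.n, (1 - I.bag t v * I.lit c v (digit (I.bag t) v x))
  else 1

/-- All nodes share one range of states; numbers too large to be codes for the bag of `t` are
excluded here, so each partial assignment counts once. -/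
def nodeW (t x : ℕ) : ℕ :=
  if x < place (I.bag t) (I.n + I.m) then ∏ c ∈ Finset.range I.m, I.clauseW t c x else 0

/-- Whether the states `x` and `x'` of `t` and its parent agree. -/
def edgeW (t x x' : ℕ) : ℕ :=
  ∏ v ∈ Finset.range (I.n + I.m), (1 - I.bag t v * I.bag (I.par t) v *
    (if digit (I.bag t) v x = digit (I.bag (I.par t)) v x' then 0 else 1))

/-- The values of the elements for an assignment `A` and a set `B` of clauses. -/
def val (A : Fin I.n → Bool) (B : Fin I.m → Bool) (v : ℕ) : ℕ :=
  if h : v < I.n then (A ⟨v, h⟩).toNat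
  else if h : v - I.n < I.m then (B ⟨v - I.n, h⟩).toNat else 0

theorem val_le (A : Fin I.n → Bool) (B : Fin I.m → Bool) (v : ℕ) : I.val A B v ≤ 1 := by
  unfold val
  split
  · exact Bool.toNat_le _
  · split
    · exact Bool.toNat_le _
    · omega

theorem val_var (A : Fin I.n → Bool) (B : Fin I.m → Bool) (x : Fin I.n) :
    I.val A B x = (A x).toNat := by simp [val]

theorem val_clause (A : Fin I.n → Bool) (B : Fin I.m → Bool) (c : Fin I.m) :
    I.val A B (I.n + c) = (B c).toNat := by simp [val]

theorem prod_zero_one (s : Finset ℕ) (f : ℕ → ℕ) (hf : ∀ v ∈ s, f v ≤ 1) :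
    ∏ v ∈ s, (1 - f v) = if ∀ v ∈ s, f v = 0 then 1 else 0 := by
  split
  · rename_i h
    exact Finset.prod_eq_one fun v hv => by rw [h v hv, Nat.sub_zero]
  · rename_i h
    push Not at h
    obtain ⟨v, hv, hv'⟩ := h
    have := hf v hv
    exact Finset.prod_eq_zero hv (by omega)

variable {I}

theorem Valid.edgeW_eq (hI : I.Valid) (t x x' : ℕ) : I.edgeW t x x' =
    if ∀ v < I.n + I.m, I.bag t v = 1 → I.bag (I.par t) v = 1 →
      digit (I.bag t) v x = digit (I.bag (I.par t)) v x' then 1 else 0 := by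
  unfold edgeW
  rw [prod_zero_one]
  · congr 1
    simp only [Finset.mem_range, eq_iff_iff]
    refine forall₂_congr fun v hv => ?_
    have h1 := hI.bag_le t v
    have h2 := hI.bag_le (I.par t) v
    rcases (show I.bag t v = 0 ∨ I.bag t v = 1 by omega) with h | h <;>
      rcases (show I.bag (I.par t) v = 0 ∨ I.bag (I.par t) v = 1 by omega) with h' | h' <;>
      simp [h, h']
  · intro v _
    have h1 := hI.bag_le t v
    have h2 := hI.bag_le (I.par t) v
    have h3 := Nat.mul_le_mul h1 h2
    split <;> omega

theorem Valid.lit_le (hI : I.Valid) (c x : ℕ) {b : ℕ} (hb : b ≤ 1) : I.lit c x b ≤ 1 := by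
  have h1 := hI.pos_le c x
  have h2 := hI.neg_le c x
  unfold lit
  rcases (show b = 0 ∨ b = 1 by omega) with rfl | rfl <;> simp <;> assumption

theorem Valid.place_le (hI : I.Valid) (t : ℕ) (v : ℕ) :
    place (I.bag t) v = 2 ^ ∑ u ∈ Finset.range v, I.bag t u := by
  unfold place
  rw [← Finset.prod_pow_eq_pow_sum]
  refine Finset.prod_congr rfl fun u _ => ?_
  have h1 := hI.bag_le t u
  rcases (show I.bag t u = 0 ∨ I.bag t u = 1 by omega) with h | h <;> simp [h]

variable {R : Type} [CommRing R]

/-- A clause contributes `-1` or `0`, according to whether no literal of it is true, if it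
is selected. -/
theorem Valid.prod_clauseW (hI : I.Valid) (hR : (2 ^ I.n : R) = -1) (A : Fin I.n → Bool)
    (B : Fin I.m → Bool) (c : Fin I.m) :
    ∏ t ∈ Finset.range I.N,
      (I.clauseW t c (codeOf (I.bag t) (I.val A B) (I.n + I.m)) : R) =
      if B c then (if ∀ x : Fin I.n, I.lit c x (A x).toNat = 0 then -1 else 0) else 1 := by
  have hdig : ∀ t v, v < I.n + I.m → I.bag t v = 1 →
      digit (I.bag t) v (codeOf (I.bag t) (I.val A B) (I.n + I.m)) = I.val A B v :=
    fun t v hv h => digit_codeOf (hI.bag_le t) (I.val_le A B) hv h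
  have hc : I.n + (c : ℕ) < I.n + I.m := by have := c.2; omega
  have hbag : ∀ t v, I.bag t v = 0 ∨ I.bag t v = 1 := fun t v => by
    have := hI.bag_le t v; omega
  by_cases hB : B c
  · rw [if_pos hB]
    have hval : I.val A B (I.n + c) = 1 := by rw [I.val_clause, hB]; rfl
    -- The contribution of a node is split into the sign and the indicator that no literal of `c`
    -- over a variable in this bag is true.
    have h1 : ∀ t, (I.clauseW t c (codeOf (I.bag t) (I.val A B) (I.n + I.m)) : R) =
        (if I.bag t (I.n + c) = 1 ∧ I.first t (I.n + c) = 1 then -1 else 1) *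
        (if I.bag t (I.n + c) = 1 → ∀ x : Fin I.n, I.bag t x = 1 → I.lit c x (A x).toNat = 0
          then 1 else 0) := by
      intro t
      unfold clauseW
      rcases hbag t (I.n + c) with h | h
      · simp [h]
      · rw [h, hdig t _ hc h, hval, if_pos (by norm_num)]
        have h2 : ∏ v ∈ Finset.range I.n, (1 - I.bag t v * I.lit c v (digit (I.bag t) v
            (codeOf (I.bag t) (I.val A B) (I.n + I.m)))) =
            if ∀ x : Fin I.n, I.bag t x = 1 → I.lit c x (A x).toNat = 0 then 1 else 0 := by
          rw [prod_zero_one]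
          · congr 1
            rw [eq_iff_iff]
            constructor
            · intro hh x hx
              have := hh x (Finset.mem_range.2 x.2)
              rwa [hx, one_mul, hdig t x (by omega) hx, I.val_var] at this
            · intro hh v hv
              rw [Finset.mem_range] at hv
              rcases hbag t v with h' | h'
              · rw [h', zero_mul]
              · have h3 := hh ⟨v, hv⟩ h'
                rw [← I.val_var A B] at h3
                rw [h', one_mul, hdig t v (by omega) h']
                exact h3
          · intro v _
            exact (Nat.mul_le_mul (hI.bag_le t v) (hI.lit_le c v (digit_le _ _ _)))
        rw [h2, Nat.cast_mul]
        congr 1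
        · simp only [true_and]
          split <;> simp [hR]
        · simp only [forall_const]
          split <;> simp
    rw [Finset.prod_congr rfl fun t _ => h1 t, Finset.prod_mul_distrib]
    have hsign : ∏ t ∈ Finset.range I.N,
        (if I.bag t (I.n + c) = 1 ∧ I.first t (I.n + c) = 1 then (-1 : R) else 1) = -1 := by
      have hfirst : ∀ t, I.first t (I.n + c) = 1 ↔ ∀ u < t, I.bag u (I.n + c) = 0 := by
        intro t
        unfold first
        rw [prod_zero_one _ _ fun u _ => hI.bag_le u _]
        simp
      have hex := hI.cover _ hc
      classical
      have hs := Nat.find_spec hex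
      rw [Finset.prod_eq_single (Nat.find hex)]
      · rw [if_pos]
        refine ⟨hs.2, (hfirst _).2 fun u hu => ?_⟩
        have := Nat.find_min hex hu
        rcases hbag u (I.n + c) with h | h
        · exact h
        · exact absurd ⟨by omega, h⟩ this
      · intro t ht hne
        rw [if_neg]
        rintro ⟨h2, h3⟩
        rw [Finset.mem_range] at ht
        rcases Nat.lt_or_gt_of_ne hne with h4 | h4
        · exact Nat.find_min hex h4 ⟨ht, h2⟩
        · have := (hfirst t).1 h3 _ h4
          omega
      · intro h
        exact absurd (Finset.mem_range.2 hs.1) h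
    rw [hsign]
    split
    · rename_i hall
      rw [Finset.prod_eq_one, mul_one]
      intro t _
      rw [if_pos fun _ x _ => hall x]
    · rename_i hall
      push Not at hall
      obtain ⟨x, hx⟩ := hall
      have hedge : I.pos c x = 1 ∨ I.neg c x = 1 := by
        have h1 := hI.pos_le c x
        have h2 := hI.neg_le c x
        by_contra hcon
        push Not at hcon
        have e1 : I.pos c x = 0 := by omega
        have e2 : I.neg c x = 0 := by omega
        exact hx (by simp [lit, e1, e2])
      -- The variable of a true literal shares some bag with the clause, and at this node the
      -- indicator vanishes.
      obtain ⟨t, ht, h1, h2⟩ := hI.edge c x c.2 x.2 hedge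
      rw [Finset.prod_eq_zero (Finset.mem_range.2 ht), mul_zero]
      rw [if_neg]
      intro h
      exact hx (h h2 x h1)
  · rw [if_neg hB]
    refine Finset.prod_eq_one fun t _ => ?_
    have hval : I.val A B (I.n + c) = 0 := by rw [I.val_clause]; simp [hB]
    unfold clauseW
    rw [if_neg, Nat.cast_one]
    rcases hbag t (I.n + c) with h | h
    · simp [h]
    · rw [h, hdig t _ hc h, hval]
      norm_num

/-- The sum over all states of all nodes is the number of satisfying assignments. -/
theorem Valid.sum_states (hI : I.Valid) (hR : (2 ^ I.n : R) = -1) {K : ℕ}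
    (hK : ∀ t, t < I.N → place (I.bag t) (I.n + I.m) ≤ K) :
    ∑ X : Fin I.N → Fin K, ∏ d ∈ Finset.range I.N,
        ((I.nodeW d (Model.ext X d) : R) *
          (I.edgeW d (Model.ext X d) (Model.ext X (I.par d)) : R)) =
      ((Finset.univ.filter fun A : Fin I.n → Bool =>
        ∀ c : Fin I.m, ∃ x : Fin I.n, I.lit c x (A x).toNat = 1).card : R) := by
  classical
  set S := I.n + I.m with hS
  -- A pair of an assignment and a set of clauses determines a state of every node. By `cover`
  -- different pairs give different states, and it is shown below that all other families of states
  -- have weight `0`.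
  let code : (Fin I.n → Bool) × (Fin I.m → Bool) → ℕ → ℕ := fun p t =>
    codeOf (I.bag t) (I.val p.1 p.2) S
  have hcode : ∀ p t, code p t < place (I.bag t) S := fun p t =>
    codeOf_lt (hI.bag_le t) (I.val_le _ _) S
  let e : (Fin I.n → Bool) × (Fin I.m → Bool) → Fin I.N → Fin K := fun p t =>
    ⟨code p t, (hcode p t).trans_le (hK t t.2)⟩
  have hext : ∀ p t, t < I.N → Model.ext (e p) t = code p t := fun p t ht => by
    simp [Model.ext, ht, e]
  have hdig : ∀ p t v, v < S → I.bag t v = 1 → digit (I.bag t) v (code p t) = I.val p.1 p.2 v :=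
    fun p t v hv h => digit_codeOf (hI.bag_le t) (I.val_le _ _) hv h
  set F : (Fin I.N → Fin K) → R := fun X => ∏ d ∈ Finset.range I.N,
        ((I.nodeW d (Model.ext X d) : R) *
          (I.edgeW d (Model.ext X d) (Model.ext X (I.par d)) : R)) with hF
  have hval : ∀ p, F (e p) = ∏ c : Fin I.m,
      (if p.2 c then (if ∀ x : Fin I.n, I.lit c x (p.1 x).toNat = 0 then (-1 : R) else 0) else 1) := by
    intro p
    have h1 : ∀ d ∈ Finset.range I.N, ((I.nodeW d (Model.ext (e p) d) : R) *
          (I.edgeW d (Model.ext (e p) d) (Model.ext (e p) (I.par d)) : R)) =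
        ∏ c ∈ Finset.range I.m, (I.clauseW d c (code p d) : R) := by
      intro d hd
      rw [Finset.mem_range] at hd
      rw [hext p d hd, nodeW, if_pos (hcode p d), hI.edgeW_eq, if_pos]
      · simp
      · intro v hv h1 h2
        have hlt : I.par d < I.N := by
          rcases (hI.par_le d hd).lt_or_eq with h | h
          · exact h
          · rw [h, hI.bag_N] at h2
            omega
        rw [hext p _ hlt, hdig p d v hv h1, hdig p _ v hv h2]
    rw [hF]
    dsimp only
    rw [Finset.prod_congr rfl h1, Finset.prod_comm, Finset.prod_range]
    exact Finset.prod_congr rfl fun c _ => hI.prod_clauseW hR p.1 p.2 c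
  have hsum : ∑ X : Fin I.N → Fin K, F X = ∑ p, F (e p) := by
    symm
    refine Finset.sum_of_injOn e ?_ (fun _ _ => Finset.mem_univ _) ?_ fun _ _ => rfl
    · rintro ⟨A, B⟩ - ⟨A', B'⟩ - heq
      have hinj : ∀ b b' : Bool, b.toNat = b'.toNat → b = b' := by decide
      have hv : ∀ v, v < S → I.val A B v = I.val A' B' v := by
        intro v hv
        obtain ⟨t, ht, htv⟩ := hI.cover v hv
        have h1 := congrArg Fin.val (congrFun heq ⟨t, ht⟩)
        rw [← hdig (A, B) t v hv htv, ← hdig (A', B') t v hv htv]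
        exact congrArg _ h1
      refine Prod.ext (funext fun x => ?_) (funext fun c => ?_)
      · have := hv x (by omega)
        rw [I.val_var, I.val_var] at this
        exact hinj _ _ this
      · have := hv (I.n + c) (by omega)
        rw [I.val_clause, I.val_clause] at this
        exact hinj _ _ this
    · intro X _ hX
      by_contra hne
      refine hX ?_
      have hfac : ∀ d, d < I.N → ((I.nodeW d (Model.ext X d) : R) *
          (I.edgeW d (Model.ext X d) (Model.ext X (I.par d)) : R)) ≠ 0 := fun d hd h =>
        hne (Finset.prod_eq_zero (Finset.mem_range.2 hd) h)
      have hlt : ∀ d, d < I.N → Model.ext X d < place (I.bag d) S := by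
        intro d hd
        by_contra hcon
        refine hfac d hd ?_
        rw [nodeW, if_neg hcon]
        simp
      have hag : ∀ d, d < I.N → ∀ v, v < S → I.bag d v = 1 → I.bag (I.par d) v = 1 →
          digit (I.bag d) v (Model.ext X d) = digit (I.bag (I.par d)) v (Model.ext X (I.par d)) := by
        intro d hd
        by_contra hcon
        refine hfac d hd ?_
        rw [hI.edgeW_eq, if_neg]
        · simp
        · intro h
          exact hcon fun v hv => h v hv
      have hcov : ∀ v, ∃ t, v < S → t < I.N ∧ I.bag t v = 1 := by
        intro v
        by_cases hv : v < S
        · obtain ⟨t, ht⟩ := hI.cover v hv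
          exact ⟨t, fun _ => ht⟩
        · exact ⟨0, fun h => absurd h hv⟩
      choose node hnode using hcov
      let w : ℕ → ℕ := fun v => digit (I.bag (node v)) v (Model.ext X (node v))
      -- A family of nonzero weight agrees along every tree edge; by `conn` each element has one
      -- value `w v` in all bags that contain it.
      have hw : ∀ t, t < I.N → ∀ v, v < S → I.bag t v = 1 →
          digit (I.bag t) v (Model.ext X t) = w v := fun t ht v hv htv =>
        hI.conn v hv (fun t => digit (I.bag t) v (Model.ext X t))
          (fun t ht _ h1 h2 => hag t ht v hv h1 h2) t (node v) ht (hnode v hv).1 htv (hnode v hv).2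
      refine ⟨(fun x => decide (w x = 1), fun c => decide (w (I.n + c) = 1)), Finset.mem_coe.2
        (Finset.mem_univ _), funext fun t => Fin.ext ?_⟩
      have hXt : (X t : ℕ) = Model.ext X t := by simp [Model.ext]
      show codeOf _ _ S = (X t : ℕ)
      rw [hXt, ← Nat.mod_eq_of_lt (hlt t t.2), ← codeOf_digit (hI.bag_le t)]
      refine codeOf_congr (fun v hv htv => ?_) (hI.bag_le t)
      rw [hw t t.2 v hv htv]
      have hw1 : w v = 0 ∨ w v = 1 := by
        have := digit_le (I.bag (node v)) v (Model.ext X (node v))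
        change digit _ _ _ = 0 ∨ digit _ _ _ = 1
        omega
      have key : ∀ z : ℕ, z = 0 ∨ z = 1 → (decide (z = 1)).toNat = z := by
        rintro z (rfl | rfl) <;> rfl
      unfold val
      by_cases h1 : v < I.n
      · rw [dif_pos h1]
        exact key _ hw1
      · rw [dif_neg h1, dif_pos (show v - I.n < I.m by omega)]
        have : I.n + (v - I.n) = v := by omega
        simp only [this]
        exact key _ hw1
  rw [hsum, Fintype.sum_prod_type, Finset.card_filter, Nat.cast_sum]
  refine Finset.sum_congr rfl fun A _ => ?_
  rw [Finset.sum_congr rfl fun B _ => hval (A, B)]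
  -- Distributivity: the sum over all sets of clauses of a product over clauses is the product over
  -- clauses of the sum over both choices.
  have hprod := (Finset.prod_univ_sum (fun _ : Fin I.m => (Finset.univ : Finset Bool))
    fun c b => if b then (if ∀ x : Fin I.n, I.lit c x (A x).toNat = 0 then (-1 : R) else 0) else 1)
  rw [Fintype.piFinset_univ] at hprod
  rw [← hprod]
  have hclause : ∀ c : Fin I.m, (∑ b : Bool, if b = true then
      (if ∀ x : Fin I.n, I.lit c x (A x).toNat = 0 then (-1 : R) else 0) else 1) =
      if ∃ x : Fin I.n, I.lit c x (A x).toNat = 1 then 1 else 0 := by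
    intro c
    rw [Fintype.sum_bool]
    have hiff : (∃ x : Fin I.n, I.lit c x (A x).toNat = 1) ↔
        ¬ ∀ x : Fin I.n, I.lit c x (A x).toNat = 0 := by
      push Not
      refine exists_congr fun x => ?_
      have := hI.lit_le c x (Bool.toNat_le (A x))
      omega
    simp only [hiff]
    by_cases h : ∀ x : Fin I.n, I.lit c x (A x).toNat = 0 <;> simp [h]
  rw [Finset.prod_congr rfl fun c _ => hclause c]
  by_cases hall : ∀ c : Fin I.m, ∃ x : Fin I.n, I.lit c x (A x).toNat = 1
  · rw [if_pos hall, Finset.prod_eq_one fun c _ => if_pos (hall c), Nat.cast_one]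
  · rw [if_neg hall, Nat.cast_zero]
    push Not at hall
    obtain ⟨c, hc⟩ := hall
    refine Finset.prod_eq_zero (Finset.mem_univ c) (if_neg ?_)
    rintro ⟨x, hx⟩
    exact hc x hx

end Inst

end SatTW

namespace SatTW

/-! ### A program logic for expressions and commands -/

/-- Expressions with binders, as functions of the first unused variable. -/
abbrev Tm := ℕ → Ex

abbrev CTm := ℕ → Cm

namespace Tm

def c (k : ℕ) : Tm := fun _ => .const k
def op (o : Op) (a b : Tm) : Tm := fun x => .op o (a x) (b x)
def add (a b : Tm) : Tm := op .add a b
def sub (a b : Tm) : Tm := op .sub a b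
def mul (a b : Tm) : Tm := op .mul a b
def div (a b : Tm) : Tm := op .div a b
def arr (j : ℕ) (a : Tm) : Tm := fun x => .arr j (a x)
def inp (a : Tm) : Tm := fun x => .inp (a x)
def iter (n a : Tm) (b : Tm → Tm → Tm) : Tm := fun x =>
  .iter x (n x) (a x) (b (fun _ => .var x) (fun _ => .var (x + 1)) (x + 2))
def sum (n : Tm) (b : Tm → Tm) : Tm := iter n (c 0) fun i z => add z (b i)
def prod (n : Tm) (b : Tm → Tm) : Tm := iter n (c 1) fun i z => mul z (b i)
/-- Definition by cases, without evaluation of the other case. -/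
def cond (e a b : Tm) : Tm := iter (sub (c 1) e) (iter e (c 0) fun _ _ => a) fun _ _ => b
def le (a b : Tm) : Tm := sub (c 1) (sub a b)
def lt (a b : Tm) : Tm := le (add a (c 1)) b
def eq (a b : Tm) : Tm := mul (le a b) (le b a)
def mod (a b : Tm) : Tm := sub a (mul (div a b) b)
def pow2 (a : Tm) : Tm := prod a fun _ => c 2
def max (a b : Tm) : Tm := add a (sub b a)

end Tm

namespace CTm

def store (j : ℕ) (a b : Tm) : CTm := fun x => .store j (a x) (b x)
def seq (c₁ c₂ : CTm) : CTm := fun x => .seq (c₁ x) (c₂ x)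
def ite (e : Tm) (c₁ c₂ : CTm) : CTm := fun x => .ite (e x) (c₁ x) (c₂ x)
def loop (n : Tm) (b : Tm → CTm) : CTm := fun x => .loop x (n x) (b (fun _ => .var x) (x + 1))

end CTm

/-- The values of the variables below a scope. -/
structure World where
  lvl : ℕ
  env : ℕ → ℕ

instance : Preorder World where
  le w w' := w.lvl ≤ w'.lvl ∧ ∀ y, y < w.lvl → w'.env y = w.env y
  le_refl w := ⟨le_rfl, fun _ _ => rfl⟩
  le_trans w w' w'' h h' := ⟨h.1.trans h'.1, fun y hy => by
    rw [h'.2 y (hy.trans_le h.1), h.2 y hy]⟩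

/-- In all extensions of `w` the expression `e` has the value `v` and can be evaluated safely. -/
def Has (cx : Ctx) (A : ℕ → ℕ → ℕ) (w : World) (e : Tm) (v : ℕ) : Prop :=
  ∀ w', w ≤ w' → (e w'.lvl).Safe cx.I cx.len cx.β cx.T A w'.env ∧ (e w'.lvl).ev cx.I A w'.env = v

/-- Values that do not depend on the arrays. -/
abbrev Cst (cx : Ctx) (w : World) (e : Tm) (v : ℕ) : Prop := ∀ A, Has cx A w e v

/-- A Hoare triple whose precondition is a concrete content of the arrays. Safety is part of it,
since safety is what the compilation needs. -/
def Tri (cx : Ctx) (w : World) (p : CTm) (A : ℕ → ℕ → ℕ) (Q : (ℕ → ℕ → ℕ) → Prop) : Prop :=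
  ∀ w', w ≤ w' → (p w'.lvl).Safe cx.I cx.len cx.β cx.T cx.X w'.env A ∧
    Q ((p w'.lvl).run cx.I w'.env A)

namespace Has

variable {cx : Ctx} {A : ℕ → ℕ → ℕ} {w w' : World} {a b e n : Tm} {u v : ℕ}

theorem mono (h : Has cx A w e v) (hw : w ≤ w') : Has cx A w' e v :=
  fun w'' hw' => h w'' (hw.trans hw')

theorem c (k : ℕ) : Has cx A w (Tm.c k) k := fun _ _ => ⟨trivial, rfl⟩

theorem op (o : Op) (ha : Has cx A w a u) (hb : Has cx A w b v) :
    Has cx A w (Tm.op o a b) (o.eval u v) := fun w' hw => by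
  obtain ⟨h1, h2⟩ := ha w' hw
  obtain ⟨h3, h4⟩ := hb w' hw
  exact ⟨⟨h1, h3⟩, by simp [Tm.op, Ex.ev, h2, h4]⟩

theorem add (ha : Has cx A w a u) (hb : Has cx A w b v) : Has cx A w (Tm.add a b) (u + v) :=
  op .add ha hb
theorem sub (ha : Has cx A w a u) (hb : Has cx A w b v) : Has cx A w (Tm.sub a b) (u - v) :=
  op .sub ha hb
theorem mul (ha : Has cx A w a u) (hb : Has cx A w b v) : Has cx A w (Tm.mul a b) (u * v) :=
  op .mul ha hb
theorem div (ha : Has cx A w a u) (hb : Has cx A w b v) : Has cx A w (Tm.div a b) (u / v) :=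
  op .div ha hb

theorem congr (h : Has cx A w e u) (huv : u = v) : Has cx A w e v := huv ▸ h

theorem arr (j : ℕ) (ha : Has cx A w a u) : Has cx A w (Tm.arr j a) (A j u) := fun w' hw => by
  obtain ⟨h1, h2⟩ := ha w' hw
  exact ⟨h1, by simp [Tm.arr, Ex.ev, h2]⟩

theorem inp (ha : Has cx A w a u) (hu : u < cx.len) : Has cx A w (Tm.inp a) (cx.I u) :=
  fun w' hw => by
  obtain ⟨h1, h2⟩ := ha w' hw
  exact ⟨⟨h1, by rwa [h2]⟩, by simp [Tm.inp, Ex.ev, h2]⟩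

theorem iterN_congr {α : Type} {n : ℕ} {a : α} {f g : ℕ → α → α}
    (h : ∀ k, k < n → f k (iterN k a g) = g k (iterN k a g)) : ∀ k, k ≤ n →
    iterN k a f = iterN k a g := by
  intro k
  induction k with
  | zero => intro _; rfl
  | succ k ih =>
    intro hk
    rw [iterN_succ, iterN_succ, ih (by omega), h k (by omega)]

/-- The two bound variables are the first names above the current world. The body is verified in the
extended world, to which `Has.mono` transports facts about outer terms. The arguments of `b` are
known only through their values, so variable names never appear in specifications. -/
theorem iter {b : Tm → Tm → Tm} {N a₀ : ℕ} {f : ℕ → ℕ → ℕ} (hn : Has cx A w n N)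
    (ha : Has cx A w a a₀) (hT : N ≤ cx.T) (hacc : ∀ k, k ≤ N → iterN k a₀ f < 2 ^ cx.β)
    (hb : ∀ w', w ≤ w' → ∀ i z k, k < N → Cst cx w' i k → Cst cx w' z (iterN k a₀ f) →
      Has cx A w' (b i z) (f k (iterN k a₀ f))) :
    Has cx A w (Tm.iter n a b) (iterN N a₀ f) := fun w' hw => by
  obtain ⟨h1, h2⟩ := hn w' hw
  obtain ⟨h3, h4⟩ := ha w' hw
  set x := w'.lvl with hx
  have hbody : ∀ k, k < N →
      (b (fun _ => .var x) (fun _ => .var (x + 1)) (x + 2)).Safe cx.I cx.len cx.β cx.T A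
        (upd (upd w'.env x k) (x + 1) (iterN k a₀ f)) ∧
      (b (fun _ => .var x) (fun _ => .var (x + 1)) (x + 2)).ev cx.I A
        (upd (upd w'.env x k) (x + 1) (iterN k a₀ f)) = f k (iterN k a₀ f) := by
    intro k hk
    let w₂ : World := ⟨x + 2, upd (upd w'.env x k) (x + 1) (iterN k a₀ f)⟩
    have hw₂ : w' ≤ w₂ := ⟨by show x ≤ x + 2; omega, fun y hy => by
      show upd _ _ _ y = _
      rw [upd_apply, upd_apply, if_neg (by omega), if_neg (by omega)]⟩
    refine hb w₂ (hw.trans hw₂) (fun _ => .var x) (fun _ => .var (x + 1)) k hk (fun B w₃ h => ⟨trivial, ?_⟩)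
      (fun B w₃ h => ⟨trivial, ?_⟩) w₂ le_rfl
    · show w₃.env x = k
      rw [h.2 x (by show x < x + 2; omega)]
      simp [w₂]
    · show w₃.env (x + 1) = _
      rw [h.2 (x + 1) (by show x + 1 < x + 2; omega)]
      simp [w₂]
  have hit : ∀ k, k ≤ N → iterN k a₀ (fun i acc =>
      (b (fun _ => .var x) (fun _ => .var (x + 1)) (x + 2)).ev cx.I A
        (upd (upd w'.env x i) (x + 1) acc)) = iterN k a₀ f :=
    iterN_congr fun k hk => (hbody k hk).2
  simp only [Tm.iter, Ex.Safe, Ex.ev, h2, h4]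
  refine ⟨⟨h1, h3, hT, fun k hk => ?_, fun k hk => ?_⟩, hit N le_rfl⟩
  · rw [hit k hk]
    exact hacc k hk
  · rw [hit k hk.le]
    exact (hbody k hk).1

theorem iterN_add_eq (f : ℕ → ℕ) (N : ℕ) :
    iterN N 0 (fun k z => z + f k) = ∑ k ∈ Finset.range N, f k := by
  induction N with
  | zero => rfl
  | succ N ih => rw [iterN_succ, ih, Finset.sum_range_succ]

theorem iterN_mul_eq (f : ℕ → ℕ) (N : ℕ) :
    iterN N 1 (fun k z => z * f k) = ∏ k ∈ Finset.range N, f k := by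
  induction N with
  | zero => rfl
  | succ N ih => rw [iterN_succ, ih, Finset.prod_range_succ]

theorem sum {b : Tm → Tm} {N : ℕ} {f : ℕ → ℕ} (hn : Has cx A w n N) (hT : N ≤ cx.T)
    (hlt : ∑ k ∈ Finset.range N, f k < 2 ^ cx.β)
    (hb : ∀ w', w ≤ w' → ∀ i k, k < N → Cst cx w' i k → Has cx A w' (b i) (f k)) :
    Has cx A w (Tm.sum n b) (∑ k ∈ Finset.range N, f k) := by
  rw [← iterN_add_eq]
  refine iter hn (c 0) hT (fun k hk => ?_) fun w' hw i z k hk hi hz => (hz A).add (hb w' hw i k hk hi)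
  rw [iterN_add_eq]
  exact (Finset.sum_le_sum_of_subset (Finset.range_subset_range.2 hk)).trans_lt hlt

theorem prod {b : Tm → Tm} {N : ℕ} {f : ℕ → ℕ} (hn : Has cx A w n N) (hT : N ≤ cx.T)
    (hlt : ∀ k, k ≤ N → ∏ j ∈ Finset.range k, f j < 2 ^ cx.β)
    (hb : ∀ w', w ≤ w' → ∀ i k, k < N → Cst cx w' i k → Has cx A w' (b i) (f k)) :
    Has cx A w (Tm.prod n b) (∏ k ∈ Finset.range N, f k) := by
  rw [← iterN_mul_eq]
  refine iter hn (c 1) hT (fun k hk => ?_) fun w' hw i z k hk hi hz => (hz A).mul (hb w' hw i k hk hi)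
  rw [iterN_mul_eq]
  exact hlt k hk

theorem pow2 (ha : Has cx A w a u) (hT : u ≤ cx.T) (hβ : u < cx.β) :
    Has cx A w (Tm.pow2 a) (2 ^ u) := by
  have := prod (b := fun _ => Tm.c 2) (f := fun _ => 2) ha hT
    (fun k hk => by
      rw [Finset.prod_const, Finset.card_range]
      exact Nat.pow_lt_pow_right (by norm_num) (by omega)) fun _ _ _ _ _ _ => c 2
  exact this.congr (by simp)

theorem le (ha : Has cx A w a u) (hb : Has cx A w b v) :
    Has cx A w (Tm.le a b) (if u ≤ v then 1 else 0) :=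
  ((c 1).sub (ha.sub hb)).congr (by split <;> omega)

theorem lt (ha : Has cx A w a u) (hb : Has cx A w b v) :
    Has cx A w (Tm.lt a b) (if u < v then 1 else 0) := (ha.add (c 1)).le hb

theorem eq (ha : Has cx A w a u) (hb : Has cx A w b v) :
    Has cx A w (Tm.eq a b) (if u = v then 1 else 0) :=
  ((ha.le hb).mul (hb.le ha)).congr (by split <;> split <;> split <;> omega)

theorem mod (ha : Has cx A w a u) (hb : Has cx A w b v) : Has cx A w (Tm.mod a b) (u % v) :=
  (ha.sub ((ha.div hb).mul hb)).congr (by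
    have := Nat.div_add_mod' u v
    omega)

theorem max (ha : Has cx A w a u) (hb : Has cx A w b v) : Has cx A w (Tm.max a b) (Max.max u v) :=
  (ha.add (hb.sub ha)).congr (by omega)

theorem and {p q : Prop} [Decidable p] [Decidable q] (ha : Has cx A w a (if p then 1 else 0))
    (hb : Has cx A w b (if q then 1 else 0)) :
    Has cx A w (Tm.mul a b) (if p ∧ q then 1 else 0) :=
  (ha.mul hb).congr (by by_cases p <;> by_cases q <;> simp [*])

theorem cond {p : Prop} [Decidable p] (he : Has cx A w e (if p then 1 else 0)) (hT : 1 ≤ cx.T)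
    (ha : p → Has cx A w a u) (hb : ¬ p → Has cx A w b v) (hu : p → u < 2 ^ cx.β)
    (hv : ¬ p → v < 2 ^ cx.β) : Has cx A w (Tm.cond e a b) (if p then u else v) := by
  have h1 : Has cx A w (Tm.iter e (Tm.c 0) fun _ _ => a) (if p then u else 0) := by
    refine (iter (f := fun _ _ => u) he (c 0) (by split <;> omega) (fun k hk => ?_)
      fun w' hw i z k hk _ _ => ?_).congr (by split <;> rfl)
    · cases k with
      | zero => exact Nat.two_pow_pos _
      | succ k => exact hu (by by_contra h; simp [h] at hk)
    · exact (ha (by by_contra h; simp [h] at hk)).mono hw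
  refine (iter (f := fun _ _ => v) ((c 1).sub he) h1 (by omega) (fun k hk => ?_)
      fun w' hw i z k hk _ _ => ?_).congr (by split <;> rfl)
  · cases k with
    | zero =>
      show (if p then u else 0) < _
      split
      · exact hu ‹_›
      · exact Nat.two_pow_pos _
    | succ k => exact hv (by intro h; simp [h] at hk)
  · exact (hb (by intro h; simp [h] at hk)).mono hw

end Has

namespace Tri

variable {cx : Ctx} {A : ℕ → ℕ → ℕ} {w : World} {Q : (ℕ → ℕ → ℕ) → Prop}

theorem store {j u v : ℕ} {a b : Tm} (ha : Has cx A w a u) (hb : Has cx A w b v) (hu : u < cx.X)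
    (hv : v < 2 ^ cx.β) (hQ : Q (updArr A j u v)) : Tri cx w (CTm.store j a b) A Q := fun w' hw => by
  obtain ⟨h1, h2⟩ := ha w' hw
  obtain ⟨h3, h4⟩ := hb w' hw
  exact ⟨⟨h1, h3, by rwa [h2], by rwa [h4]⟩, by simpa [CTm.store, Cm.run, h2, h4] using hQ⟩

theorem seq {p q : CTm} {R : (ℕ → ℕ → ℕ) → Prop} (hp : Tri cx w p A R)
    (hq : ∀ B, R B → Tri cx w q B Q) : Tri cx w (CTm.seq p q) A Q := fun w' hw => by
  obtain ⟨h1, h2⟩ := hp w' hw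
  obtain ⟨h3, h4⟩ := hq _ h2 w' hw
  exact ⟨⟨h1, h3⟩, h4⟩

theorem ite {p q : CTm} {e : Tm} {P : Prop} [Decidable P]
    (he : Has cx A w e (if P then 1 else 0)) (hp : P → Tri cx w p A Q)
    (hq : ¬ P → Tri cx w q A Q) : Tri cx w (CTm.ite e p q) A Q := fun w' hw => by
  obtain ⟨h1, h2⟩ := he w' hw
  by_cases h : P
  · rw [if_pos h] at h2
    have := hp h w' hw
    exact ⟨⟨h1, fun _ => this.1, fun h0 => by omega⟩, by
      simpa [CTm.ite, Cm.run, h2] using this.2⟩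
  · rw [if_neg h] at h2
    have := hq h w' hw
    exact ⟨⟨h1, fun h0 => absurd h2 h0, fun _ => this.1⟩, by
      simpa [CTm.ite, Cm.run, h2] using this.2⟩

theorem loop {n : Tm} {b : Tm → CTm} {N : ℕ} (J : ℕ → (ℕ → ℕ → ℕ) → Prop)
    (hn : Has cx A w n N) (hT : N ≤ cx.T) (h0 : J 0 A)
    (hb : ∀ w', w ≤ w' → ∀ i k B, k < N → Cst cx w' i k → J k B → Tri cx w' (b i) B (J (k + 1)))
    (hQ : ∀ B, J N B → Q B) : Tri cx w (CTm.loop n b) A Q := fun w' hw => by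
  obtain ⟨h1, h2⟩ := hn w' hw
  set x := w'.lvl with hx
  set F : ℕ → (ℕ → ℕ → ℕ) → ℕ → ℕ → ℕ :=
    fun i B => (b (fun _ => .var x) (x + 1)).run cx.I (upd w'.env x i) B with hF
  have hbody : ∀ k B, k < N → J k B →
      (b (fun _ => .var x) (x + 1)).Safe cx.I cx.len cx.β cx.T cx.X (upd w'.env x k) B ∧
      J (k + 1) (F k B) := by
    intro k B hk hJ
    let w₂ : World := ⟨x + 1, upd w'.env x k⟩
    have hw₂ : w' ≤ w₂ := ⟨by show x ≤ x + 1; omega, fun y hy => by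
      show upd _ _ _ y = _
      rw [upd_apply, if_neg (by omega)]⟩
    refine hb w₂ (hw.trans hw₂) (fun _ => .var x) k B hk (fun B w₃ h => ⟨trivial, ?_⟩) hJ w₂ le_rfl
    show w₃.env x = k
    rw [h.2 x (by show x < x + 1; omega)]
    simp [w₂]
  have hinv : ∀ k, k ≤ N → J k (iterN k A F) := by
    intro k
    induction k with
    | zero => exact fun _ => h0
    | succ k ih => exact fun hk => (hbody k _ (by omega) (ih (by omega))).2
  simp only [CTm.loop, Cm.Safe, Cm.run, h2]
  exact ⟨⟨h1, hT, fun k hk => (hbody k _ hk (hinv k hk.le)).1⟩, hQ _ (hinv N le_rfl)⟩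

/-- Filling the array `j` from values that depend only on the arrays before and on the later
elements of the array `j`. -/
theorem fill {n : Tm} {e : Tm → Tm} {N j : ℕ} {f : ℕ → ℕ} (hn : Has cx A w n N) (hT : N ≤ cx.T)
    (hX : N ≤ cx.X) (hlt : ∀ k, k < N → f k < 2 ^ cx.β)
    (he : ∀ w', w ≤ w' → ∀ i k, k < N → Cst cx w' i k →
      Has cx (fun j' i' => if j' = j ∧ i' < k then f i' else A j' i') w' (e i) (f k))
    (hQ : Q fun j' i' => if j' = j ∧ i' < N then f i' else A j' i') :
    Tri cx w (CTm.loop n fun i => CTm.store j i (e i)) A Q := by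
  refine loop (fun k B => B = fun j' i' => if j' = j ∧ i' < k then f i' else A j' i') hn hT
    (by simp) (fun w' hw i k B hk hi hB => ?_) (fun B hB => hB ▸ hQ)
  subst hB
  refine store (hi _) (he w' hw i k hk hi) (by omega) (hlt k hk) ?_
  funext j' i'
  rw [updArr_apply]
  by_cases h1 : j' = j <;> by_cases h2 : i' = k <;> simp [h1, h2]
  · by_cases h3 : i' < k
    · rw [if_pos h3, if_pos (by omega)]
    · rw [if_neg h3, if_neg (by omega)]

end Tri

end SatTW

namespace SatTW

/-! ### Rooted trees and heavy-path ranks -/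

/-- `par` is the parent function of a tree with nodes `0, …, N - 1` and a node `N` above the root,
and `dep` counts the steps to `N`. -/
structure Rooted (N : ℕ) (par dep : ℕ → ℕ) : Prop where
  par_N : par N = N
  par_le : ∀ t, t < N → par t ≤ N
  dep_par : ∀ t, t < N → dep t = dep (par t) + 1
  dep_le : ∀ t, t < N → dep t ≤ N

section Ranks

/-- The number of nodes below `t`. -/
def sizeOfSub (par : ℕ → ℕ) (N t : ℕ) : ℕ :=
  ∑ u ∈ Finset.range N, ∑ j ∈ Finset.range N, if par^[j] u = t then 1 else 0

/-- The number of ranks. -/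
def levels (N : ℕ) : ℕ := ∑ i ∈ Finset.range N, if 2 ^ i ≤ N then 1 else 0

/-- The sizes of the subtrees of the children of `t`, rounded down to multiples of `2 ^ k`. -/
def childSizes (par : ℕ → ℕ) (N k t : ℕ) : ℕ :=
  ∑ y ∈ Finset.range N, if par y = t then sizeOfSub par N y / 2 ^ k else 0

/-- The rank of a node `t < N` is the largest `k` such that a multiple of `2 ^ k` is reached
only at `t`. -/
def rankOf (par : ℕ → ℕ) (N t : ℕ) : ℕ :=
  if t < N then
    iterN N 0 fun k a => if childSizes par N k t < sizeOfSub par N t / 2 ^ k then k else a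
  else levels N

theorem iterN_last (p : ℕ → Prop) [DecidablePred p] (n : ℕ) :
    (∀ k, k < n → p k → k ≤ iterN n 0 fun k a => if p k then k else a) ∧
    (p 0 → p (iterN n 0 fun k a => if p k then k else a)) := by
  induction n with
  | zero => exact ⟨fun k hk => by omega, id⟩
  | succ n ih =>
    rw [iterN_succ]
    by_cases h : p n
    · rw [if_pos h]
      exact ⟨fun k hk _ => by omega, fun _ => h⟩
    · rw [if_neg h]
      refine ⟨fun k hk hp => ?_, ih.2⟩
      rcases Nat.lt_succ_iff_lt_or_eq.1 hk with h' | rfl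
      · exact ih.1 k h' hp
      · exact absurd hp h

namespace Rooted

variable {N : ℕ} {par dep : ℕ → ℕ} (hT : Rooted N par dep)
include hT

theorem iterate_le {k d : ℕ} (hd : d ≤ N) : par^[k] d ≤ N := by
  induction k with
  | zero => exact hd
  | succ k ih =>
    rw [Function.iterate_succ_apply']
    rcases Nat.lt_or_ge (par^[k] d) N with h | h
    · exact hT.par_le _ h
    · rw [le_antisymm ih h, hT.par_N]

theorem dep_iterate {k d : ℕ} (hd : d ≤ N) (h : par^[k] d < N) : dep d = dep (par^[k] d) + k := by
  induction k with
  | zero => rfl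
  | succ k ih =>
    rw [Function.iterate_succ_apply'] at h ⊢
    have hlt : par^[k] d < N := by
      rcases Nat.lt_or_ge (par^[k] d) N with h' | h'
      · exact h'
      · rw [le_antisymm (hT.iterate_le hd) h', hT.par_N] at h
        omega
    rw [ih hlt, hT.dep_par _ hlt]
    omega

theorem iterate_N {u : ℕ} (hu : u < N) : par^[N] u = N := by
  rcases Nat.lt_or_ge (par^[N] u) N with h | h
  · have h1 := hT.dep_iterate hu.le h
    have h2 := hT.dep_le u hu
    have h3 := hT.dep_par _ h
    omega
  · exact le_antisymm (hT.iterate_le hu.le) h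

theorem sum_ancestors_le {u t n : ℕ} (hu : u < N) (ht : t < N) :
    (∑ j ∈ Finset.range n, if par^[j] u = t then 1 else 0) ≤ 1 := by
  rw [Finset.sum_boole, Nat.cast_id, Finset.card_le_one]
  intro i hi j hj
  rw [Finset.mem_filter] at hi hj
  have h1 := hT.dep_iterate hu.le (by rw [hi.2]; exact ht)
  have h2 := hT.dep_iterate hu.le (by rw [hj.2]; exact ht)
  rw [hi.2] at h1
  rw [hj.2] at h2
  omega

theorem sizeOfSub_le {t : ℕ} (ht : t < N) : sizeOfSub par N t ≤ N :=
  (Finset.sum_le_sum fun u hu =>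
    hT.sum_ancestors_le (n := N) (Finset.mem_range.1 hu) ht).trans (by simp)

theorem sizeOfSub_eq {t : ℕ} (ht : t < N) : sizeOfSub par N t =
    1 + ∑ y ∈ Finset.range N, if par y = t then sizeOfSub par N y else 0 := by
  have h1 : sizeOfSub par N t =
      ∑ u ∈ Finset.range N, ∑ j ∈ Finset.range (N + 1), if par^[j] u = t then 1 else 0 := by
    refine Finset.sum_congr rfl fun u hu => ?_
    rw [Finset.sum_range_succ, hT.iterate_N (Finset.mem_range.1 hu), if_neg (by omega), add_zero]
  have h2 : ∀ u ∈ Finset.range N, (∑ j ∈ Finset.range (N + 1), if par^[j] u = t then 1 else 0) =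
      (if u = t then 1 else 0) + ∑ y ∈ Finset.range N, if par y = t then
        (∑ j ∈ Finset.range N, if par^[j] u = y then 1 else 0) else 0 := by
    intro u hu
    rw [Finset.sum_range_succ', add_comm]
    congr 1
    have h3 : ∀ y ∈ Finset.range N, (if par y = t then
        (∑ j ∈ Finset.range N, if par^[j] u = y then 1 else 0) else 0) =
        ∑ j ∈ Finset.range N, if par^[j] u = y then (if par y = t then 1 else 0) else 0 := by
      intro y _
      by_cases h : par y = t <;> simp [h]
    rw [Finset.sum_congr rfl h3, Finset.sum_comm]
    refine Finset.sum_congr rfl fun j _ => ?_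
    rw [Finset.sum_ite_eq, Function.iterate_succ_apply']
    by_cases h : par^[j] u < N
    · simp [h]
    · rw [le_antisymm (hT.iterate_le (Finset.mem_range.1 hu).le) (not_lt.1 h), hT.par_N,
        if_neg (by omega)]
      simp
  rw [h1, Finset.sum_congr rfl h2, Finset.sum_add_distrib, Finset.sum_ite_eq',
    if_pos (Finset.mem_range.2 ht), Finset.sum_comm]
  congr 1
  refine Finset.sum_congr rfl fun y _ => ?_
  by_cases h : par y = t <;> simp [h, sizeOfSub]

/-- The node `t` itself makes its subtree larger than those of its children together. So the
condition that defines the rank holds for `k = 0`, and the default value `0` of the search is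
legitimate. -/
theorem rank_zero {t : ℕ} (ht : t < N) : childSizes par N 0 t < sizeOfSub par N t / 2 ^ 0 := by
  rw [childSizes]
  simp only [pow_zero, Nat.div_one]
  have := hT.sizeOfSub_eq ht
  omega

theorem rank_spec {t : ℕ} (ht : t < N) :
    childSizes par N (rankOf par N t) t < sizeOfSub par N t / 2 ^ rankOf par N t := by
  rw [rankOf, if_pos ht]
  exact (iterN_last (fun k => childSizes par N k t < sizeOfSub par N t / 2 ^ k) N).2
    (hT.rank_zero ht)

theorem le_rank {t k : ℕ} (ht : t < N)
    (h : childSizes par N k t < sizeOfSub par N t / 2 ^ k) : k ≤ rankOf par N t := by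
  rw [rankOf, if_pos ht]
  refine (iterN_last (fun k => childSizes par N k t < sizeOfSub par N t / 2 ^ k) N).1 k ?_ h
  by_contra hk
  have h1 := hT.sizeOfSub_le ht
  have h2 : N < 2 ^ k := Nat.lt_two_pow_self.trans_le
    (Nat.pow_le_pow_right (by norm_num) (not_lt.1 hk))
  rw [Nat.div_eq_of_lt (by omega)] at h
  omega

theorem rank_lt {t : ℕ} (ht : t < N) : rankOf par N t < levels N := by
  have h1 : 2 ^ rankOf par N t ≤ N := by
    have := hT.rank_spec ht
    have h2 := hT.sizeOfSub_le ht
    by_contra h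
    rw [Nat.div_eq_of_lt (by omega)] at this
    omega
  have h3 : rankOf par N t < N := Nat.lt_two_pow_self.trans_le h1
  unfold levels
  rw [Finset.sum_boole, Nat.cast_id]
  calc rankOf par N t < (Finset.range (rankOf par N t + 1)).card := by simp
    _ ≤ _ := Finset.card_le_card fun i hi => by
      rw [Finset.mem_range] at hi
      rw [Finset.mem_filter, Finset.mem_range]
      exact ⟨by omega, (Nat.pow_le_pow_right (by norm_num) (by omega)).trans h1⟩

/-- For `f` take the binary digit at place `r` of the subtree size `s`. If `v` has rank at most `r`,
it adds no multiple of `2 ^ (r + 1)`, so `s v / 2 ^ (r + 1)` is at most the corresponding sum over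
the children. On the other hand `s v / 2 ^ r` is at least the sum over the children, with one to
spare if the rank is `r`. As a digit is `s / 2 ^ r - 2 * (s / 2 ^ (r + 1))`, the claim follows. -/
theorem ranking (r : ℕ) : ∃ f : ℕ → ℕ, (∀ v, f v ≤ 1) ∧ ∀ v, v < N → rankOf par N v ≤ r →
    (∑ y ∈ (Finset.range N).filter (fun y => par y = v), f y) +
      (if rankOf par N v = r then 1 else 0) ≤ f v := by
  refine ⟨fun v => sizeOfSub par N v / 2 ^ r % 2, fun v => by dsimp only; omega,
    fun v hv hr => ?_⟩
  set s := sizeOfSub par N with hs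
  have hdiv : ∀ y, s y / 2 ^ r % 2 + 2 * (s y / 2 ^ (r + 1)) = s y / 2 ^ r := fun y => by
    rw [pow_succ, ← Nat.div_div_eq_div_mul]
    omega
  have hch : ∀ k, childSizes par N k v =
      ∑ y ∈ (Finset.range N).filter (fun y => par y = v), s y / 2 ^ k := fun k => by
    rw [childSizes, Finset.sum_filter]
  have h1 : s v / 2 ^ (r + 1) ≤ childSizes par N (r + 1) v := by
    by_contra h
    have := hT.le_rank hv (not_le.1 h)
    omega
  have h2 : childSizes par N r v + (if rankOf par N v = r then 1 else 0) ≤ s v / 2 ^ r := by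
    split
    · rename_i h
      have := hT.rank_spec hv
      rw [h] at this
      exact this
    · have h3 : s v = 1 + ∑ y ∈ Finset.range N, if par y = v then s y else 0 := hT.sizeOfSub_eq hv
      rw [add_zero, hch, Nat.le_div_iff_mul_le (Nat.two_pow_pos _), Finset.sum_mul]
      rw [← Finset.sum_filter] at h3
      have h4 : ∑ y ∈ (Finset.range N).filter (fun y => par y = v), s y / 2 ^ r * 2 ^ r ≤
          ∑ y ∈ (Finset.range N).filter (fun y => par y = v), s y :=
        Finset.sum_le_sum fun y _ => Nat.div_mul_le_self _ _
      omega
  have h5 : (∑ y ∈ (Finset.range N).filter (fun y => par y = v), s y / 2 ^ r % 2) +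
      2 * childSizes par N (r + 1) v = childSizes par N r v := by
    rw [hch, hch, Finset.mul_sum, ← Finset.sum_add_distrib]
    exact Finset.sum_congr rfl fun y _ => hdiv y
  have h6 := hdiv v
  dsimp only
  omega

end Rooted

end Ranks

/-! ### Rooting a tree graph at the node `0` -/

section Trees

variable {N : ℕ} (T : SimpleGraph (Fin N))

noncomputable def adjN (t u : ℕ) : ℕ :=
  if h : t < N ∧ u < N then bit (T.Adj ⟨t, h.1⟩ ⟨u, h.2⟩) else 0

/-- The distance to the node `0`. -/
noncomputable def distN (t : ℕ) : ℕ :=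
  if h : t < N then T.dist ⟨0, by omega⟩ ⟨t, h⟩ else 0

/-- The sum has a single term, since in a tree only one neighbour is nearer to the node `0`; in this
form the parent can be evaluated by a bounded loop. The parent of the root, and of every number
outside the tree, is `N`. -/
noncomputable def parN (t : ℕ) : ℕ :=
  if t < N ∧ 0 < t then
    ∑ u ∈ Finset.range N, if adjN T t u = 1 ∧ distN T u < distN T t then u else 0
  else N

noncomputable def depN (t : ℕ) : ℕ := if t < N then distN T t + 1 else 0

theorem adjN_eq_one {t u : ℕ} : adjN T t u = 1 ↔ ∃ (ht : t < N) (hu : u < N), T.Adj ⟨t, ht⟩ ⟨u, hu⟩ := by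
  unfold adjN bit
  split
  · rename_i h
    simp [h.1, h.2]
  · rename_i h
    simp only [zero_ne_one, false_iff]
    rintro ⟨h1, h2, -⟩
    exact h ⟨h1, h2⟩

theorem adjN_le (t u : ℕ) : adjN T t u ≤ 1 := by
  unfold adjN bit
  split
  · split <;> omega
  · omega

/-- A shortest path from `u` to `o` avoids `t`, because `t` is not nearer to `o`. Prefixed by the
edge from `t` it is a path, hence the only path from `t` to `o`, and its length is the distance. In
particular neighbours never have equal distance from `o`. -/
theorem dist_of_adj (hT : T.IsTree) {o t u : Fin N} (h : T.Adj t u) (hd : T.dist u o ≤ T.dist t o) :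
    T.dist t o = T.dist u o + 1 ∧ ∀ p : T.Walk t o, p.IsPath → p.snd = u := by
  obtain ⟨q, hq⟩ := hT.1.exists_walk_length_eq_dist u o
  have hqp := q.isPath_of_length_eq_dist hq
  have hnot : t ∉ q.support := by
    intro hmem
    have h1 := SimpleGraph.dist_le (q.dropUntil t hmem)
    have h2 : (q.takeUntil t hmem).length + (q.dropUntil t hmem).length = q.length := by
      rw [← SimpleGraph.Walk.length_append, SimpleGraph.Walk.take_spec]
    have h3 : (q.takeUntil t hmem).length ≠ 0 := fun h0 =>
      h.ne (SimpleGraph.Walk.eq_of_length_eq_zero h0).symm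
    omega
  have hc : (SimpleGraph.Walk.cons h q).IsPath := (SimpleGraph.Walk.cons_isPath_iff h q).2 ⟨hqp, hnot⟩
  have huniq : ∀ {p q : T.Walk t o}, p.IsPath → q.IsPath → p = q :=
    fun h h' => (hT.existsUnique_path t o).unique h h'
  obtain ⟨p, hp⟩ := hT.1.exists_walk_length_eq_dist t o
  have hpc := huniq (p.isPath_of_length_eq_dist hp) hc
  refine ⟨by rw [← hp, hpc, SimpleGraph.Walk.length_cons, hq], fun p' hp' => ?_⟩
  rw [huniq hp' hc, SimpleGraph.Walk.snd_cons]

theorem parN_zero : parN T 0 = N := by simp [parN]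

variable {T} (hT : T.IsTree)
include hT

theorem parN_spec {t : ℕ} (ht : t < N) (h0 : 0 < t) :
    parN T t < N ∧ adjN T t (parN T t) = 1 ∧ distN T t = distN T (parN T t) + 1 ∧
      ∀ u, adjN T t u = 1 → distN T u ≤ distN T t → u = parN T t := by
  have hd : ∀ u (hu : u < N), distN T u = T.dist ⟨u, hu⟩ ⟨0, by omega⟩ := fun u hu => by
    rw [distN, dif_pos hu, SimpleGraph.dist_comm]
  obtain ⟨p, hp⟩ := hT.1.exists_walk_length_eq_dist (⟨t, ht⟩ : Fin N) ⟨0, by omega⟩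
  have hpp := p.isPath_of_length_eq_dist hp
  have hnil : ¬ p.Nil := SimpleGraph.Walk.not_nil_of_ne (by
    rw [Ne, Fin.mk.injEq]
    omega)
  have hadj := p.adj_snd hnil
  have hlen : p.tail.length + 1 = p.length := SimpleGraph.Walk.length_tail_add_one hnil
  have hle := SimpleGraph.dist_le p.tail
  have hone := dist_of_adj T hT (o := ⟨0, by omega⟩) hadj (by omega)
  have huniq : ∀ u, adjN T t u = 1 → distN T u ≤ distN T t → u = p.snd := by
    intro u hu hle
    obtain ⟨_, hu, hadj⟩ := (adjN_eq_one T).1 hu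
    have h1 := (dist_of_adj T hT hadj (by rwa [hd u hu, hd t ht] at hle)).2 p hpp
    rw [h1]
  have hs : adjN T t p.snd = 1 := (adjN_eq_one T).2 ⟨ht, p.snd.2, hadj⟩
  have hds : distN T t = distN T p.snd + 1 := by
    rw [hd t ht, hd p.snd p.snd.2]
    exact hone.1
  have hpar : parN T t = p.snd := by
    rw [parN, if_pos ⟨ht, h0⟩, Finset.sum_eq_single (p.snd : ℕ)]
    · rw [if_pos ⟨hs, by omega⟩]
    · intro u _ hne
      rw [if_neg fun h => hne (huniq u h.1 h.2.le)]
    · intro h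
      exact absurd (Finset.mem_range.2 p.snd.2) h
  rw [hpar]
  exact ⟨p.snd.2, hs, hds, huniq⟩

theorem distN_lt {t : ℕ} (ht : t < N) : distN T t < N := by
  rw [distN, dif_pos ht]
  obtain ⟨p, hp⟩ := hT.1.exists_walk_length_eq_dist (⟨0, by omega⟩ : Fin N) ⟨t, ht⟩
  have := (p.isPath_of_length_eq_dist hp).length_lt
  rwa [hp, Fintype.card_fin] at this

theorem rooted : Rooted N (parN T) (depN T) where
  par_N := by simp [parN]
  par_le t ht := by
    rcases Nat.eq_zero_or_pos t with rfl | h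
    · simp [parN]
    · exact (parN_spec hT ht h).1.le
  dep_par t ht := by
    rcases Nat.eq_zero_or_pos t with rfl | h
    · simp [parN, depN, distN, ht]
    · obtain ⟨h1, -, h3, -⟩ := parN_spec hT ht h
      rw [depN, if_pos ht, depN, if_pos h1, h3]
  dep_le t ht := by
    rw [depN, if_pos ht]
    exact distN_lt hT ht

theorem parN_reach : ∀ k t, t < N → distN T t ≤ k → ∃ j, (parN T)^[j] t = 0 := by
  intro k
  induction k with
  | zero =>
    intro t ht h
    rcases Nat.eq_zero_or_pos t with rfl | h0
    · exact ⟨0, rfl⟩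
    · have := (parN_spec hT ht h0).2.2.1
      omega
  | succ k ih =>
    intro t ht h
    rcases Nat.eq_zero_or_pos t with rfl | h0
    · exact ⟨0, rfl⟩
    · obtain ⟨h1, -, h3, -⟩ := parN_spec hT ht h0
      obtain ⟨j, hj⟩ := ih _ h1 (by omega)
      exact ⟨j + 1, by rw [Function.iterate_succ_apply, hj]⟩

theorem parN_of_adj {t u : Fin N} (h : T.Adj t u) : parN T t = u ∨ parN T u = t := by
  have key : ∀ t u : Fin N, T.Adj t u → distN T u ≤ distN T t → parN T t = u := by
    intro t u h hle
    have hadj : adjN T t u = 1 := (adjN_eq_one T).2 ⟨t.2, u.2, h⟩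
    rcases Nat.eq_zero_or_pos (t : ℕ) with h0 | h0
    · have : distN T u = 0 := by
        have : distN T (t : ℕ) = 0 := by rw [h0]; simp [distN]
        omega
      rw [distN, dif_pos u.2, hT.1.dist_eq_zero_iff] at this
      exact absurd (Fin.ext (by rw [h0]; exact congrArg Fin.val this) : t = u) h.ne
    · exact ((parN_spec hT t.2 h0).2.2.2 u hadj hle).symm
  rcases Nat.le_total (distN T u) (distN T t) with hle | hle
  · exact Or.inl (key t u h hle)
  · exact Or.inr (key u t h.symm hle)

/-- Every edge joins a node to its parent by `parN_of_adj`, so `g` is constant along walks inside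
`s`. -/
theorem conn_of_induce {s : Set (Fin N)} (hs : (T.induce s).Connected) (g : ℕ → ℕ)
    (hg : ∀ t (ht : t < N) (hp : parN T t < N), ⟨t, ht⟩ ∈ s → ⟨parN T t, hp⟩ ∈ s →
      g t = g (parN T t)) (t t' : Fin N) (ht : t ∈ s) (ht' : t' ∈ s) : g t = g t' := by
  obtain ⟨p⟩ := hs.preconnected ⟨t, ht⟩ ⟨t', ht'⟩
  have key : ∀ a b : s, (T.induce s).Walk a b → g a.1 = g b.1 := by
    intro a b p
    induction p with
    | nil => rfl
    | @cons a b c h p ih =>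
      rw [← ih]
      have hadj : T.Adj a.1 b.1 := h
      rcases parN_of_adj hT hadj with h1 | h1
      · have := hg a.1 a.1.2 (by rw [h1]; exact b.1.2) a.2 (by
          have : (⟨parN T a.1, by rw [h1]; exact b.1.2⟩ : Fin N) = b.1 := Fin.ext h1
          rw [this]; exact b.2)
        rw [this, h1]
      · have := hg b.1 b.1.2 (by rw [h1]; exact a.1.2) b.2 (by
          have : (⟨parN T b.1, by rw [h1]; exact a.1.2⟩ : Fin N) = a.1 := Fin.ext h1
          rw [this]; exact a.2)
        rw [this, h1]
  exact key _ _ p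

open Classical in
-- The degrees sum to `2 (N - 1)`, which exceeds `N` for `N ≥ 3`. This is how the base `d` of the
-- time bound enters.
theorem two_le_maxDegree (hN : 3 ≤ N) : 2 ≤ T.maxDegree := by
  have h1 := T.sum_degrees_eq_twice_card_edges
  have h2 := hT.card_edgeFinset
  rw [Fintype.card_fin] at h2
  have h3 : ∑ v, T.degree v ≤ ∑ _v : Fin N, T.maxDegree :=
    Finset.sum_le_sum fun v _ => T.degree_le_maxDegree v
  rw [Finset.sum_const, Finset.card_univ, Fintype.card_fin, smul_eq_mul] at h3
  by_contra h
  have h4 : N * T.maxDegree ≤ N * 1 := Nat.mul_le_mul_left _ (by omega)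
  have h5 : T.edgeFinset.card * 2 = 2 * T.edgeFinset.card := mul_comm _ _
  omega

end Trees

end SatTW

namespace SatTW

/-! ### The program: the tree -/

/-- The input of a context, with enough room for the numbers that the program handles. -/
structure Input (cx : Ctx) (n m N : ℕ) (pos neg adj bag : ℕ → ℕ → ℕ) : Prop where
  T : n + m + N + 3 ≤ cx.T
  -- The largest accumulators are products of weights or of messages over all clauses or children,
  -- and the number of events; their bit lengths are quadratic in the size of the input.
  β : 8 * (n + m + N + 3) ^ 2 ≤ cx.β
  len : cx.len = 3 + m * n + m * n + N * N + N * n + N * m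
  I_n : cx.I 0 = n
  I_m : cx.I 1 = m
  I_N : cx.I 2 = N
  I_pos : ∀ c x, c < m → x < n → cx.I (3 + (c * n + x)) = pos c x
  I_neg : ∀ c x, c < m → x < n → cx.I (3 + m * n + (c * n + x)) = neg c x
  I_adj : ∀ t u, t < N → u < N → cx.I (3 + m * n + m * n + (t * N + u)) = adj t u
  I_var : ∀ t x, t < N → x < n → cx.I (3 + m * n + m * n + N * N + (t * n + x)) = bag t x
  I_clause : ∀ t c, t < N → c < m →
    cx.I (3 + m * n + m * n + N * N + N * n + (t * m + c)) = bag t (n + c)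
  bag_le : ∀ t v, bag t v ≤ 1
  bag_N : ∀ t v, N ≤ t → bag t v = 0

namespace Tm

def n : Tm := inp (c 0)
def m : Tm := inp (c 1)
def N : Tm := inp (c 2)
def S : Tm := add n m
def off1 : Tm := add (c 3) (mul m n)
def off2 : Tm := add off1 (mul m n)
def off3 : Tm := add off2 (mul N N)
def off4 : Tm := add off3 (mul N n)
def inputLength : Tm := add off4 (mul N m)
def pos (a x : Tm) : Tm := inp (add (c 3) (add (mul a n) x))
def neg (a x : Tm) : Tm := inp (add off1 (add (mul a n) x))
def adj (t u : Tm) : Tm := inp (add off2 (add (mul t N) u))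
def bag (t v : Tm) : Tm := cond (lt t N)
  (cond (lt v n) (inp (add off3 (add (mul t n) v))) (inp (add off4 (add (mul t m) (sub v n))))) (c 0)
def bit (z t : Tm) : Tm := mod (div z (pow2 t)) (c 2)
-- Breadth-first search from the node `0` with the set of visited nodes as a bit mask in a single
-- accumulator. The distance of `t` is then the number of radii below `N` whose ball misses `t`.
-- Parents, sizes and ranks are likewise recomputed from the input at each use, which costs time
-- polynomial in `T` but no arrays.
def ball (k : Tm) : Tm := iter k (c 1) fun _ z => sum N fun t =>
  mul (pow2 t) (max (bit z t) (lt (c 0) (sum N fun u => mul (adj t u) (bit z u))))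
def dist (t : Tm) : Tm := sum N fun k => sub (c 1) (bit (ball k) t)
def par (t : Tm) : Tm := cond (mul (lt t N) (lt (c 0) t))
  (sum N fun u => mul u (mul (adj t u) (lt (dist u) (dist t)))) N
def size (t : Tm) : Tm := sum N fun u => sum N fun j => eq (iter j u fun _ z => par z) t
def levels : Tm := sum N fun i => le (pow2 i) N
def childSizes (k t : Tm) : Tm := sum N fun y => mul (eq (par y) t) (div (size y) (pow2 k))
def rank (t : Tm) : Tm := cond (lt t N)
  (iter N (c 0) fun k a => cond (lt (childSizes k t) (div (size t) (pow2 k))) k a) levels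
def top (t : Tm) : Tm := iter N t fun _ a => cond (lt (rank (par a)) (rank t)) (par a) a

end Tm

theorem pair_lt {a b x y : ℕ} (h : a < x) (h' : b < y) : a * y + b < x * y := by
  calc a * y + b < (a + 1) * y := by rw [Nat.add_mul]; omega
    _ ≤ x * y := Nat.mul_le_mul_right _ h

theorem sum_le_one {N : ℕ} {f : ℕ → ℕ} (h : ∀ k, k < N → f k ≤ 1) :
    ∑ k ∈ Finset.range N, f k ≤ N :=
  (Finset.sum_le_sum fun k hk => h k (Finset.mem_range.1 hk)).trans (by simp)

theorem prod_le_pow {N B : ℕ} {f : ℕ → ℕ} (h : ∀ k, k < N → f k ≤ B) :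
    ∏ k ∈ Finset.range N, f k ≤ B ^ N :=
  (Finset.prod_le_prod' fun k hk => h k (Finset.mem_range.1 hk)).trans (by simp)

theorem ite_le_one (p : Prop) [Decidable p] : (if p then 1 else 0) ≤ 1 := by split <;> omega

namespace Input

variable {cx : Ctx} {n m N : ℕ} {pos neg adj bag : ℕ → ℕ → ℕ}
  (hI : Input cx n m N pos neg adj bag)
  {A : ℕ → ℕ → ℕ} {w : World} {a b e : Tm} {u v : ℕ}
include hI

theorem lt_two_pow {v k : ℕ} (h : v ≤ 2 ^ k) (hk : k < 8 * (n + m + N + 3) ^ 2) :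
    v < 2 ^ cx.β :=
  h.trans_lt (Nat.pow_lt_pow_right (by norm_num) (hk.trans_le hI.β))

theorem small {v : ℕ} (h : v ≤ (n + m + N + 3) ^ 2) : v < 2 ^ cx.β := by
  refine hI.lt_two_pow (h.trans Nat.lt_two_pow_self.le) ?_
  have : 0 < (n + m + N + 3) ^ 2 := by positivity
  omega

theorem le_pow {v k : ℕ} (h : v ≤ 2 ^ k) (hk : k ≤ n + m + N + 3) : v < 2 ^ cx.β :=
  hI.lt_two_pow h (by
    have : k ≤ (n + m + N + 3) ^ 2 := hk.trans (Nat.le_self_pow (by norm_num) _)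
    have : 0 < (n + m + N + 3) ^ 2 := by positivity
    omega)

theorem small_sq {v : ℕ} (h : v ≤ N * N) : v < 2 ^ cx.β :=
  hI.small (h.trans (by rw [sq]; exact Nat.mul_le_mul (by omega) (by omega)))

theorem smaller {v : ℕ} (h : v ≤ n + m + N + 3) : v < 2 ^ cx.β :=
  hI.small (h.trans (Nat.le_self_pow (by norm_num) _))

theorem T_N : N ≤ cx.T := by have := hI.T; omega

theorem T_one : 1 ≤ cx.T := by have := hI.T; omega

theorem three_lt {i : ℕ} (h : i < 3) : i < cx.len := by rw [hI.len]; omega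

theorem n_spec : Has cx A w Tm.n n := (Has.inp (.c 0) (hI.three_lt (by omega))).congr hI.I_n
theorem m_spec : Has cx A w Tm.m m := (Has.inp (.c 1) (hI.three_lt (by omega))).congr hI.I_m
theorem N_spec : Has cx A w Tm.N N := (Has.inp (.c 2) (hI.three_lt (by omega))).congr hI.I_N
theorem S_spec : Has cx A w Tm.S (n + m) := hI.n_spec.add hI.m_spec
theorem off1_spec : Has cx A w Tm.off1 (3 + m * n) := (Has.c 3).add (hI.m_spec.mul hI.n_spec)
theorem off2_spec : Has cx A w Tm.off2 (3 + m * n + m * n) :=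
  hI.off1_spec.add (hI.m_spec.mul hI.n_spec)
theorem off3_spec : Has cx A w Tm.off3 (3 + m * n + m * n + N * N) :=
  hI.off2_spec.add (hI.N_spec.mul hI.N_spec)
theorem off4_spec : Has cx A w Tm.off4 (3 + m * n + m * n + N * N + N * n) :=
  hI.off3_spec.add (hI.N_spec.mul hI.n_spec)
theorem inputLength_spec : Has cx A w Tm.inputLength cx.len :=
  (hI.off4_spec.add (hI.N_spec.mul hI.m_spec)).congr hI.len.symm

theorem pos_spec (ha : Has cx A w a u) (hb : Has cx A w b v) (hu : u < m) (hv : v < n) :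
    Has cx A w (Tm.pos a b) (pos u v) :=
  (Has.inp ((Has.c 3).add ((ha.mul hI.n_spec).add hb)) (by
    have := pair_lt hu hv; rw [hI.len]; omega)).congr (hI.I_pos u v hu hv)

theorem neg_spec (ha : Has cx A w a u) (hb : Has cx A w b v) (hu : u < m) (hv : v < n) :
    Has cx A w (Tm.neg a b) (neg u v) :=
  (Has.inp (hI.off1_spec.add ((ha.mul hI.n_spec).add hb)) (by
    have := pair_lt hu hv; rw [hI.len]; omega)).congr (hI.I_neg u v hu hv)

theorem adj_spec (ha : Has cx A w a u) (hb : Has cx A w b v) (hu : u < N) (hv : v < N) :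
    Has cx A w (Tm.adj a b) (adj u v) :=
  (Has.inp (hI.off2_spec.add ((ha.mul hI.N_spec).add hb)) (by
    have := pair_lt hu hv; rw [hI.len]; omega)).congr (hI.I_adj u v hu hv)

theorem bag_spec (ha : Has cx A w a u) (hb : Has cx A w b v) (hv : v < n + m) :
    Has cx A w (Tm.bag a b) (bag u v) := by
  have h1 : bag u v < 2 ^ cx.β := hI.smaller (by have := hI.bag_le u v; omega)
  refine ((ha.lt hI.N_spec).cond hI.T_one (u := bag u v) (v := 0) (fun hu => ?_) (fun _ => .c 0)
    (fun _ => h1) (fun _ => Nat.two_pow_pos _)).congr ?_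
  · refine ((hb.lt hI.n_spec).cond hI.T_one (u := bag u v) (v := bag u v) (fun hx => ?_)
      (fun hx => ?_) (fun _ => h1) (fun _ => h1)).congr (by simp)
    · exact (Has.inp (hI.off3_spec.add ((ha.mul hI.n_spec).add hb)) (by
        have := pair_lt hu hx; rw [hI.len]; omega)).congr (hI.I_var u v hu hx)
    · have hc : v - n < m := by omega
      refine (Has.inp (hI.off4_spec.add ((ha.mul hI.m_spec).add (hb.sub hI.n_spec))) (by
        have := pair_lt hu hc; rw [hI.len]; omega)).congr ((hI.I_clause u _ hu hc).trans ?_)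
      rw [show n + (v - n) = v by omega]
  · split
    · rfl
    · exact (hI.bag_N u v (by omega)).symm

theorem pow_spec {k : ℕ} (ha : Has cx A w a k) (hk : k ≤ n + m + N + 3) :
    Has cx A w (Tm.pow2 a) (2 ^ k) :=
  ha.pow2 (hk.trans hI.T) ((hk.trans (Nat.le_self_pow two_ne_zero _)).trans_lt (by
    have := hI.β
    have : 0 < (n + m + N + 3) ^ 2 := by positivity
    omega))

theorem bit_spec {k : ℕ} (ha : Has cx A w a v) (hb : Has cx A w b k) (hk : k ≤ n + m + N + 3) :
    Has cx A w (Tm.bit a b) (v / 2 ^ k % 2) :=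
  (ha.div (hI.pow_spec hb hk)).mod (.c 2)

theorem levels_spec : Has cx A w Tm.levels (levels N) :=
  Has.sum hI.N_spec hI.T_N (hI.smaller ((sum_le_one fun _ _ => ite_le_one _).trans (by omega)))
    fun w' hw i k hk hi => (hI.pow_spec (hi A) (by omega)).le hI.N_spec

end Input

/-- The nodes at distance at most `k` from the node `0`, as a binary number. -/
def ballCode (adj : ℕ → ℕ → ℕ) (N k : ℕ) : ℕ := iterN k 1 fun _ z => ∑ t ∈ Finset.range N,
  2 ^ t * max (z / 2 ^ t % 2) (if 0 < ∑ u ∈ Finset.range N, adj t u * (z / 2 ^ u % 2) then 1 else 0)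

theorem codeOf_one {f : ℕ → ℕ} {N t : ℕ} (hf : ∀ v, f v ≤ 1) (ht : t < N) :
    (∑ v ∈ Finset.range N, 2 ^ v * f v) / 2 ^ t % 2 = f t ∧
    ∑ v ∈ Finset.range N, 2 ^ v * f v < 2 ^ N := by
  have hplace : ∀ v, place (fun _ => 1) v = 2 ^ v := fun v => by simp [place]
  have hcode : ∑ v ∈ Finset.range N, 2 ^ v * f v = codeOf (fun _ => 1) f N := by
    refine Finset.sum_congr rfl fun v _ => ?_
    rw [hplace, one_mul, mul_comm]
  have h1 := digit_codeOf (b := fun _ => 1) (fun _ => le_rfl) hf ht rfl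
  have h2 := codeOf_lt (b := fun _ => 1) (fun _ => le_rfl) hf N
  rw [digit, hplace] at h1
  rw [hplace] at h2
  rw [hcode]
  exact ⟨h1, h2⟩

section

variable {N : ℕ} {T : SimpleGraph (Fin N)} (hT : T.IsTree)
include hT

theorem dist_le_succ_iff {k t : ℕ} (ht : t < N) : distN T t ≤ k + 1 ↔
    distN T t ≤ k ∨ ∃ u, u < N ∧ adjN T t u = 1 ∧ distN T u ≤ k := by
  constructor
  · intro h
    rcases Nat.eq_zero_or_pos t with rfl | h0
    · left
      simp [distN]
    · obtain ⟨h1, h2, h3, -⟩ := parN_spec hT ht h0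
      exact Or.inr ⟨_, h1, h2, by omega⟩
  · rintro (h | ⟨u, hu, hadj, hle⟩)
    · omega
    · obtain ⟨_, _, hadj⟩ := (adjN_eq_one T).1 hadj
      rcases parN_of_adj hT hadj with h | h
      · rcases Nat.eq_zero_or_pos t with rfl | h0
        · simp [distN]
        · have := (parN_spec hT ht h0).2.2.1
          simp only at h
          rw [h] at this
          omega
      · rcases Nat.eq_zero_or_pos u with rfl | h0
        · simp only [parN_zero] at h
          omega
        · have := (parN_spec hT hu h0).2.2.1
          simp only at h
          rw [h] at this
          omega

theorem bit_ballCode (k : ℕ) : ∀ t, t < N →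
    ballCode (adjN T) N k / 2 ^ t % 2 = if distN T t ≤ k then 1 else 0 := by
  induction k with
  | zero =>
    intro t ht
    rcases Nat.eq_zero_or_pos t with rfl | h0
    · simp [ballCode, distN]
    · have h1 := (parN_spec hT ht h0).2.2.1
      rw [if_neg (by omega), ballCode, iterN_zero, Nat.div_eq_of_lt]
      exact Nat.one_lt_two_pow (by omega)
  | succ k ih =>
    intro t ht
    have hf : ∀ t, max (ballCode (adjN T) N k / 2 ^ t % 2)
        (if 0 < ∑ u ∈ Finset.range N, adjN T t u * (ballCode (adjN T) N k / 2 ^ u % 2)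
          then 1 else 0) ≤ 1 := fun t => by
      have := ite_le_one (0 < ∑ u ∈ Finset.range N, adjN T t u * (ballCode (adjN T) N k / 2 ^ u % 2))
      omega
    have h1 : ballCode (adjN T) N (k + 1) / 2 ^ t % 2 = _ := (codeOf_one hf ht).1
    rw [h1, ih t ht]
    have h2 : (0 < ∑ u ∈ Finset.range N, adjN T t u * (ballCode (adjN T) N k / 2 ^ u % 2)) ↔
        ∃ u, u < N ∧ adjN T t u = 1 ∧ distN T u ≤ k := by
      rw [Finset.sum_pos_iff]
      refine exists_congr fun u => ?_
      rw [Finset.mem_range]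
      refine and_congr_right fun hu => ?_
      rw [ih u hu]
      have := adjN_le T t u
      by_cases h : distN T u ≤ k
      · simp only [h, if_true, and_true]
        omega
      · simp [h]
    simp only [h2, dist_le_succ_iff hT ht]
    by_cases h3 : distN T t ≤ k <;>
      by_cases h4 : ∃ u, u < N ∧ adjN T t u = 1 ∧ distN T u ≤ k <;> simp [h3, h4]

theorem ballCode_lt (k : ℕ) : ballCode (adjN T) N k < 2 ^ (N + 1) := by
  cases k with
  | zero => exact Nat.one_lt_two_pow (by omega)
  | succ k =>
    rcases Nat.eq_zero_or_pos N with h | h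
    · subst h
      simp [ballCode, iterN_succ]
    · have := (codeOf_one (N := N) (t := 0) (f := fun t => max (ballCode (adjN T) N k / 2 ^ t % 2)
        (if 0 < ∑ u ∈ Finset.range N, adjN T t u * (ballCode (adjN T) N k / 2 ^ u % 2)
          then 1 else 0)) (fun t => by
        have := ite_le_one (0 < ∑ u ∈ Finset.range N,
          adjN T t u * (ballCode (adjN T) N k / 2 ^ u % 2))
        omega) h).2
      exact lt_trans this (Nat.pow_lt_pow_right (by norm_num) (by omega))

theorem sum_ballCode {t : ℕ} (ht : t < N) :
    ∑ k ∈ Finset.range N, (1 - ballCode (adjN T) N k / 2 ^ t % 2) = distN T t := by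
  have h1 : ∀ k ∈ Finset.range N, (1 - ballCode (adjN T) N k / 2 ^ t % 2) =
      if k < distN T t then 1 else 0 := by
    intro k _
    rw [bit_ballCode hT k t ht]
    split <;> split <;> omega
  rw [Finset.sum_congr rfl h1, Finset.sum_boole, Nat.cast_id]
  have h2 : (Finset.range N).filter (fun k => k < distN T t) = Finset.range (distN T t) := by
    have := distN_lt hT ht
    ext k
    simp only [Finset.mem_filter, Finset.mem_range]
    omega
  rw [h2, Finset.card_range]

end

theorem iterN_const_eq (f : ℕ → ℕ) (k x : ℕ) : iterN k x (fun _ z => f z) = f^[k] x := by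
  induction k with
  | zero => rfl
  | succ k ih => rw [iterN_succ, ih, Function.iterate_succ_apply']

theorem rankOf_lt {N : ℕ} (k t : ℕ) (p : ℕ → Prop) [DecidablePred p] (hk : k ≤ N)
    (ht : t ≤ N) : iterN k t (fun k a => if p k then k else a) ≤ N := by
  induction k with
  | zero => exact ht
  | succ k ih =>
    rw [iterN_succ]
    split
    · omega
    · exact ih (by omega)

theorem levels_le (N : ℕ) : levels N ≤ N := sum_le_one fun _ _ => ite_le_one _

section

variable {N : ℕ} {T : SimpleGraph (Fin N)} (hT : T.IsTree)
include hT

theorem parN_le (u : ℕ) : parN T u ≤ N := by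
  rcases Nat.lt_or_ge u N with h | h
  · exact (rooted hT).par_le u h
  · rw [parN, if_neg (by omega)]

end

theorem sizeOfSub_le_sq (par : ℕ → ℕ) (N t : ℕ) : sizeOfSub par N t ≤ N * N :=
  (Finset.sum_le_sum (g := fun _ => N) fun u _ => sum_le_one fun _ _ => ite_le_one _).trans
    (by simp)

namespace Input

variable {cx : Ctx} {n m N : ℕ} {pos neg bag : ℕ → ℕ → ℕ} {T : SimpleGraph (Fin N)}
  (hI : Input cx n m N pos neg (adjN T) bag) (hT : T.IsTree)
  {A : ℕ → ℕ → ℕ} {w : World} {a b e : Tm} {u v : ℕ}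
include hI hT

theorem ball_spec {k : ℕ} (ha : Has cx A w a k) (hk : k ≤ N) :
    Has cx A w (Tm.ball a) (ballCode (adjN T) N k) := by
  refine Has.iter ha (.c 1) (hk.trans hI.T_N) (fun j _ => hI.le_pow (ballCode_lt hT j).le (by omega)) ?_
  · intro w' hw i z j hj hi hz
    have hlt := ballCode_lt hT (j + 1)
    refine Has.sum hI.N_spec hI.T_N (hI.le_pow hlt.le (by omega)) fun w₂ hw₂ i k hk hi => ?_
    refine (hI.pow_spec (hi A) (by omega)).mul (Has.max (hI.bit_spec ((hz A).mono hw₂) (hi A)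
      (by omega)) ((Has.c 0).lt (Has.sum hI.N_spec hI.T_N (hI.smaller ?_) fun w₃ hw₃ i' k' hk' hi' =>
        (hI.adj_spec ((hi A).mono hw₃) (hi' A) hk hk').mul
          (hI.bit_spec ((hz A).mono (hw₂.trans hw₃)) (hi' A) (by omega)))))
    refine (sum_le_one fun u _ => ?_).trans (by omega)
    exact Nat.mul_le_mul (adjN_le T k u) (show _ ≤ 1 by omega)

theorem dist_spec (ha : Has cx A w a u) (hu : u < N) : Has cx A w (Tm.dist a) (distN T u) := by
  refine (Has.sum hI.N_spec hI.T_N (hI.smaller ?_) fun w' hw i k hk hi => (Has.c 1).sub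
    (hI.bit_spec (hI.ball_spec hT (hi A) hk.le) (ha.mono hw) (by omega))).congr
    (sum_ballCode hT hu)
  exact (sum_le_one fun _ _ => by omega).trans (by omega)

theorem par_spec (ha : Has cx A w a u) : Has cx A w (Tm.par a) (parN T u) := by
  have hle := parN_le hT u
  have hlt : parN T u < 2 ^ cx.β := hI.smaller (by omega)
  refine (((ha.lt hI.N_spec).and ((Has.c 0).lt ha)).cond hI.T_one (u := parN T u) (v := N)
    (fun h => ?_) (fun _ => hI.N_spec) (fun _ => hlt) (fun _ => hI.smaller (by omega))).congr
    (by split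
        · rfl
        · rw [parN, if_neg ‹_›])
  have hpar : parN T u = ∑ u' ∈ Finset.range N, u' * (adjN T u u' *
      if distN T u' < distN T u then 1 else 0) := by
    rw [parN, if_pos h]
    refine Finset.sum_congr rfl fun u' _ => ?_
    have := adjN_le T u u'
    rcases (show adjN T u u' = 0 ∨ adjN T u u' = 1 by omega) with h | h <;> simp [h]
  rw [hpar] at hlt ⊢
  exact Has.sum hI.N_spec hI.T_N hlt fun w' hw i k hk hi => (hi A).mul
    ((hI.adj_spec (ha.mono hw) (hi A) h.1 hk).mul
      ((hI.dist_spec hT (hi A) hk).lt (hI.dist_spec hT (ha.mono hw) h.1)))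

theorem size_spec (ha : Has cx A w a u) : Has cx A w (Tm.size a) (sizeOfSub (parN T) N u) := by
  have hR := rooted hT
  refine Has.sum hI.N_spec hI.T_N (hI.small_sq ?_) fun w₁ h₁ i x hx hi => ?_
  · exact sizeOfSub_le_sq (parN T) N u
  · refine Has.sum hI.N_spec hI.T_N (hI.smaller ?_) fun w₂ h₂ j k hk hj => ?_
    · exact (sum_le_one fun _ _ => ite_le_one _).trans (by omega)
    · refine Has.eq ?_ (ha.mono (h₁.trans h₂))
      rw [← iterN_const_eq]
      refine Has.iter (hj A) ((hi A).mono h₂) (hk.le.trans hI.T_N) (fun l _ => ?_)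
        fun w₃ h₃ _ z l _ _ hz => hI.par_spec hT (hz A)
      rw [iterN_const_eq]
      exact hI.smaller ((hR.iterate_le hx.le).trans (by omega))

theorem childSizes_spec {k : ℕ} (ha : Has cx A w a k) (hb : Has cx A w b u) (hk : k ≤ N) :
    Has cx A w (Tm.childSizes a b) (childSizes (parN T) N k u) := by
  have hval : childSizes (parN T) N k u = ∑ y ∈ Finset.range N,
      (if parN T y = u then 1 else 0) * (sizeOfSub (parN T) N y / 2 ^ k) :=
    Finset.sum_congr rfl fun y _ => by by_cases h : parN T y = u <;> simp [h]
  have hle : childSizes (parN T) N k u ≤ N * N := by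
    refine (Finset.sum_le_sum (g := fun _ => N) fun y hy => ?_).trans (by simp)
    split
    · exact (Nat.div_le_self _ _).trans ((rooted hT).sizeOfSub_le (Finset.mem_range.1 hy))
    · exact Nat.zero_le _
  have hlt : childSizes (parN T) N k u < 2 ^ cx.β := hI.small_sq hle
  rw [hval] at hlt ⊢
  exact Has.sum hI.N_spec hI.T_N hlt fun w' hw i y hy hi =>
    ((hI.par_spec hT (hi A)).eq (hb.mono hw)).mul
      ((hI.size_spec hT (hi A)).div (hI.pow_spec (ha.mono hw) (by omega)))

theorem rank_spec (ha : Has cx A w a u) : Has cx A w (Tm.rank a) (rankOf (parN T) N u) := by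
  have hlev := levels_le N
  have hle : ∀ k, k ≤ N → iterN k 0 (fun k a => if childSizes (parN T) N k u <
      sizeOfSub (parN T) N u / 2 ^ k then k else a) ≤ N := fun k hk =>
    rankOf_lt k 0 _ hk (Nat.zero_le _)
  refine (ha.lt hI.N_spec).cond hI.T_one (fun h => ?_) (fun _ => hI.levels_spec)
    (fun _ => hI.smaller ((hle N le_rfl).trans (by omega))) (fun _ => hI.smaller (by omega))
  refine Has.iter hI.N_spec (.c 0) hI.T_N (fun k hk => hI.smaller ((hle k hk).trans (by omega)))
    fun w' hw i z k hk hi hz => ?_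
  exact ((hI.childSizes_spec hT (hi A) (ha.mono hw) hk.le).lt
    ((hI.size_spec hT (ha.mono hw)).div (hI.pow_spec (hi A) (by omega)))).cond hI.T_one
    (fun _ => hi A) (fun _ => hz A) (fun _ => hI.smaller (by omega))
    (fun _ => hI.smaller ((hle k hk.le).trans (by omega)))

theorem top_spec (ha : Has cx A w a u) (hu : u < N) : Has cx A w (Tm.top a)
    (iterN N u fun _ a => if rankOf (parN T) N (parN T a) < rankOf (parN T) N u
      then parN T a else a) := by
  have hle : ∀ k, iterN k u (fun _ a => if rankOf (parN T) N (parN T a) < rankOf (parN T) N u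
      then parN T a else a) ≤ N := fun k => by
    induction k with
    | zero => exact hu.le
    | succ k ih =>
      rw [iterN_succ]
      split
      · exact parN_le hT _
      · exact ih
  refine Has.iter hI.N_spec ha hI.T_N (fun k hk => hI.smaller ((hle k).trans (by omega)))
    fun w' hw i z k hk hi hz => ?_
  exact ((hI.rank_spec hT (hI.par_spec hT (hz A))).lt (hI.rank_spec hT (ha.mono hw))).cond hI.T_one
    (fun _ => hI.par_spec hT (hz A)) (fun _ => hz A)
    (fun _ => hI.smaller ((parN_le hT _).trans (by omega)))
    (fun _ => hI.smaller ((hle k).trans (by omega)))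

end Input

end SatTW

namespace SatTW

/-! ### The program: weights -/

namespace Tm

def place (t v : Tm) : Tm := prod v fun u => add (c 1) (bag t u)
def digit (t v x : Tm) : Tm := mod (div x (place t v)) (c 2)
def lit (a x b : Tm) : Tm := add (mul b (pos a x)) (mul (sub (c 1) b) (neg a x))
def first (t v : Tm) : Tm := prod t fun u => sub (c 1) (bag u v)
def clauseW (t a x : Tm) : Tm :=
  cond (eq (mul (bag t (add n a)) (digit t (add n a) x)) (c 1))
    (mul (cond (eq (first t (add n a)) (c 1)) (pow2 n) (c 1))
      (prod n fun v => sub (c 1) (mul (bag t v) (lit a v (digit t v x)))))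
    (c 1)
def nodeW (t x : Tm) : Tm := cond (lt x (place t S)) (prod m fun a => clauseW t a x) (c 0)
def edgeW (t x x' : Tm) : Tm := prod S fun v => sub (c 1)
  (mul (mul (bag t v) (bag (par t) v)) (cond (eq (digit t v x) (digit (par t) v x')) (c 0) (c 1)))
/-- The number of bits in the codes of the states. -/
def bits : Tm := iter N (c 1) fun t z => max z (sum S fun v => bag t v)
/-- The number of bits that are not guessed. -/
def low (p r : ℕ) : Tm := div (mul (c p) (sub bits (c 1))) (c r)

end Tm

namespace Inst

variable (I : Inst)

def bits : ℕ := iterN I.N 1 fun t z => max z (∑ v ∈ Finset.range (I.n + I.m), I.bag t v)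

def low (p r : ℕ) : ℕ := p * (I.bits - 1) / r

theorem iterN_max (f : ℕ → ℕ) (N : ℕ) :
    1 ≤ iterN N 1 (fun t z => max z (f t)) ∧
    (∀ t, t < N → f t ≤ iterN N 1 fun t z => max z (f t)) ∧
    ∀ B, 1 ≤ B → (∀ t, t < N → f t ≤ B) → iterN N 1 (fun t z => max z (f t)) ≤ B := by
  induction N with
  | zero => exact ⟨le_rfl, fun t ht => by omega, fun B hB _ => hB⟩
  | succ N ih =>
    obtain ⟨h1, h2, h3⟩ := ih
    rw [iterN_succ]
    refine ⟨h1.trans (le_max_left _ _), fun t ht => ?_, fun B hB h => ?_⟩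
    · rcases Nat.lt_succ_iff_lt_or_eq.1 ht with h | rfl
      · exact (h2 t h).trans (le_max_left _ _)
      · exact le_max_right _ _
    · exact max_le (h3 B hB fun t ht => h t (by omega)) (h N (by omega))

theorem bits_pos : 1 ≤ I.bits := (iterN_max _ _).1

theorem low_lt {p r : ℕ} (h : p ≤ r) : I.low p r < I.bits := by
  have h1 := I.bits_pos
  have : I.low p r ≤ I.bits - 1 := Nat.div_le_of_le_mul (Nat.mul_le_mul_right _ h)
  omega

variable {I}

theorem Valid.bits_le (hV : I.Valid) : I.bits ≤ I.n + I.m + 1 :=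
  (iterN_max _ _).2.2 _ (by omega) fun t _ =>
    (sum_le_one fun v _ => hV.bag_le t v).trans (by omega)

theorem Valid.place_le_bits (hV : I.Valid) {t : ℕ} (ht : t < I.N) :
    place (I.bag t) (I.n + I.m) ≤ 2 ^ I.bits := by
  rw [hV.place_le]
  exact Nat.pow_le_pow_right (by norm_num) ((iterN_max (fun t => ∑ v ∈ Finset.range (I.n + I.m), I.bag t v) _).2.1 t ht)

theorem Valid.place_le_pow (hV : I.Valid) (t v : ℕ) : place (I.bag t) v ≤ 2 ^ v := by
  rw [hV.place_le]
  exact Nat.pow_le_pow_right (by norm_num) (sum_le_one fun v _ => hV.bag_le t v)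

theorem clauseW_le (t c x : ℕ) : I.clauseW t c x ≤ 2 ^ I.n := by
  have h1 := Nat.one_le_two_pow (n := I.n)
  unfold clauseW
  split
  · refine (Nat.mul_le_mul (show _ ≤ 2 ^ I.n by split <;> omega)
      (show _ ≤ 1 from ?_)).trans (by simp)
    exact (prod_le_pow (B := 1) fun v _ => Nat.sub_le _ _).trans (by simp)
  · exact h1

theorem edgeW_le (t x x' : ℕ) : I.edgeW t x x' ≤ 1 :=
  (prod_le_pow (B := 1) fun v _ => Nat.sub_le _ _).trans (by simp)

end Inst

namespace Input

section

variable {cx : Ctx} {I : Inst} (hV : I.Valid) {adj : ℕ → ℕ → ℕ}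
  (hI : Input cx I.n I.m I.N I.pos I.neg adj I.bag)
  {A : ℕ → ℕ → ℕ} {w : World} {a b d : Tm} {u v x : ℕ}
include hI

theorem T_S : I.n + I.m ≤ cx.T := by have := hI.T; omega

theorem first_spec (ha : Has cx A w a u) (hb : Has cx A w b v) (hv : v < I.n + I.m) (hu : u ≤ I.N) :
    Has cx A w (Tm.first a b) (I.first u v) :=
  Has.prod ha (hu.trans hI.T_N) (fun k _ => hI.smaller
      (((prod_le_pow (B := 1) fun v _ => Nat.sub_le _ _).trans (by simp)).trans
        (show 1 ≤ _ by omega)))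
    fun w' hw i k hk hi => (Has.c 1).sub (hI.bag_spec (hi A) (hb.mono hw) hv)

theorem lit_spec (ha : Has cx A w a u) (hb : Has cx A w b v) (hd : Has cx A w d x)
    (hu : u < I.m) (hv : v < I.n) : Has cx A w (Tm.lit a b d) (I.lit u v x) :=
  (hd.mul (hI.pos_spec ha hb hu hv)).add (((Has.c 1).sub hd).mul (hI.neg_spec ha hb hu hv))

include hV

theorem place_spec (ha : Has cx A w a u) (hb : Has cx A w b v) (hv : v ≤ I.n + I.m) :
    Has cx A w (Tm.place a b) (place (I.bag u) v) :=
  Has.prod hb (hv.trans hI.T_S) (fun k hk => hI.le_pow (hV.place_le_pow u k) (by omega))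
    fun w' hw i k hk hi => (Has.c 1).add (hI.bag_spec (ha.mono hw) (hi A) (by omega))

theorem digit_spec (ha : Has cx A w a u) (hb : Has cx A w b v) (hd : Has cx A w d x)
    (hv : v ≤ I.n + I.m) : Has cx A w (Tm.digit a b d) (digit (I.bag u) v x) :=
  (hd.div (hI.place_spec hV ha hb hv)).mod (.c 2)

theorem clauseW_spec (ha : Has cx A w a u) (hb : Has cx A w b v) (hd : Has cx A w d x)
    (hu : u ≤ I.N) (hv : v < I.m) : Has cx A w (Tm.clauseW a b d) (I.clauseW u v x) := by
  have h1 := Nat.one_le_two_pow (n := I.n)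
  have hc := hI.n_spec.add hb
  have hcS : I.n + v < I.n + I.m := by omega
  refine (((hI.bag_spec ha hc hcS).mul (hI.digit_spec hV ha hc hd hcS.le)).eq (.c 1)).cond hI.T_one
    (fun _ => ?_) (fun _ => .c 1) (fun h => ?_) (fun _ => hI.smaller (by omega))
  · refine (((hI.first_spec ha hc hcS hu).eq (.c 1)).cond hI.T_one
      (fun _ => hI.pow_spec hI.n_spec (by omega)) (fun _ => .c 1)
      (fun _ => hI.le_pow le_rfl (by omega)) (fun _ => hI.smaller (by omega))).mul ?_
    refine Has.prod hI.n_spec (by have := hI.T; omega) (fun k _ => hI.smaller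
      (((prod_le_pow (B := 1) fun v _ => Nat.sub_le _ _).trans (by simp)).trans
        (show 1 ≤ _ by omega))) fun w' hw i k hk hi => ?_
    exact (Has.c 1).sub ((hI.bag_spec (ha.mono hw) (hi A) (by omega)).mul
      (hI.lit_spec (hb.mono hw) (hi A)
        (hI.digit_spec hV (ha.mono hw) (hi A) (hd.mono hw) (by omega)) hv hk))
  · have := Inst.clauseW_le (I := I) u v x
    rw [Inst.clauseW, if_pos h] at this
    exact hI.le_pow this (by omega)

theorem nodeW_spec (ha : Has cx A w a u) (hd : Has cx A w d x) (hu : u ≤ I.N) :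
    Has cx A w (Tm.nodeW a d) (I.nodeW u x) := by
  have hlt : ∀ k, k ≤ I.m → ∏ c ∈ Finset.range k, I.clauseW u c x < 2 ^ cx.β := fun k hk => by
    refine hI.lt_two_pow (k := I.n * k)
      ((prod_le_pow fun c _ => Inst.clauseW_le (I := I) u c x).trans (by rw [pow_mul])) ?_
    have : I.n * k ≤ (I.n + I.m + I.N + 3) * (I.n + I.m + I.N + 3) :=
      Nat.mul_le_mul (by omega) (by omega)
    rw [← sq] at this
    have : 0 < (I.n + I.m + I.N + 3) ^ 2 := by positivity
    omega
  refine (hd.lt (hI.place_spec hV ha hI.S_spec le_rfl)).cond hI.T_one (fun _ => ?_)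
    (fun _ => .c 0) (fun _ => hlt _ le_rfl) (fun _ => Nat.two_pow_pos _)
  exact Has.prod hI.m_spec (by have := hI.T; omega) hlt fun w' hw i k hk hi =>
    hI.clauseW_spec hV (ha.mono hw) (hi A) (hd.mono hw) hu hk

theorem bits_spec : Has cx A w Tm.bits I.bits := by
  have hsum : ∀ t, ∑ v ∈ Finset.range (I.n + I.m), I.bag t v ≤ I.n + I.m :=
    fun t => sum_le_one fun v _ => hV.bag_le t v
  refine Has.iter hI.N_spec (.c 1) hI.T_N (fun k _ => hI.smaller ?_) fun w' hw i z k hk hi hz => ?_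
  · exact ((Inst.iterN_max _ k).2.2 (I.n + I.m + 1) (by omega) fun t _ =>
      (hsum t).trans (by omega)).trans (by omega)
  · exact (hz A).max (Has.sum hI.S_spec hI.T_S (hI.smaller ((hsum k).trans (by omega)))
      fun w₂ hw₂ j l hl hj => hI.bag_spec ((hi A).mono hw₂) (hj A) hl)

theorem low_spec (p r : ℕ) : Has cx A w (Tm.low p r) (I.low p r) :=
  ((Has.c p).mul ((hI.bits_spec hV).sub (.c 1))).div (.c r)

end

theorem edgeW_spec {cx : Ctx} {I : Inst} (hV : I.Valid) {T : SimpleGraph (Fin I.N)} (hT : T.IsTree)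
    (hI : Input cx I.n I.m I.N I.pos I.neg (adjN T) I.bag) (hp : I.par = parN T)
    {A : ℕ → ℕ → ℕ} {w : World} {a b d : Tm} {u v x : ℕ} (ha : Has cx A w a u)
    (hb : Has cx A w b v) (hd : Has cx A w d x) : Has cx A w (Tm.edgeW a b d) (I.edgeW u v x) := by
  unfold Inst.edgeW
  rw [hp]
  have hpa := hI.par_spec hT ha
  refine Has.prod hI.S_spec hI.T_S (fun k _ => hI.smaller
      (((prod_le_pow (B := 1) fun v _ => Nat.sub_le _ _).trans (by simp)).trans
        (show 1 ≤ _ by omega))) fun w' hw i k hk hi => (Has.c 1).sub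
    (((hI.bag_spec (ha.mono hw) (hi A) hk).mul (hI.bag_spec (hpa.mono hw) (hi A) hk)).mul
      (((hI.digit_spec hV (ha.mono hw) (hi A) (hb.mono hw) hk.le).eq
        (hI.digit_spec hV (hpa.mono hw) (hi A) (hd.mono hw) hk.le)).cond hI.T_one (fun _ => .c 0)
        (fun _ => .c 1) (fun _ => Nat.two_pow_pos _) (fun _ => hI.smaller (by omega))))

end Input

end SatTW

namespace SatTW

/-! ### The program: the evaluation -/

namespace Tm

variable (p r : ℕ)

def H : Tm := pow2 (low p r)
def G : Tm := pow2 (sub bits (low p r))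
def modulus : Tm := add (pow2 n) (c 1)
def lev : Tm := arr 4 (c 0)
def dig : Tm := arr 3 lev
/-- The state of `t` with the guess for the rank of `t` and the lower part `h`. -/
def state (t h : Tm) : Tm := add (mul (div (arr 3 (rank t)) (c 2)) (H p r)) h
def cell (t h : Tm) : Tm := add (mul t (H p r)) h
def msgU (y h : Tm) : Tm := sum (H p r) fun h' =>
  mul (edgeW y (state p r y h') (state p r (par y) h)) (arr 0 (cell p r y h'))
def comb (a h : Tm) : Tm := mul (nodeW a (state p r a h)) (prod N fun y => cond (eq (par y) a)
  (cond (lt (rank a) (rank y)) (msgU p r y h) (arr 1 (cell p r y h))) (c 1))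
def newU (i a h : Tm) : Tm :=
  cond (eq (rank a) lev) (mod (comb p r a h) modulus) (arr 0 i)
def newACC (i a h : Tm) : Tm := cond (eq (rank a) lev) (mod (add (arr 2 i)
  (cond (eq (top a) a) (msgU p r a h) (arr 1 (cell p r (top a) h)))) modulus) (arr 2 i)
def newMSG (i t h : Tm) : Tm := iter N (arr 1 i) fun a z =>
  cond (mul (eq (rank a) lev) (eq (top a) t)) (arr 2 (cell p r a h)) z
def clearACC (i a : Tm) : Tm := cond (eq (rank a) lev) (c 0) (arr 2 i)
def events : Tm := iter levels (c 0) fun _ z =>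
  mul (add (mul (c 2) (G p r)) (c 1)) (add z (c 1))

end Tm

namespace CTm

variable (p r : ℕ)

def fill (j : ℕ) (e : Tm → Tm → Tm → Tm) : CTm := loop (Tm.mul Tm.N (Tm.H p r)) fun i =>
  store j i (e i (Tm.div i (Tm.H p r)) (Tm.mod i (Tm.H p r)))
def setDig (e : Tm) : CTm := store 3 Tm.lev e
def setLev (e : Tm) : CTm := store 4 (Tm.c 0) e
def bump : CTm := seq (setDig (Tm.add Tm.dig (Tm.c 1))) (setLev (Tm.c 0))
def step : CTm := ite (Tm.lt Tm.lev Tm.levels)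
  (ite (Tm.lt Tm.dig (Tm.mul (Tm.c 2) (Tm.G p r)))
    (ite (Tm.eq (Tm.mod Tm.dig (Tm.c 2)) (Tm.c 0))
      (seq (fill p r 0 (Tm.newU p r)) bump)
      (seq (fill p r 2 (Tm.newACC p r)) bump))
    (seq (fill p r 1 (Tm.newMSG p r)) (seq (fill p r 2 fun i a _ => Tm.clearACC i a)
      (seq (setDig (Tm.c 0)) (setLev (Tm.add Tm.lev (Tm.c 1)))))))
  (setLev Tm.lev)

end CTm

namespace Inst

variable (I : Inst)

/-- The evaluation of the sum over all states with `2 ^ q` unguessed states. -/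
noncomputable def model {T : SimpleGraph (Fin I.N)} (hT : T.IsTree) (q : ℕ) (R : Type) [CommRing R] :
    Model R where
  N := I.N
  G := 2 ^ (I.bits - q)
  H := 2 ^ q
  L := levels I.N
  par := parN T
  dep := depN T
  rk := rankOf (parN T) I.N
  φ t x := I.nodeW t x
  ψ t x x' := I.edgeW t x x'
  H_pos := Nat.two_pow_pos _
  par_N := (rooted hT).par_N
  par_le := (rooted hT).par_le
  dep_par := (rooted hT).dep_par
  dep_le := (rooted hT).dep_le
  rk_lt _ := (rooted hT).rank_lt
  rk_N := by simp [rankOf]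
  ranking := (rooted hT).ranking

variable (T : SimpleGraph (Fin I.N)) (H : ℕ)

noncomputable def rk (t : ℕ) : ℕ := rankOf (parN T) I.N t

noncomputable def topN (u : ℕ) : ℕ :=
  iterN I.N u fun _ a => if rk I T (parN T a) < rk I T u then parN T a else a

/-- This and the next two definitions are the values of program terms for the arrays `A`: the arrays
`0`, `1`, `2` hold the tables `U`, `MSG`, `ACC` in rows of length `H`, array `3` the digits, and
element `0` of array `4` the current rank. -/
noncomputable def stateN (A : ℕ → ℕ → ℕ) (t h : ℕ) : ℕ := A 3 (I.rk T t) / 2 * H + h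

noncomputable def msgUN (A : ℕ → ℕ → ℕ) (y h : ℕ) : ℕ := ∑ h' ∈ Finset.range H,
  I.edgeW y (I.stateN T H A y h') (I.stateN T H A (parN T y) h) * A 0 (y * H + h')

noncomputable def combN (A : ℕ → ℕ → ℕ) (a h : ℕ) : ℕ := I.nodeW a (I.stateN T H A a h) *
  ∏ y ∈ Finset.range I.N, if parN T y = a then
    (if I.rk T a < I.rk T y then I.msgUN T H A y h else A 1 (y * H + h)) else 1

end Inst

/-- The values in the tables are residues modulo `2 ^ n + 1`. -/
def Tidy (n : ℕ) (A : ℕ → ℕ → ℕ) : Prop := ∀ j, j < 3 → ∀ i, A j i ≤ 2 ^ n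

namespace Inst

variable {I : Inst} {T : SimpleGraph (Fin I.N)} {q : ℕ} {A : ℕ → ℕ → ℕ}

theorem msgUN_le (hA : Tidy I.n A) (u h : ℕ) :
    I.msgUN T (2 ^ q) A u h ≤ 2 ^ (q + I.n) := by
  refine (Finset.sum_le_sum (g := fun _ => 2 ^ I.n) fun h' _ => ?_).trans ?_
  · exact (Nat.mul_le_mul (Inst.edgeW_le _ _ _) (hA 0 (by omega) _)).trans (by simp)
  · simp [pow_add]

theorem prod_msg_le (hA : Tidy I.n A) (u h k : ℕ) : (∏ y ∈ Finset.range k, if parN T y = u then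
    (if I.rk T u < I.rk T y then I.msgUN T (2 ^ q) A y h
      else A 1 (y * 2 ^ q + h)) else 1) ≤ 2 ^ ((q + I.n) * k) := by
  rw [pow_mul]
  refine prod_le_pow fun y _ => ?_
  split
  · split
    · exact msgUN_le hA y h
    · exact (hA 1 (by omega) _).trans (Nat.pow_le_pow_right (by norm_num) (by omega))
  · exact Nat.one_le_two_pow

end Inst

/-- The first `k` elements of the array `j`, as an array with rows of length `H`, are set to the
values `f`. -/
def filled (A : ℕ → ℕ → ℕ) (j k H : ℕ) (f : ℕ → ℕ → ℕ) : ℕ → ℕ → ℕ :=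
  fun j' i => if j' = j ∧ i < k then f (i / H) (i % H) else A j' i

section filled

variable {A : ℕ → ℕ → ℕ} {j k H : ℕ} {f : ℕ → ℕ → ℕ}

theorem filled_ne {j' : ℕ} (h : j' ≠ j) : filled A j k H f j' = A j' := by
  funext i
  simp [filled, h]

theorem filled_of_lt {c h : ℕ} (hh : h < H) (hk : c * H + h < k) :
    filled A j k H f j (c * H + h) = f c h := by
  have h1 : (c * H + h) / H = c := by
    rw [Nat.add_comm, Nat.add_mul_div_right _ _ (by omega), Nat.div_eq_of_lt hh, zero_add]
  have h2 : (c * H + h) % H = h := by rw [Nat.mul_comm, Nat.mul_add_mod, Nat.mod_eq_of_lt hh]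
  rw [filled, if_pos ⟨rfl, hk⟩, h1, h2]

theorem filled_of_le {i : ℕ} (hk : k ≤ i) : filled A j k H f j i = A j i := by
  rw [filled, if_neg (by omega)]

theorem Tidy.filled {n : ℕ} (hA : Tidy n A) (hf : ∀ c h, f c h ≤ 2 ^ n) :
    Tidy n (filled A j k H f) := by
  intro j' hj' i
  unfold SatTW.filled
  split
  · exact hf _ _
  · exact hA j' hj' i

end filled

/-- A context with the input of a formula and a tree decomposition. -/
structure Setup (cx : Ctx) (I : Inst) (T : SimpleGraph (Fin I.N)) (p r : ℕ) : Prop where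
  valid : I.Valid
  tree : T.IsTree
  input : Input cx I.n I.m I.N I.pos I.neg (adjN T) I.bag
  par : I.par = parN T
  le : p ≤ r
  room : (I.n + I.m + I.N + 3) * 2 ^ I.low p r ≤ cx.T
  X : cx.T ≤ cx.X

namespace Setup

variable {cx : Ctx} {I : Inst} {T : SimpleGraph (Fin I.N)} {p r : ℕ} (hS : Setup cx I T p r)
  {A B : ℕ → ℕ → ℕ} {w : World} {a b d i t : Tm} {u v h k : ℕ}
include hS

theorem low_le : I.low p r ≤ I.n + I.m := by
  have h1 := hS.valid.bits_le
  have h2 := I.low_lt hS.le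
  omega

theorem H_le : 2 ^ I.low p r ≤ cx.T :=
  (Nat.le_mul_of_pos_left _ (by omega)).trans hS.room

theorem cells_le : I.N * 2 ^ I.low p r ≤ cx.T :=
  (Nat.mul_le_mul_right _ (by omega)).trans hS.room

theorem low_spec : Has cx A w (Tm.low p r) (I.low p r) := hS.input.low_spec hS.valid p r

theorem H_spec : Has cx A w (Tm.H p r) (2 ^ I.low p r) :=
  hS.input.pow_spec hS.low_spec (by have := hS.low_le; omega)

theorem G_spec : Has cx A w (Tm.G p r) (2 ^ (I.bits - I.low p r)) :=
  hS.input.pow_spec ((hS.input.bits_spec hS.valid).sub hS.low_spec)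
    (by have := hS.valid.bits_le; omega)

theorem modulus_spec : Has cx A w Tm.modulus (2 ^ I.n + 1) :=
  (hS.input.pow_spec hS.input.n_spec (by omega)).add (.c 1)

theorem state_spec (ht : Has cx A w t u) (hd : Has cx A w d h) :
    Has cx A w (Tm.state p r t d) (I.stateN T (2 ^ I.low p r) A u h) :=
  (((Has.arr 3 (hS.input.rank_spec hS.tree ht)).div (.c 2)).mul hS.H_spec).add hd

theorem cell_spec (ht : Has cx A w t u) (hd : Has cx A w d h) :
    Has cx A w (Tm.cell p r t d) (u * 2 ^ I.low p r + h) := (ht.mul hS.H_spec).add hd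

theorem pow_low_lt {v : ℕ} (h : v ≤ 2 ^ (I.low p r + I.n)) : v < 2 ^ cx.β :=
  hS.input.lt_two_pow h (by
    have := hS.low_le
    have : 0 < (I.n + I.m + I.N + 3) ^ 2 := by positivity
    have : I.n + I.m + I.N + 3 ≤ (I.n + I.m + I.N + 3) ^ 2 := Nat.le_self_pow (by norm_num) _
    omega)

theorem msgU_spec (hA : Tidy I.n A) (ht : Has cx A w t u) (hd : Has cx A w d h) :
    Has cx A w (Tm.msgU p r t d) (I.msgUN T (2 ^ I.low p r) A u h) :=
  Has.sum hS.H_spec hS.H_le (hS.pow_low_lt (Inst.msgUN_le hA u h)) fun _ hw _ _ _ hi =>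
    (hS.input.edgeW_spec hS.valid hS.tree hS.par (ht.mono hw) (hS.state_spec (ht.mono hw) (hi A))
      (hS.state_spec (hS.input.par_spec hS.tree (ht.mono hw)) (hd.mono hw))).mul
      (Has.arr 0 (hS.cell_spec (ht.mono hw) (hi A)))

theorem exponent_lt (k : ℕ) (hk : k ≤ I.N) : I.n * I.m + (I.low p r + I.n) * k <
    8 * (I.n + I.m + I.N + 3) ^ 2 := by
  have h1 := hS.low_le
  have h2 : I.n * I.m ≤ (I.n + I.m + I.N + 3) * (I.n + I.m + I.N + 3) :=
    Nat.mul_le_mul (by omega) (by omega)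
  have h3 : (I.low p r + I.n) * k ≤ (2 * (I.n + I.m + I.N + 3)) * (I.n + I.m + I.N + 3) :=
    Nat.mul_le_mul (by omega) (by omega)
  have : 0 < (I.n + I.m + I.N + 3) ^ 2 := by positivity
  rw [mul_assoc, ← sq] at h3
  rw [← sq] at h2
  omega

theorem comb_spec (hA : Tidy I.n A) (ht : Has cx A w t u) (hd : Has cx A w d h) (hu : u < I.N) :
    Has cx A w (Tm.comb p r t d) (I.combN T (2 ^ I.low p r) A u h) := by
  have hin := hS.input
  have hlt : ∀ y, I.msgUN T (2 ^ I.low p r) A y h < 2 ^ cx.β := fun y =>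
    hS.pow_low_lt (Inst.msgUN_le hA y h)
  have hlt' : ∀ i, A 1 i < 2 ^ cx.β := fun i => hin.le_pow (hA 1 (by omega) i) (by omega)
  refine (hin.nodeW_spec hS.valid ht (hS.state_spec ht hd) hu.le).mul
    (Has.prod hin.N_spec hin.T_N (fun k hk => ?_) fun w' hw i y hy hi => ?_)
  · refine hin.lt_two_pow (Inst.prod_msg_le hA u h k) ?_
    have := hS.exponent_lt k hk
    omega
  · refine ((hin.par_spec hS.tree (hi A)).eq (ht.mono hw)).cond hin.T_one (fun _ => ?_)
      (fun _ => .c 1) (fun _ => ?_) (fun _ => hin.smaller (by omega))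
    · exact ((hin.rank_spec hS.tree (ht.mono hw)).lt (hin.rank_spec hS.tree (hi A))).cond hin.T_one
        (fun _ => hS.msgU_spec hA (hi A) (hd.mono hw))
        (fun _ => Has.arr 1 (hS.cell_spec (hi A) (hd.mono hw))) (fun _ => hlt _) (fun _ => hlt' _)
    · split
      · exact hlt _
      · exact hlt' _

/-- A table is updated in place, cell by cell, so each new value is evaluated on a partially updated
array. Users have to show that the already overwritten cells do not matter. -/
theorem fill_spec {j : ℕ} {e : Tm → Tm → Tm → Tm} {f : ℕ → ℕ → ℕ} {Q : (ℕ → ℕ → ℕ) → Prop}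
    (hlt : ∀ c h, c < I.N → h < 2 ^ I.low p r → f c h < 2 ^ cx.β)
    (he : ∀ w', w ≤ w' → ∀ i a d c h, c < I.N → h < 2 ^ I.low p r →
      Cst cx w' i (c * 2 ^ I.low p r + h) → Cst cx w' a c → Cst cx w' d h →
      Has cx (filled A j (c * 2 ^ I.low p r + h) (2 ^ I.low p r) f) w' (e i a d) (f c h))
    (hQ : Q (filled A j (I.N * 2 ^ I.low p r) (2 ^ I.low p r) f)) :
    Tri cx w (CTm.fill p r j e) A Q := by
  have hdiv : ∀ k, k < I.N * 2 ^ I.low p r → k / 2 ^ I.low p r < I.N := fun k hk =>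
    Nat.div_lt_of_lt_mul (by rwa [mul_comm])
  have hmod : ∀ k, k % 2 ^ I.low p r < 2 ^ I.low p r := fun k => Nat.mod_lt _ (Nat.two_pow_pos _)
  refine Tri.fill (hS.input.N_spec.mul hS.H_spec) hS.cells_le (hS.cells_le.trans hS.X)
    (fun k hk => hlt _ _ (hdiv k hk) (hmod k)) (fun w' hw i k hk hi => ?_) hQ
  have := he w' hw i _ _ _ _ (hdiv k hk) (hmod k) (by rwa [Nat.div_add_mod'])
    (fun B => (hi B).div hS.H_spec) (fun B => (hi B).mod hS.H_spec)
  rwa [Nat.div_add_mod'] at this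

end Setup

end SatTW

namespace SatTW

/-! ### Correctness of a round of the evaluation -/

/-- The arrays represent the working state of the evaluation. -/
structure Sim (I : Inst) (H G : ℕ) (A : ℕ → ℕ → ℕ) (s : Work (ZMod (2 ^ I.n + 1))) : Prop where
  lev : A 4 0 = s.lev
  lev_le : s.lev ≤ levels I.N
  dig : ∀ i, A 3 i = s.dig i
  dig_le : ∀ i, s.dig i ≤ 2 * G
  tidy : Tidy I.n A
  U : ∀ c h, c < I.N → h < H → (A 0 (c * H + h) : ZMod (2 ^ I.n + 1)) = s.U c h
  MSG : ∀ c h, c < I.N → h < H → (A 1 (c * H + h) : ZMod (2 ^ I.n + 1)) = s.MSG c h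
  ACC : ∀ c h, c < I.N → h < H → (A 2 (c * H + h) : ZMod (2 ^ I.n + 1)) = s.ACC c h

/-- The entry of `c` reads the array `0` only at nodes of higher rank, which the update of the
tables of one rank leaves unchanged. This makes the update in place correct. -/
theorem Inst.combN_congr {I : Inst} {T : SimpleGraph (Fin I.N)} {H : ℕ} {A B : ℕ → ℕ → ℕ} {c h : ℕ}
    (h1 : B 1 = A 1) (h3 : B 3 = A 3)
    (h0 : ∀ y h', I.rk T c < I.rk T y → h' < H → B 0 (y * H + h') = A 0 (y * H + h')) :
    I.combN T H B c h = I.combN T H A c h := by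
  have hst : ∀ t h, I.stateN T H B t h = I.stateN T H A t h :=
    fun t h => by rw [Inst.stateN, Inst.stateN, h3]
  rw [Inst.combN, Inst.combN, hst, h1]
  congr 1
  refine Finset.prod_congr rfl fun y _ => ?_
  split
  · split
    · rename_i hlt
      refine Finset.sum_congr rfl fun h' hh' => ?_
      rw [hst, hst, h0 y h' hlt (Finset.mem_range.1 hh')]
    · rfl
  · rfl

theorem Inst.msgUN_congr {I : Inst} {T : SimpleGraph (Fin I.N)} {H : ℕ} {A B : ℕ → ℕ → ℕ} {c h : ℕ}
    (h0 : B 0 = A 0) (h3 : B 3 = A 3) : I.msgUN T H B c h = I.msgUN T H A c h := by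
  simp only [Inst.msgUN, Inst.stateN, h0, h3]

namespace Sim

variable {cx : Ctx} {w : World} {I : Inst} {T : SimpleGraph (Fin I.N)} {H G : ℕ}
  {A B : ℕ → ℕ → ℕ} {s : Work (ZMod (2 ^ I.n + 1))} (hA : Sim I H G A s)
include hA

theorem stateN_eq (t h : ℕ) : I.stateN T H A t h = s.dig (I.rk T t) / 2 * H + h := by
  rw [Inst.stateN, hA.dig]

theorem lev_spec (h4 : B 4 = A 4) : Has cx B w Tm.lev s.lev :=
  (Has.arr 4 (.c 0)).congr (by rw [h4, hA.lev])

theorem dig_spec (h3 : B 3 = A 3) (h4 : B 4 = A 4) : Has cx B w Tm.dig (s.dig s.lev) :=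
  (Has.arr 3 (hA.lev_spec h4)).congr (by rw [h3, hA.dig])

end Sim

namespace Setup

variable {cx : Ctx} {I : Inst} {T : SimpleGraph (Fin I.N)} {p r : ℕ} (hS : Setup cx I T p r)
  {A : ℕ → ℕ → ℕ} {w : World}
include hS

/-- The evaluation that the program carries out. -/
noncomputable abbrev model : Model (ZMod (2 ^ I.n + 1)) :=
  I.model hS.tree (I.low p r) (ZMod (2 ^ I.n + 1))

theorem topN_lt {c : ℕ} (hc : c < I.N) : I.topN T c < I.N := (hS.model.top_spec hc).1

theorem residue_lt {v : ℕ} (h : v ≤ 2 ^ I.n) : v < 2 ^ cx.β := hS.input.le_pow h (by omega)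

variable {s : Work (ZMod (2 ^ I.n + 1))}
  (hA : Sim I (2 ^ I.low p r) (2 ^ (I.bits - I.low p r)) A s)
include hA

theorem cast_msgUN {y : ℕ} (hy : y < I.N) (h : ℕ) :
    (I.msgUN T (2 ^ I.low p r) A y h : ZMod (2 ^ I.n + 1)) = hS.model.msgU s y h := by
  rw [Inst.msgUN, Nat.cast_sum]
  refine Finset.sum_congr rfl fun h' hh' => ?_
  rw [Nat.cast_mul, hA.U y h' hy (Finset.mem_range.1 hh'), hA.stateN_eq, hA.stateN_eq]
  rfl

theorem cast_combN {c h : ℕ} (hh : h < 2 ^ I.low p r) :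
    (I.combN T (2 ^ I.low p r) A c h : ZMod (2 ^ I.n + 1)) = hS.model.comb s c h := by
  rw [Inst.combN, Nat.cast_mul, hA.stateN_eq, Nat.cast_prod]
  unfold Model.comb Model.ch
  rw [Finset.prod_filter]
  refine congrArg _ (Finset.prod_congr rfl fun y hy => ?_)
  have hy := Finset.mem_range.1 hy
  change _ = if parN T y = c then (if I.rk T c < I.rk T y then _ else _) else _
  split
  · split
    · exact hS.cast_msgUN hA hy h
    · exact hA.MSG y h hy hh
  · exact Nat.cast_one

theorem fillU_spec : Tri cx w (CTm.fill p r 0 (Tm.newU p r)) A fun B =>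
    Sim I (2 ^ I.low p r) (2 ^ (I.bits - I.low p r)) B { s with
      U := fun c h => if c < I.N ∧ h < 2 ^ I.low p r ∧ I.rk T c = s.lev
        then hS.model.comb s c h else s.U c h } := by
  set H := 2 ^ I.low p r with hH
  let f : ℕ → ℕ → ℕ := fun c h => if I.rk T c = s.lev then I.combN T H A c h % (2 ^ I.n + 1)
    else A 0 (c * H + h)
  have hf : ∀ c h, f c h ≤ 2 ^ I.n := by
    intro c h
    dsimp only [f]
    split
    · exact Nat.lt_succ_iff.1 (Nat.mod_lt _ (Nat.succ_pos _))
    · exact hA.tidy 0 (by omega) _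
  refine hS.fill_spec (f := f) (fun c h _ _ => hS.residue_lt (hf c h))
    (fun w' hw i a d c h hc hh hi ha hd => ?_) ?_
  · have h4 : filled A 0 (c * H + h) H f 4 = A 4 := filled_ne (by omega)
    refine ((hS.input.rank_spec hS.tree (ha _)).eq (hA.lev_spec h4)).cond hS.input.T_one
      (fun hr => ?_) (fun _ => (Has.arr 0 (hi _)).congr (filled_of_le le_rfl)) (fun hr => ?_)
      (fun _ => hS.residue_lt (hA.tidy 0 (by omega) _))
    · refine ((hS.comb_spec (hA.tidy.filled hf) (ha _) (hd _) hc).congr ?_).mod hS.modulus_spec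
      refine Inst.combN_congr (filled_ne (by omega)) (filled_ne (by omega)) fun y h' hy hh' => ?_
      rcases Nat.lt_or_ge (y * H + h') (c * H + h) with hlt | hge
      · rw [filled_of_lt hh' hlt]
        exact if_neg (by have : I.rk T c = s.lev := hr; omega)
      · exact filled_of_le hge
    · exact hS.residue_lt (Nat.lt_succ_iff.1 (Nat.mod_lt _ (Nat.succ_pos _)))
  · have hne : ∀ j, j ≠ 0 → filled A 0 (I.N * H) H f j = A j := fun j hj => filled_ne hj
    refine ⟨by rw [hne 4 (by omega)]; exact hA.lev, hA.lev_le,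
      by rw [hne 3 (by omega)]; exact hA.dig, hA.dig_le, hA.tidy.filled hf, fun c h hc hh => ?_,
      by rw [hne 1 (by omega)]; exact hA.MSG, by rw [hne 2 (by omega)]; exact hA.ACC⟩
    rw [filled_of_lt hh (pair_lt hc hh)]
    dsimp only [f]
    by_cases hr : I.rk T c = s.lev
    · rw [if_pos hr, if_pos ⟨hc, hh, hr⟩, ← hS.cast_combN hA hh]
      have := ZMod.natCast_mod (I.combN T H A c h) (2 ^ I.n + 1)
      exact this
    · rw [if_neg hr, if_neg fun h => hr h.2.2]
      exact hA.U c h hc hh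

theorem fillACC_spec : Tri cx w (CTm.fill p r 2 (Tm.newACC p r)) A fun B =>
    Sim I (2 ^ I.low p r) (2 ^ (I.bits - I.low p r)) B { s with
      ACC := fun c h => if c < I.N ∧ h < 2 ^ I.low p r ∧ I.rk T c = s.lev
        then s.ACC c h + (if I.topN T c = c then hS.model.msgU s c h else s.MSG (I.topN T c) h)
        else s.ACC c h } := by
  set H := 2 ^ I.low p r with hH
  let g : ℕ → ℕ → ℕ := fun c h => if I.topN T c = c then I.msgUN T H A c h
    else A 1 (I.topN T c * H + h)
  let f : ℕ → ℕ → ℕ := fun c h => if I.rk T c = s.lev then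
    (A 2 (c * H + h) + g c h) % (2 ^ I.n + 1) else A 2 (c * H + h)
  have hf : ∀ c h, f c h ≤ 2 ^ I.n := by
    intro c h
    dsimp only [f]
    split
    · exact Nat.lt_succ_iff.1 (Nat.mod_lt _ (Nat.succ_pos _))
    · exact hA.tidy 2 (by omega) _
  refine hS.fill_spec (f := f) (fun c h _ _ => hS.residue_lt (hf c h))
    (fun w' hw i a d c h hc hh hi ha hd => ?_) ?_
  · have hne : ∀ j, j ≠ 2 → filled A 2 (c * H + h) H f j = A j := fun j hj => filled_ne hj
    have hi2 := (Has.arr 2 (hi (filled A 2 (c * H + h) H f))).congr (filled_of_le le_rfl)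
    refine ((hS.input.rank_spec hS.tree (ha _)).eq (hA.lev_spec (hne 4 (by omega)))).cond
      hS.input.T_one (fun hr => ?_) (fun _ => hi2) (fun hr => ?_)
      (fun _ => hS.residue_lt (hA.tidy 2 (by omega) _))
    · refine (hi2.add ?_).mod hS.modulus_spec
      have ht := hS.input.top_spec hS.tree (ha (filled A 2 (c * H + h) H f)) hc
      refine (ht.eq (ha _)).cond hS.input.T_one (fun _ => ?_) (fun _ => ?_)
        (fun _ => hS.pow_low_lt (Inst.msgUN_le hA.tidy _ _))
        (fun _ => hS.residue_lt (hA.tidy 1 (by omega) _))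
      · exact (hS.msgU_spec (hA.tidy.filled hf) (ha _) (hd _)).congr
          (Inst.msgUN_congr (hne 0 (by omega)) (hne 3 (by omega)))
      · exact (Has.arr 1 (hS.cell_spec ht (hd _))).congr (by rw [hne 1 (by omega)]; rfl)
    · exact hS.residue_lt (Nat.lt_succ_iff.1 (Nat.mod_lt _ (Nat.succ_pos _)))
  · have hne : ∀ j, j ≠ 2 → filled A 2 (I.N * H) H f j = A j := fun j hj => filled_ne hj
    refine ⟨by rw [hne 4 (by omega)]; exact hA.lev, hA.lev_le,
      by rw [hne 3 (by omega)]; exact hA.dig, hA.dig_le, hA.tidy.filled hf,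
      by rw [hne 0 (by omega)]; exact hA.U, by rw [hne 1 (by omega)]; exact hA.MSG,
      fun c h hc hh => ?_⟩
    rw [filled_of_lt hh (pair_lt hc hh)]
    dsimp only [f]
    by_cases hr : I.rk T c = s.lev
    · rw [if_pos hr, if_pos ⟨hc, hh, hr⟩]
      have := ZMod.natCast_mod (A 2 (c * H + h) + g c h) (2 ^ I.n + 1)
      refine this.trans ?_
      rw [Nat.cast_add, hA.ACC c h hc hh]
      refine congrArg _ ?_
      dsimp only [g]
      split
      · exact hS.cast_msgUN hA hc h
      · exact hA.MSG _ _ (hS.topN_lt hc) hh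
    · rw [if_neg hr, if_neg fun h => hr h.2.2]
      exact hA.ACC c h hc hh

theorem fillMSG_spec : Tri cx w (CTm.fill p r 1 (Tm.newMSG p r)) A fun B =>
    Sim I (2 ^ I.low p r) (2 ^ (I.bits - I.low p r)) B { s with
      MSG := fun t h => if t < I.N ∧ h < 2 ^ I.low p r then iterN I.N (s.MSG t h) fun c a =>
        if I.rk T c = s.lev ∧ I.topN T c = t then s.ACC c h else a else s.MSG t h } := by
  set H := 2 ^ I.low p r with hH
  let g : ℕ → ℕ → ℕ → ℕ := fun t h k => iterN k (A 1 (t * H + h)) fun c a =>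
    if I.rk T c = s.lev ∧ I.topN T c = t then A 2 (c * H + h) else a
  have hg : ∀ t h k, g t h k ≤ 2 ^ I.n := by
    intro t h k
    dsimp only [g]
    induction k with
    | zero => exact hA.tidy 1 (by omega) _
    | succ k ih =>
      rw [iterN_succ]
      split
      · exact hA.tidy 2 (by omega) _
      · exact ih
  let f : ℕ → ℕ → ℕ := fun t h => g t h I.N
  have hf : ∀ c h, f c h ≤ 2 ^ I.n := fun c h => hg c h _
  refine hS.fill_spec (f := f) (fun c h _ _ => hS.residue_lt (hf c h))
    (fun w' hw i a d c h hc hh hi ha hd => ?_) ?_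
  · have hne : ∀ j, j ≠ 1 → filled A 1 (c * H + h) H f j = A j := fun j hj => filled_ne hj
    refine Has.iter hS.input.N_spec ((Has.arr 1 (hi _)).congr (filled_of_le le_rfl))
      hS.input.T_N (fun k _ => hS.residue_lt (hg c h k)) fun w₂ hw₂ j z k hk hj hz => ?_
    refine Has.cond (Has.and ((hS.input.rank_spec hS.tree (hj _)).eq (hA.lev_spec (hne 4 (by omega))))
      ((hS.input.top_spec hS.tree (hj _) hk).eq ((ha _).mono hw₂))) hS.input.T_one (fun _ => ?_)
      (fun _ => hz _) (fun _ => hS.residue_lt (hA.tidy 2 (by omega) _))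
      (fun _ => hS.residue_lt (hg c h k))
    exact (Has.arr 2 (hS.cell_spec (hj _) ((hd _).mono hw₂))).congr (by rw [hne 2 (by omega)])
  · have hne : ∀ j, j ≠ 1 → filled A 1 (I.N * H) H f j = A j := fun j hj => filled_ne hj
    refine ⟨by rw [hne 4 (by omega)]; exact hA.lev, hA.lev_le,
      by rw [hne 3 (by omega)]; exact hA.dig, hA.dig_le, hA.tidy.filled hf,
      by rw [hne 0 (by omega)]; exact hA.U, fun c h hc hh => ?_,
      by rw [hne 2 (by omega)]; exact hA.ACC⟩
    rw [filled_of_lt hh (pair_lt hc hh)]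
    dsimp only [f, g]
    rw [if_pos ⟨hc, hh⟩]
    have key : ∀ k, k ≤ I.N → ((iterN k (A 1 (c * H + h)) fun c' a =>
        if I.rk T c' = s.lev ∧ I.topN T c' = c then A 2 (c' * H + h) else a : ℕ) :
          ZMod (2 ^ I.n + 1)) = iterN k (s.MSG c h) fun c' a =>
        if I.rk T c' = s.lev ∧ I.topN T c' = c then s.ACC c' h else a := by
      intro k
      induction k with
      | zero => exact fun _ => hA.MSG c h hc hh
      | succ k ih =>
        intro hk
        rw [iterN_succ, iterN_succ]
        split
        · exact hA.ACC k h (by omega) hh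
        · exact ih (by omega)
    exact key _ le_rfl

theorem clearACC_spec : Tri cx w (CTm.fill p r 2 fun i a _ => Tm.clearACC i a) A fun B =>
    Sim I (2 ^ I.low p r) (2 ^ (I.bits - I.low p r)) B { s with
      ACC := fun c h => if c < I.N ∧ h < 2 ^ I.low p r ∧ I.rk T c = s.lev
        then 0 else s.ACC c h } := by
  set H := 2 ^ I.low p r with hH
  let f : ℕ → ℕ → ℕ := fun c h => if I.rk T c = s.lev then 0 else A 2 (c * H + h)
  have hf : ∀ c h, f c h ≤ 2 ^ I.n := by
    intro c h
    dsimp only [f]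
    split
    · exact Nat.zero_le _
    · exact hA.tidy 2 (by omega) _
  refine hS.fill_spec (f := f) (fun c h _ _ => hS.residue_lt (hf c h))
    (fun w' hw i a d c h hc hh hi ha hd => ?_) ?_
  · exact ((hS.input.rank_spec hS.tree (ha _)).eq (hA.lev_spec (filled_ne (by omega)))).cond
      hS.input.T_one (fun _ => .c 0) (fun _ => (Has.arr 2 (hi _)).congr (filled_of_le le_rfl))
      (fun _ => Nat.two_pow_pos _) (fun _ => hS.residue_lt (hA.tidy 2 (by omega) _))
  · have hne : ∀ j, j ≠ 2 → filled A 2 (I.N * H) H f j = A j := fun j hj => filled_ne hj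
    refine ⟨by rw [hne 4 (by omega)]; exact hA.lev, hA.lev_le,
      by rw [hne 3 (by omega)]; exact hA.dig, hA.dig_le, hA.tidy.filled hf,
      by rw [hne 0 (by omega)]; exact hA.U, by rw [hne 1 (by omega)]; exact hA.MSG,
      fun c h hc hh => ?_⟩
    rw [filled_of_lt hh (pair_lt hc hh)]
    dsimp only [f]
    by_cases hr : I.rk T c = s.lev
    · rw [if_pos hr, if_pos ⟨hc, hh, hr⟩, Nat.cast_zero]
    · rw [if_neg hr, if_neg fun h => hr h.2.2]
      exact hA.ACC c h hc hh

/-- Setting the current digit and then the level. -/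
theorem setDig_setLev_spec {e e' : Tm} {v l : ℕ}
    (he : Has cx A w e v) (he' : ∀ B, B 4 = A 4 → Has cx B w e' l)
    (hv : v ≤ 2 * 2 ^ (I.bits - I.low p r)) (hl : l ≤ levels I.N) :
    Tri cx w (CTm.seq (CTm.setDig e) (CTm.setLev e')) A fun B =>
      Sim I (2 ^ I.low p r) (2 ^ (I.bits - I.low p r)) B
        { s with dig := upd s.dig s.lev v, lev := l } := by
  have hT := hS.input.T
  have hX := hS.X
  have hN := levels_le I.N
  have hlev := hA.lev_le
  have hbits := hS.valid.bits_le
  have hlt : v < 2 ^ cx.β := by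
    refine hS.input.le_pow (k := I.bits - I.low p r + 1) (hv.trans ?_) (by omega)
    rw [pow_succ, mul_comm]
  refine Tri.seq (R := fun B => B = updArr A 3 s.lev v) (Tri.store (hA.lev_spec rfl) he
    (by omega) hlt rfl) fun B hB => ?_
  refine Tri.store (.c 0) (he' B (by subst hB; exact updArr_ne _ _ _ _ (by omega))) (by omega)
    (hS.input.smaller (by omega)) ?_
  subst hB
  have hne : ∀ j, j < 3 → updArr (updArr A 3 s.lev v) 4 0 l j = A j := fun j hj => by
    rw [updArr_ne _ _ _ _ (by omega), updArr_ne _ _ _ _ (by omega)]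
  refine ⟨by simp, hl, fun i => ?_, fun i => ?_, fun j hj i => ?_, ?_, ?_, ?_⟩
  · rw [updArr_ne _ _ _ _ (by omega), updArr_same]
    show _ = upd s.dig s.lev v i
    rw [upd_apply, hA.dig]
  · show upd s.dig s.lev v i ≤ _
    rw [upd_apply]
    split
    · exact hv
    · exact hA.dig_le i
  · rw [hne j hj]
    exact hA.tidy j hj i
  · rw [hne 0 (by omega)]
    exact hA.U
  · rw [hne 1 (by omega)]
    exact hA.MSG
  · rw [hne 2 (by omega)]
    exact hA.ACC

/-- The order of the assignments matters: messages are taken from the accumulators before these are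
cleared, and the level is written last, because it selects the nodes to be changed and the digit. -/
theorem step_spec : Tri cx w (CTm.step p r) A fun B =>
    Sim I (2 ^ I.low p r) (2 ^ (I.bits - I.low p r)) B (hS.model.step s) := by
  have hT := hS.input.T
  have hX := hS.X
  have hN := levels_le I.N
  have hlev := hA.lev_le
  unfold Model.step
  refine Tri.ite ((hA.lev_spec rfl).lt hS.input.levels_spec) (fun h1 => ?_) (fun h1 => ?_)
  · rw [if_pos (show s.lev < hS.model.L from h1)]
    refine Tri.ite ((hA.dig_spec rfl rfl).lt ((Has.c 2).mul hS.G_spec)) (fun h2 => ?_) (fun h2 => ?_)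
    · rw [if_pos (show s.dig s.lev < 2 * hS.model.G from h2)]
      refine Tri.ite (((hA.dig_spec rfl rfl).mod (.c 2)).eq (.c 0)) (fun h3 => ?_) (fun h3 => ?_)
      · rw [if_pos h3]
        refine Tri.seq (hS.fillU_spec hA) fun B hB => ?_
        exact hS.setDig_setLev_spec hB ((hB.dig_spec rfl rfl).add (.c 1)) (fun _ _ => .c 0) h2
          (Nat.zero_le _)
      · rw [if_neg h3]
        refine Tri.seq (hS.fillACC_spec hA) fun B hB => ?_
        exact hS.setDig_setLev_spec hB ((hB.dig_spec rfl rfl).add (.c 1)) (fun _ _ => .c 0) h2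
          (Nat.zero_le _)
    · rw [if_neg (show ¬ s.dig s.lev < 2 * hS.model.G from h2)]
      refine Tri.seq (hS.fillMSG_spec hA) fun B hB => ?_
      refine Tri.seq (hS.clearACC_spec hB) fun C hC => ?_
      exact hS.setDig_setLev_spec hC (.c 0) (fun D hD => (hC.lev_spec hD).add (.c 1))
        (Nat.zero_le _) h1
  · rw [if_neg (show ¬ s.lev < hS.model.L from h1)]
    refine Tri.store (.c 0) (hA.lev_spec rfl) (by omega) (hS.input.smaller (by omega)) ?_
    have : updArr A 4 0 s.lev = A := by
      funext j i
      rw [updArr_apply]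
      split
      · rename_i h
        rw [h.1, h.2, hA.lev]
      · rfl
    rw [this]
    exact hA

end Setup

end SatTW

namespace SatTW

/-! ### Correctness of the evaluation -/

theorem Model.events_eq {R : Type} [CommRing R] (M : Model R) (r : ℕ) :
    M.events r = iterN r 0 fun _ z => (2 * M.G + 1) * (z + 1) := by
  induction r with
  | zero => rfl
  | succ r ih => rw [Model.events, ih, iterN_succ]

/-- With `E` events below a rank, `(2 G + 1) (E + 1) + 1 ≤ 4 G (E + 1)`. The factor `4` per rank is
harmless: over `log N + 1` ranks it amounts to `4 N ^ 2`. -/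
theorem Model.events_lt {R : Type} [CommRing R] (M : Model R) (hG : 0 < M.G) (r : ℕ) :
    M.events r + 1 ≤ (4 * M.G) ^ r := by
  induction r with
  | zero => simp [Model.events]
  | succ r ih =>
    rw [Model.events, pow_succ]
    have h1 : (2 * M.G + 1) * (M.events r + 1) + 1 ≤ (4 * M.G) * (M.events r + 1) := by
      have : 1 ≤ M.events r + 1 := by omega
      nlinarith
    refine h1.trans ?_
    rw [mul_comm]
    exact Nat.mul_le_mul_right _ ih

/-- The initial working state. -/
def Work.init (R : Type) [CommRing R] : Work R := ⟨0, fun _ => 0, fun _ _ => 0, fun _ _ => 0, fun _ _ => 0⟩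

/-- `block` with `r = L`: no node has rank `L` or more, so no guess is fixed, no table is
presupposed, and the message of the root is the unrestricted sum. -/
theorem Model.eval_root {R : Type} [CommRing R] (M : Model R) {ρ : ℕ} (hρ : ρ < M.N)
    (hpar : M.par ρ = M.N) (hreach : ∀ d, d < M.N → ∃ k, M.par^[k] d = ρ) :
    (M.step^[M.events M.L] (Work.init R)).MSG ρ 0 = ∑ X : Fin M.N → Fin (M.G * M.H),
      ∏ d ∈ Finset.range M.N, M.φ d (ext X d) * M.ψ d (ext X d) (ext X (M.par d)) := by
  have hb := M.block M.L le_rfl (Work.init R) ⟨rfl, fun _ _ => rfl, fun _ _ _ _ _ => rfl⟩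
  rw [hb.MSG ρ hρ (M.rk_lt ρ hρ) (by rw [hpar, M.rk_N]) (fun b hv => by
    have := M.rk_lt b hv.1
    have := hv.2.1
    omega) 0 M.H_pos, ← M.total_eq_sum hρ hpar hreach]
  have h0 : guess (Work.init R) (M.rk (M.par ρ)) * M.H + 0 = 0 := by simp [guess, Work.init]
  rw [h0]
  refine Finset.sum_congr rfl fun x hx => ?_
  congr 1
  refine M.dp_congr ρ hρ (fun d k hd _ z _ => ?_) x (Finset.mem_range.1 hx)
  rw [fixW, if_neg]
  rintro ⟨⟨h, -⟩, -⟩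
  have := M.rk_lt d hd
  omega

theorem Sim.init {I : Inst} {H G : ℕ} :
    Sim I H G (fun _ _ => 0) (Work.init (ZMod (2 ^ I.n + 1))) :=
  ⟨rfl, Nat.zero_le _, fun _ => rfl, fun _ => Nat.zero_le _, fun _ _ _ => Nat.zero_le _,
    fun _ _ _ _ => Nat.cast_zero, fun _ _ _ _ => Nat.cast_zero, fun _ _ _ _ => Nat.cast_zero⟩

namespace Setup

variable {cx : Ctx} {I : Inst} {T : SimpleGraph (Fin I.N)} {p r : ℕ} (hS : Setup cx I T p r)
  {A : ℕ → ℕ → ℕ} {w : World}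
include hS

theorem events_le (k : ℕ) (hk : k ≤ I.N) : hS.model.events k + 1 ≤ 2 ^ ((I.n + I.m + 3) * I.N) := by
  refine (hS.model.events_lt (Nat.two_pow_pos _) k).trans ?_
  have h1 : 4 * hS.model.G ≤ 2 ^ (I.n + I.m + 3) := by
    show 4 * 2 ^ (I.bits - I.low p r) ≤ _
    rw [show 4 = 2 ^ 2 from rfl, ← pow_add]
    refine Nat.pow_le_pow_right (by norm_num) ?_
    have := hS.valid.bits_le
    omega
  rw [pow_mul]
  exact (Nat.pow_le_pow_left h1 k).trans (Nat.pow_le_pow_right (Nat.two_pow_pos _) hk)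

theorem events_lt (k : ℕ) (hk : k ≤ I.N) : hS.model.events k < 2 ^ cx.β := by
  refine hS.input.lt_two_pow (k := (I.n + I.m + 3) * I.N)
    ((Nat.le_succ _).trans (hS.events_le k hk)) ?_
  have : (I.n + I.m + 3) * I.N ≤ (I.n + I.m + I.N + 3) * (I.n + I.m + I.N + 3) :=
    Nat.mul_le_mul (by omega) (by omega)
  rw [← sq] at this
  have : 0 < (I.n + I.m + I.N + 3) ^ 2 := by positivity
  omega

theorem events_spec : Has cx A w (Tm.events p r) (hS.model.events (levels I.N)) := by
  rw [Model.events_eq]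
  refine Has.iter hS.input.levels_spec (.c 0) ((levels_le I.N).trans hS.input.T_N) (fun k hk => ?_)
    fun w' hw i z k hk hi hz => (((Has.c 2).mul hS.G_spec).add (.c 1)).mul ((hz A).add (.c 1))
  rw [← Model.events_eq]
  exact hS.events_lt k (hk.trans (levels_le I.N))

/-- At the end the message from the root tells whether the formula is satisfiable. -/
theorem answer {A : ℕ → ℕ → ℕ} (hN : 0 < I.N)
    (hA : Sim I (2 ^ I.low p r) (2 ^ (I.bits - I.low p r)) A
      (hS.model.step^[hS.model.events (levels I.N)] (Work.init (ZMod (2 ^ I.n + 1))))) :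
    A 1 0 ≠ 0 ↔ ∃ B : Fin I.n → Bool, ∀ c : Fin I.m, ∃ x : Fin I.n, I.lit c x (B x).toNat = 1 := by
  have h1 := hA.MSG 0 0 hN (Nat.two_pow_pos _)
  have hpar : hS.model.par 0 = hS.model.N := parN_zero T
  have hsum : (hS.model.step^[hS.model.events (levels I.N)] (Work.init _)).MSG 0 0 = _ :=
    hS.model.eval_root hN hpar fun d hd => parN_reach hS.tree _ d hd le_rfl
  have hG : hS.model.G * hS.model.H = 2 ^ I.bits := by
    show 2 ^ _ * 2 ^ _ = _
    rw [← pow_add]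
    congr 1
    have := I.low_lt hS.le
    omega
  have hR : (2 ^ I.n : ZMod (2 ^ I.n + 1)) = -1 := by
    have := ZMod.natCast_self (2 ^ I.n + 1)
    push_cast at this
    exact eq_neg_of_add_eq_zero_left this
  have hcount := hS.valid.sum_states hR (K := hS.model.G * hS.model.H)
    (fun t ht => by rw [hG]; exact hS.valid.place_le_bits ht)
  rw [hS.par] at hcount
  rw [zero_mul, zero_add, hsum] at h1
  have h2 := h1.trans hcount
  set S := Finset.univ.filter fun A : Fin I.n → Bool =>
    ∀ c : Fin I.m, ∃ x : Fin I.n, I.lit c x (A x).toNat = 1 with hSdef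
  -- Both the count and the table entry are at most `2 ^ n`, so congruence modulo `2 ^ n + 1` is
  -- equality.
  have hcard : S.card ≤ 2 ^ I.n := by
    refine (Finset.card_le_univ _).trans ?_
    simp
  rw [ZMod.natCast_eq_natCast_iff', Nat.mod_eq_of_lt (Nat.lt_succ_of_le (hA.tidy 1 (by omega) 0)),
    Nat.mod_eq_of_lt (Nat.lt_succ_of_le hcard)] at h2
  rw [h2, Finset.card_ne_zero]
  constructor
  · rintro ⟨B, hB⟩
    exact ⟨B, (Finset.mem_filter.1 hB).2⟩
  · rintro ⟨B, hB⟩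
    exact ⟨B, Finset.mem_filter.2 ⟨Finset.mem_univ _, hB⟩⟩

end Setup

end SatTW

namespace SatTW

/-! ### The input -/

theorem bit_le (p : Prop) : bit p ≤ 1 := by
  unfold bit
  split <;> omega

theorem bit_eq_one {p : Prop} : bit p = 1 ↔ p := by
  unfold bit
  split <;> simp_all

theorem length_table {a b : ℕ} (r : Fin a → Fin b → Prop) : (table r).length = a * b := by
  simp [table]

theorem getD_table {a b : ℕ} (r : Fin a → Fin b → Prop) (i : Fin a) (j : Fin b) :
    (table r).getD (i * b + j) 0 = bit (r i j) := by
  have hlt : (i : ℕ) * b + j < a * b := pair_lt i.2 j.2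
  have he : finProdFinEquiv.symm (⟨i * b + j, hlt⟩ : Fin (a * b)) = (i, j) := by
    rw [Equiv.symm_apply_eq]
    ext
    simp [finProdFinEquiv]
    ring
  rw [List.getD_eq_getElem _ _ (by rw [length_table]; exact hlt)]
  simp only [table, List.getElem_ofFn]
  rw [he]

theorem getD_append_add (l l' : List ℕ) (k i : ℕ) (h : l.length = k) :
    (l ++ l').getD (k + i) 0 = l'.getD i 0 := by
  subst h
  rw [List.getD_append_right _ _ _ _ (by omega), Nat.add_sub_cancel_left]

section

variable (φ : CNF) {N : ℕ} (D : TreeDecomposition φ.incidenceGraph N)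

/-- The vertex of the incidence graph with the number `v`. -/
def CNF.vertex (v : ℕ) (h : v < φ.n + φ.m) : Fin φ.n ⊕ Fin φ.m := finSumFinEquiv.symm ⟨v, h⟩

theorem CNF.vertex_var {x : ℕ} (h : x < φ.n) : φ.vertex x (by omega) = Sum.inl ⟨x, h⟩ := by
  rw [CNF.vertex, Equiv.symm_apply_eq]
  rfl

theorem CNF.vertex_clause {c : ℕ} (h : c < φ.m) :
    φ.vertex (φ.n + c) (by omega) = Sum.inr ⟨c, h⟩ := by
  rw [CNF.vertex, Equiv.symm_apply_eq]
  rfl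

noncomputable def CNF.litTable (b : Bool) (c x : ℕ) : ℕ :=
  if h : c < φ.m ∧ x < φ.n then bit ((⟨x, h.2⟩, b) ∈ φ.clause ⟨c, h.1⟩) else 0

theorem CNF.litTable_le (b : Bool) (c x : ℕ) : φ.litTable b c x ≤ 1 := by
  unfold CNF.litTable
  split
  · exact bit_le _
  · omega

variable {φ}

noncomputable def TreeDecomposition.bagTable (t v : ℕ) : ℕ :=
  if h : t < N ∧ v < φ.n + φ.m then bit (φ.vertex v h.2 ∈ D.bag ⟨t, h.1⟩) else 0

theorem TreeDecomposition.bagTable_le (t v : ℕ) : D.bagTable t v ≤ 1 := by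
  unfold TreeDecomposition.bagTable
  split
  · exact bit_le _
  · omega

theorem TreeDecomposition.bagTable_eq_one {t v : ℕ} (ht : t < N) (hv : v < φ.n + φ.m) :
    D.bagTable t v = 1 ↔ φ.vertex v hv ∈ D.bag ⟨t, ht⟩ := by
  rw [TreeDecomposition.bagTable, dif_pos ⟨ht, hv⟩, bit_eq_one]

theorem TreeDecomposition.sum_bagTable (t : Fin N) :
    ∑ v ∈ Finset.range (φ.n + φ.m), D.bagTable t v = (D.bag t).card := by
  classical
  rw [Finset.sum_range]
  have h1 : ∀ v : Fin (φ.n + φ.m), D.bagTable t v =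
      if finSumFinEquiv.symm v ∈ D.bag t then 1 else 0 := by
    intro v
    rw [TreeDecomposition.bagTable, dif_pos ⟨t.2, v.2⟩]
    unfold bit CNF.vertex
    congr
  rw [Finset.sum_congr rfl fun v _ => h1 v,
    Equiv.sum_comp finSumFinEquiv.symm fun V => if V ∈ D.bag t then 1 else 0]
  simp

noncomputable def TreeDecomposition.inst : Inst where
  n := φ.n
  m := φ.m
  N := N
  pos := φ.litTable true
  neg := φ.litTable false
  bag := D.bagTable
  par := parN D.tree

theorem TreeDecomposition.valid : D.inst.Valid where
  pos_le := φ.litTable_le true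
  neg_le := φ.litTable_le false
  bag_le := D.bagTable_le
  bag_N v := by
    show D.bagTable N v = 0
    rw [TreeDecomposition.bagTable, dif_neg (by omega)]
  par_le t ht := parN_le D.isTree t
  cover v hv := by
    obtain ⟨t, ht⟩ := D.cover (φ.vertex v hv)
    exact ⟨t, t.2, (D.bagTable_eq_one t.2 hv).2 ht⟩
  edge c x hc hx h := by
    have hc' : c < φ.m := hc
    have hx' : x < φ.n := hx
    have hadj : φ.incidenceGraph.Adj (Sum.inl ⟨x, hx'⟩) (Sum.inr ⟨c, hc'⟩) := by
      rw [CNF.incidenceGraph, SimpleGraph.fromRel_adj]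
      refine ⟨by simp, Or.inl ?_⟩
      change φ.litTable true c x = 1 ∨ φ.litTable false c x = 1 at h
      rw [CNF.litTable, CNF.litTable, dif_pos ⟨hc', hx'⟩, dif_pos ⟨hc', hx'⟩, bit_eq_one,
        bit_eq_one] at h
      rcases h with h | h
      · exact ⟨_, _, true, rfl, rfl, h⟩
      · exact ⟨_, _, false, rfl, rfl, h⟩
    obtain ⟨t, h1, h2⟩ := D.edge _ _ hadj
    refine ⟨t, t.2, (D.bagTable_eq_one t.2 (by omega)).2 ?_,
      (D.bagTable_eq_one (v := φ.n + c) t.2 (by omega)).2 ?_⟩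
    · rw [φ.vertex_var hx']; exact h1
    · rw [φ.vertex_clause hc']; exact h2
  conn v hv g hg t t' ht ht' h h' := by
    have hv' : v < φ.n + φ.m := hv
    refine conn_of_induce D.isTree (D.subtree (φ.vertex v hv')) g (fun u hu hp h1 h2 =>
      hg u hu hp ((D.bagTable_eq_one hu hv').2 h1) ((D.bagTable_eq_one hp hv').2 h2))
      ⟨t, ht⟩ ⟨t', ht'⟩ ((D.bagTable_eq_one ht hv').1 h) ((D.bagTable_eq_one ht' hv').1 h')

/-- `bits` is the maximum of `1` and the largest bag size; the truncated subtraction makes both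
sides `0` if all bags are empty. -/
theorem TreeDecomposition.bits_sub_one : D.inst.bits - 1 = D.width := by
  have h := Inst.iterN_max (fun t => ∑ v ∈ Finset.range (φ.n + φ.m), D.bagTable t v) N
  set b := iterN N 1 fun t z => max z (∑ v ∈ Finset.range (φ.n + φ.m), D.bagTable t v) with hb
  have hbits : D.inst.bits = b := rfl
  have h1 : (Finset.univ.sup fun t => (D.bag t).card) ≤ b := Finset.sup_le fun t _ => by
    rw [← D.sum_bagTable]
    exact h.2.1 t t.2
  have h2 : b ≤ max 1 (Finset.univ.sup fun t => (D.bag t).card) := by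
    refine h.2.2 _ (le_max_left _ _) fun t ht => ?_
    have := D.sum_bagTable ⟨t, ht⟩
    dsimp only at this
    rw [this]
    exact (Finset.le_sup (f := fun t => (D.bag t).card) (Finset.mem_univ _)).trans (le_max_right _ _)
  have h3 := h.1
  rw [hbits, TreeDecomposition.width]
  omega

theorem TreeDecomposition.satisfiable_iff : φ.Satisfiable ↔
    ∃ A : Fin D.inst.n → Bool, ∀ c : Fin D.inst.m, ∃ x : Fin D.inst.n,
      D.inst.lit c x (A x).toNat = 1 := by
  refine exists_congr fun A => forall_congr' fun c => ?_
  have hlit : ∀ x : Fin φ.n, D.inst.lit c x (A x).toNat = 1 ↔ (x, A x) ∈ φ.clause c := by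
    intro x
    have hb : ∀ b : Bool, φ.litTable b c x = 1 ↔ (x, b) ∈ φ.clause c := fun b => by
      rw [CNF.litTable, dif_pos ⟨c.2, x.2⟩, bit_eq_one]
    rw [← hb]
    show (A x).toNat * φ.litTable true c x + (1 - (A x).toNat) * φ.litTable false c x = 1 ↔ _
    cases A x <;> simp
  constructor
  · rintro ⟨l, hl, h⟩
    refine ⟨l.1, (hlit l.1).2 ?_⟩
    rw [h]
    exact hl
  · rintro ⟨x, hx⟩
    exact ⟨(x, A x), (hlit x).1 hx, rfl⟩

theorem initial_mem (a : ℕ) : (initial φ D).mem a = (encode φ D).getD a 0 := by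
  simp [initial, List.toFinsupp_apply]

theorem length_encode : (encode φ D).length =
    3 + φ.m * φ.n + φ.m * φ.n + N * N + N * φ.n + N * φ.m := by
  simp [encode, length_table]
  ring

theorem TreeDecomposition.input {cx : Ctx} (hT : φ.n + φ.m + N + 3 ≤ cx.T)
    (hβ : 8 * (φ.n + φ.m + N + 3) ^ 2 ≤ cx.β) (hlen : cx.len = (encode φ D).length)
    (hI : cx.I = fun a => (encode φ D).getD a 0) :
    Input cx D.inst.n D.inst.m D.inst.N D.inst.pos D.inst.neg (adjN D.tree) D.inst.bag where
  T := hT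
  β := hβ
  len := by rw [hlen, length_encode]; rfl
  I_n := by rw [hI]; rfl
  I_m := by rw [hI]; rfl
  I_N := by rw [hI]; rfl
  I_pos c x hc hx := by
    have hc : c < φ.m := hc
    have hx : x < φ.n := hx
    rw [hI]
    dsimp only
    simp only [encode, List.append_assoc]
    rw [getD_append_add _ _ 3 _ rfl, List.getD_append _ _ _ _ (by
      rw [length_table]; exact pair_lt hc hx)]
    have := getD_table (fun c x => (x, true) ∈ φ.clause c) ⟨c, hc⟩ ⟨x, hx⟩
    refine this.trans ?_
    show _ = φ.litTable true c x
    rw [CNF.litTable, dif_pos ⟨hc, hx⟩]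
  I_neg c x hc hx := by
    have hc : c < φ.m := hc
    have hx : x < φ.n := hx
    rw [hI]
    change (encode φ D).getD (3 + φ.m * φ.n + (c * φ.n + x)) 0 = _
    simp only [encode, List.append_assoc]
    rw [add_assoc, getD_append_add _ _ 3 _ rfl, getD_append_add _ _ (φ.m * φ.n) _
      (length_table _), List.getD_append _ _ _ _ (by
      rw [length_table]; exact pair_lt hc hx)]
    have := getD_table (fun c x => (x, false) ∈ φ.clause c) ⟨c, hc⟩ ⟨x, hx⟩
    refine this.trans ?_
    show _ = φ.litTable false c x
    rw [CNF.litTable, dif_pos ⟨hc, hx⟩]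
  I_adj t u ht hu := by
    have ht : t < N := ht
    have hu : u < N := hu
    rw [hI]
    change (encode φ D).getD (3 + φ.m * φ.n + φ.m * φ.n + (t * N + u)) 0 = _
    simp only [encode, List.append_assoc]
    rw [add_assoc, add_assoc, getD_append_add _ _ 3 _ rfl,
      getD_append_add _ _ (φ.m * φ.n) _ (length_table _),
      getD_append_add _ _ (φ.m * φ.n) _ (length_table _), List.getD_append _ _ _ _ (by
      rw [length_table]; exact pair_lt ht hu)]
    have := getD_table (fun t t' => D.tree.Adj t t') ⟨t, ht⟩ ⟨u, hu⟩
    refine this.trans ?_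
    rw [adjN, dif_pos ⟨ht, hu⟩]
  I_var t x ht hx := by
    have ht : t < N := ht
    have hx : x < φ.n := hx
    rw [hI]
    change (encode φ D).getD (3 + φ.m * φ.n + φ.m * φ.n + N * N + (t * φ.n + x)) 0 = _
    simp only [encode, List.append_assoc]
    rw [add_assoc, add_assoc, add_assoc, getD_append_add _ _ 3 _ rfl,
      getD_append_add _ _ (φ.m * φ.n) _ (length_table _),
      getD_append_add _ _ (φ.m * φ.n) _ (length_table _),
      getD_append_add _ _ (N * N) _ (length_table _), List.getD_append _ _ _ _ (by
      rw [length_table]; exact pair_lt ht hx)]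
    have := getD_table (fun (t : Fin N) (x : Fin φ.n) => Sum.inl x ∈ D.bag t) ⟨t, ht⟩ ⟨x, hx⟩
    refine this.trans ?_
    show _ = D.bagTable t x
    rw [TreeDecomposition.bagTable, dif_pos ⟨ht, by omega⟩, φ.vertex_var hx]
  I_clause t c ht hc := by
    have ht : t < N := ht
    have hc : c < φ.m := hc
    rw [hI]
    change (encode φ D).getD (3 + φ.m * φ.n + φ.m * φ.n + N * N + N * φ.n + (t * φ.m + c)) 0 = _
    simp only [encode, List.append_assoc]
    rw [add_assoc, add_assoc, add_assoc, add_assoc, getD_append_add _ _ 3 _ rfl,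
      getD_append_add _ _ (φ.m * φ.n) _ (length_table _),
      getD_append_add _ _ (φ.m * φ.n) _ (length_table _),
      getD_append_add _ _ (N * N) _ (length_table _),
      getD_append_add _ _ (N * φ.n) _ (length_table _)]
    have := getD_table (fun (t : Fin N) (c : Fin φ.m) => Sum.inr c ∈ D.bag t) ⟨t, ht⟩ ⟨c, hc⟩
    refine this.trans ?_
    show _ = D.bagTable t (φ.n + c)
    rw [TreeDecomposition.bagTable, dif_pos ⟨ht, by omega⟩, φ.vertex_clause hc]
  bag_le := D.bagTable_le
  bag_N t v ht := by
    show D.bagTable t v = 0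
    rw [TreeDecomposition.bagTable, dif_neg (by
      have : N ≤ t := ht
      omega)]

end

end SatTW

namespace SatTW

/-! ### The program respects the scopes of variables -/

/-- The expression can be used in scopes from `x` on, up to the distance `d` from the bound for
names. -/
def Wf (x d : ℕ) (e : Tm) : Prop := ∀ x', x ≤ x' → x' + d ≤ nameLimit → (e x').WF x'

def CWf (x d : ℕ) (e : CTm) : Prop := ∀ x', x ≤ x' → x' + d ≤ nameLimit → (e x').WF x'

namespace Wf

variable {x d : ℕ} {a b e t u v h k i p r : Tm}

theorem mono {x' d' : ℕ} (hd : d ≤ d') (he : Wf x d e) (hx : x ≤ x') : Wf x' d' e :=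
  fun y hy hl => he y (hx.trans hy) (by omega)

theorem up {d' : ℕ} (hd : d ≤ d') (he : Wf x d e) : Wf x d' e := mono hd he le_rfl

theorem c (k : ℕ) : Wf x d (Tm.c k) := fun _ _ _ => trivial

theorem op (o : Op) (ha : Wf x d a) (hb : Wf x d b) : Wf x d (Tm.op o a b) :=
  fun y hy hl => ⟨ha y hy hl, hb y hy hl⟩

theorem arr {j : ℕ} (hj : j < numArr) (ha : Wf x d a) : Wf x d (Tm.arr j a) :=
  fun y hy hl => ⟨hj, ha y hy hl⟩

theorem inp (ha : Wf x d a) : Wf x d (Tm.inp a) := ha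

/-- Each nested binder is allotted three names. The numbers in the lemmas below are therefore bounds
on nesting depth times three; the largest, `201` for a whole step, stays below `nameLimit`. -/
theorem iter {n : Tm} {b : Tm → Tm → Tm} (hn : Wf x d n) (ha : Wf x d a)
    (hb : ∀ x' i z, x ≤ x' → Wf x' 0 i → Wf x' 0 z → Wf x' d (b i z)) :
    Wf x (d + 3) (Tm.iter n a b) := fun y hy hl =>
  ⟨rfl, by omega, hn y hy (by omega), ha y hy (by omega),
    hb (y + 2) (fun _ => .var y) (fun _ => .var (y + 1)) (by omega) (fun z hz _ => show y < z by omega)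
      (fun z hz _ => show y + 1 < z by omega) (y + 2) le_rfl (by omega)⟩

theorem sum {n : Tm} {b : Tm → Tm} (hn : Wf x d n)
    (hb : ∀ x' i, x ≤ x' → Wf x' 0 i → Wf x' d (b i)) : Wf x (d + 3) (Tm.sum n b) :=
  iter hn (c 0) fun x' i _ hx hi hz => op .add (hz.up (Nat.zero_le _)) (hb x' i hx hi)

theorem prod {n : Tm} {b : Tm → Tm} (hn : Wf x d n)
    (hb : ∀ x' i, x ≤ x' → Wf x' 0 i → Wf x' d (b i)) : Wf x (d + 3) (Tm.prod n b) :=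
  iter hn (c 1) fun x' i _ hx hi hz => op .mul (hz.up (Nat.zero_le _)) (hb x' i hx hi)

theorem pow2 (ha : Wf x d a) : Wf x (d + 3) (Tm.pow2 a) := prod ha fun _ _ _ _ => c 2

theorem le (ha : Wf x d a) (hb : Wf x d b) : Wf x d (Tm.le a b) := op _ (c 1) (op _ ha hb)
theorem lt (ha : Wf x d a) (hb : Wf x d b) : Wf x d (Tm.lt a b) := le (op _ ha (c 1)) hb
theorem eq (ha : Wf x d a) (hb : Wf x d b) : Wf x d (Tm.eq a b) := op _ (le ha hb) (le hb ha)
theorem mod (ha : Wf x d a) (hb : Wf x d b) : Wf x d (Tm.mod a b) :=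
  op _ ha (op _ (op _ ha hb) hb)
theorem max (ha : Wf x d a) (hb : Wf x d b) : Wf x d (Tm.max a b) := op _ ha (op _ hb ha)

theorem cond (he : Wf x d e) (ha : Wf x d a) (hb : Wf x d b) : Wf x (d + 6) (Tm.cond e a b) :=
  iter (op _ (c 1) (he.up (by omega)))
    (iter he (c 0) fun _ _ _ hx _ _ => ha.mono le_rfl hx)
    fun _ _ _ hx _ _ => hb.mono (by omega) hx

theorem n : Wf x d Tm.n := inp (c 0)
theorem m : Wf x d Tm.m := inp (c 1)
theorem N : Wf x d Tm.N := inp (c 2)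
theorem S : Wf x d Tm.S := op _ n m
theorem off1 : Wf x d Tm.off1 := op _ (c 3) (op _ m n)
theorem off2 : Wf x d Tm.off2 := op _ off1 (op _ m n)
theorem off3 : Wf x d Tm.off3 := op _ off2 (op _ N N)
theorem off4 : Wf x d Tm.off4 := op _ off3 (op _ N n)
theorem inputLength : Wf x d Tm.inputLength := op _ off4 (op _ N m)
theorem pos (ha : Wf x d a) (hb : Wf x d b) : Wf x d (Tm.pos a b) :=
  inp (op _ (c 3) (op _ (op _ ha n) hb))
theorem neg (ha : Wf x d a) (hb : Wf x d b) : Wf x d (Tm.neg a b) :=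
  inp (op _ off1 (op _ (op _ ha n) hb))
theorem adj (ha : Wf x d a) (hb : Wf x d b) : Wf x d (Tm.adj a b) :=
  inp (op _ off2 (op _ (op _ ha N) hb))
theorem bag (ht : Wf x d t) (hv : Wf x d v) : Wf x (d + 12) (Tm.bag t v) :=
  cond ((lt ht N).up (by omega)) (cond (lt hv n) (inp (op _ off3 (op _ (op _ ht n) hv)))
    (inp (op _ off4 (op _ (op _ ht m) (op _ hv n))))) (c 0)
theorem bit (ha : Wf x d a) (ht : Wf x d t) : Wf x (d + 3) (Tm.bit a t) :=
  mod (op _ (ha.up (by omega)) (pow2 ht)) (c 2)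
theorem ball (hk : Wf x d k) : Wf x (d + 12) (Tm.ball k) :=
  (iter (d := d + 9) (hk.up (by omega)) (c 1) fun _ _ _ _ _ hz => sum (d := d + 6) N
    fun _ _ hx hi => op _ ((pow2 hi).up (by omega)) (max ((bit (hz.mono le_rfl hx) hi).up (by omega))
      (lt (c 0) ((sum (d := 3) N fun _ _ hx' hi' => op _
        (adj (hi.mono (by omega) hx') (hi'.up (by omega)))
        (bit (hz.mono le_rfl (hx.trans hx')) hi')).up (by omega)))))
theorem dist (ht : Wf x d t) : Wf x (d + 18) (Tm.dist t) :=
  sum (d := d + 15) N fun _ _ hx hi => op _ (c 1)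
    (bit ((ball hi).up (by omega)) (ht.mono (by omega) hx))
theorem par (ht : Wf x d t) : Wf x (d + 27) (Tm.par t) :=
  cond (op _ ((lt ht N).up (by omega)) ((lt (c 0) ht).up (by omega)))
    (sum (d := d + 18) N fun _ _ hx hi => op _ (hi.up (by omega)) (op _
      (adj (ht.mono (by omega) hx) (hi.up (by omega)))
      (lt ((dist hi).up (by omega)) (dist (ht.mono le_rfl hx))))) N
theorem size (ht : Wf x d t) : Wf x (d + 36) (Tm.size t) :=
  sum (d := d + 33) N fun _ _ hx hi => sum (d := d + 30) N fun _ _ hx' hj =>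
    eq (iter (d := d + 27) (hj.up (by omega)) (hi.mono (by omega) hx')
      fun _ _ _ _ _ hz => (par hz).up (by omega)) (ht.mono (by omega) (hx.trans hx'))
theorem levels : Wf x (d + 6) Tm.levels :=
  sum (d := d + 3) N fun _ _ _ hi => le ((pow2 hi).up (by omega)) N
theorem childSizes (hk : Wf x d k) (ht : Wf x d t) : Wf x (d + 39) (Tm.childSizes k t) :=
  sum (d := d + 36) N fun _ _ hx hi => op _ (eq ((par hi).up (by omega)) (ht.mono (by omega) hx))
    (op _ ((size hi).up (by omega)) ((pow2 hk).mono (by omega) hx))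
theorem rank (ht : Wf x d t) : Wf x (d + 54) (Tm.rank t) :=
  cond ((lt ht N).up (by omega)) (iter (d := d + 45) N (c 0) fun _ _ _ hx hi hz =>
    cond (lt (childSizes (hi.up (Nat.zero_le d)) (ht.mono le_rfl hx))
      (op _ ((size ht).mono (by omega) hx) ((pow2 hi).up (by omega))))
      (hi.up (by omega)) (hz.up (by omega))) ((levels (d := 0)).up (by omega))
theorem top (ht : Wf x d t) : Wf x (d + 90) (Tm.top t) :=
  iter (d := d + 87) N (ht.up (by omega)) fun _ _ _ hx _ hz =>
    cond (d := d + 81) (lt ((rank (par hz)).up (by omega)) ((rank ht).mono (by omega) hx))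
      ((par hz).up (by omega)) (hz.up (by omega))
theorem place (ht : Wf x d t) (hv : Wf x d v) : Wf x (d + 15) (Tm.place t v) :=
  prod (d := d + 12) (hv.up (by omega)) fun _ _ hx hi => op _ (c 1)
    (bag (ht.mono le_rfl hx) (hi.up (Nat.zero_le _)))
theorem digit (ht : Wf x d t) (hv : Wf x d v) (ha : Wf x d a) : Wf x (d + 15) (Tm.digit t v a) :=
  mod (op _ (ha.up (by omega)) (place ht hv)) (c 2)
theorem lit (ha : Wf x d a) (hb : Wf x d b) (he : Wf x d e) : Wf x d (Tm.lit a b e) :=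
  op _ (op _ he (pos ha hb)) (op _ (op _ (c 1) he) (neg ha hb))
theorem first (ht : Wf x d t) (hv : Wf x d v) : Wf x (d + 15) (Tm.first t v) :=
  prod (d := d + 12) (ht.up (by omega)) fun _ _ hx hi => op _ (c 1)
    (bag (hi.up (Nat.zero_le d)) (hv.mono le_rfl hx))
theorem clauseW (ht : Wf x d t) (ha : Wf x d a) (he : Wf x d e) :
    Wf x (d + 27) (Tm.clauseW t a e) := by
  have hc : Wf x d (Tm.add Tm.n a) := op _ n ha
  refine cond (d := d + 21) (eq (op _ ((bag ht hc).up (by omega)) ((digit ht hc he).up (by omega)))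
    (c 1)) (op _ (cond (eq (first ht hc) (c 1)) ((pow2 (d := 0) n).up (by omega)) (c 1)) ?_) (c 1)
  exact (prod (d := d + 15) n fun _ _ hx hi => op _ (c 1) (op _
    ((bag (ht.mono le_rfl hx) (hi.up (Nat.zero_le d))).up (by omega))
    (lit (ha.mono (by omega) hx) (hi.up (by omega))
      (digit (ht.mono le_rfl hx) (hi.up (Nat.zero_le _)) (he.mono le_rfl hx))))).up (by omega)
theorem nodeW (ht : Wf x d t) (he : Wf x d e) : Wf x (d + 36) (Tm.nodeW t e) :=
  cond (lt (he.up (by omega)) ((place ht S).up (by omega)))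
    (prod m fun _ _ hx hi => clauseW (ht.mono le_rfl hx) (hi.up (Nat.zero_le d)) (he.mono le_rfl hx))
    (c 0)
theorem edgeW (ht : Wf x d t) (ha : Wf x d a) (hb : Wf x d b) : Wf x (d + 51) (Tm.edgeW t a b) :=
  prod (d := d + 48) S fun _ _ hx hi => by
    have ht' := ht.mono le_rfl hx
    have hi' := hi.up (Nat.zero_le d)
    have hi'' := hi.up (Nat.zero_le (d + 27))
    refine op _ (c 1) (op _ (op _ ((bag ht' hi').up (by omega)) ((bag (par ht') hi'').up (by omega)))
      (cond (eq ((digit ht' hi' (ha.mono le_rfl hx)).up (by omega))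
        ((digit (par ht') hi'' (hb.mono (by omega) hx)).up (by omega))) (c 0) (c 1)))
theorem bits : Wf x 18 Tm.bits :=
  iter (d := 15) N (c 1) fun _ _ _ _ hi hz => max (hz.up (by omega))
    (sum (d := 12) S fun _ _ hx hj => bag (hi.mono le_rfl hx) hj)
theorem low (p r : ℕ) : Wf x 18 (Tm.low p r) := op _ (op _ (c p) (op _ bits (c 1))) (c r)

variable {p r : ℕ}

theorem H : Wf x 21 (Tm.H p r) := pow2 (low p r)
theorem G : Wf x 21 (Tm.G p r) := pow2 (op _ bits (low p r))
theorem modulus : Wf x 3 Tm.modulus := op _ (pow2 n) (c 1)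
theorem lev : Wf x d Tm.lev := arr (by norm_num) (c 0)
theorem dig : Wf x d Tm.dig := arr (by norm_num) lev
theorem state (ht : Wf x d t) (hh : Wf x d h) : Wf x (d + 54) (Tm.state p r t h) :=
  op _ (op _ (op _ (arr (by norm_num) (rank ht)) (c 2)) (H.up (by omega))) (hh.up (by omega))
theorem cell (ht : Wf x d t) (hh : Wf x d h) : Wf x (d + 21) (Tm.cell p r t h) :=
  op _ (op _ (ht.up (by omega)) (H.up (by omega))) (hh.up (by omega))
theorem msgU (ht : Wf x d t) (hh : Wf x d h) : Wf x (d + 135) (Tm.msgU p r t h) :=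
  sum (d := d + 132) (H.up (by omega)) fun _ _ hx hi => by
    have ht' := ht.mono le_rfl hx
    refine op _ (edgeW (d := d + 81) (ht'.up (by omega))
      ((state ht' (hi.up (Nat.zero_le d))).up (by omega))
      (state (par ht') (hh.mono (by omega) hx))) (arr (by norm_num)
      ((cell ht' (hi.up (Nat.zero_le d))).up (by omega)))
theorem comb (ha : Wf x d a) (hh : Wf x d h) : Wf x (d + 150) (Tm.comb p r a h) :=
  op _ ((nodeW (ha.up (by omega)) (state ha hh)).up (by omega))
    (prod (d := d + 147) N fun _ _ hx hi => by
      have ha' := ha.mono le_rfl hx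
      have hi' := hi.up (Nat.zero_le d)
      have hh' := hh.mono le_rfl hx
      exact cond (d := d + 141) (eq ((par hi').up (by omega)) (ha'.up (by omega)))
        (cond (lt ((rank ha').up (by omega)) ((rank hi').up (by omega))) (msgU hi' hh')
          (arr (by norm_num) ((cell hi' hh').up (by omega)))) (c 1))
theorem newU (hi : Wf x d i) (ha : Wf x d a) (hh : Wf x d h) :
    Wf x (d + 156) (Tm.newU p r i a h) :=
  cond (eq ((rank ha).up (by omega)) lev) (mod (comb ha hh) (modulus.up (by omega)))
    (arr (by norm_num) (hi.up (by omega)))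
theorem newACC (hi : Wf x d i) (ha : Wf x d a) (hh : Wf x d h) :
    Wf x (d + 156) (Tm.newACC p r i a h) :=
  cond (d := d + 150) (eq ((rank ha).up (by omega)) lev)
    (mod (op _ (arr (by norm_num) (hi.up (by omega)))
      ((cond (d := d + 135) (eq ((top ha).up (by omega)) (ha.up (by omega))) (msgU ha hh)
        (arr (by norm_num) ((cell (top ha) (hh.up (by omega))).up (by omega)))).up (by omega)))
      (modulus.up (by omega)))
    (arr (by norm_num) (hi.up (by omega)))
theorem newMSG (hi : Wf x d i) (ht : Wf x d t) (hh : Wf x d h) :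
    Wf x (d + 99) (Tm.newMSG p r i t h) :=
  iter (d := d + 96) N (arr (by norm_num) (hi.up (by omega))) fun _ _ _ hx hj hz =>
    cond (d := d + 90) (op _ (eq ((rank hj).up (by omega)) lev)
      (eq ((top hj).up (by omega)) (ht.mono (by omega) hx)))
      (arr (by norm_num) ((cell (hj.up (Nat.zero_le d)) (hh.mono le_rfl hx)).up (by omega)))
      (hz.up (by omega))
theorem clearACC (hi : Wf x d i) (ha : Wf x d a) : Wf x (d + 60) (Tm.clearACC i a) :=
  cond (eq (rank ha) lev) (c 0) (arr (by norm_num) (hi.up (by omega)))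
theorem events : Wf x 24 (Tm.events p r) :=
  iter (d := 21) ((levels (d := 0)).up (by omega)) (c 0) fun _ _ _ _ _ hz =>
    op _ (op _ (op _ (c 2) G) (c 1)) (op _ (hz.up (by omega)) (c 1))

end Wf

namespace CWf

variable {x d : ℕ} {p r : ℕ}

theorem store {j : ℕ} (hj : j < numArr) {a b : Tm} (ha : Wf x d a) (hb : Wf x d b) :
    CWf x d (CTm.store j a b) := fun y hy hl => ⟨hj, ha y hy hl, hb y hy hl⟩

theorem seq {a b : CTm} (ha : CWf x d a) (hb : CWf x d b) : CWf x d (CTm.seq a b) :=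
  fun y hy hl => ⟨ha y hy hl, hb y hy hl⟩

theorem ite {e : Tm} {a b : CTm} (he : Wf x d e) (ha : CWf x d a) (hb : CWf x d b) :
    CWf x d (CTm.ite e a b) := fun y hy hl => ⟨he y hy hl, ha y hy hl, hb y hy hl⟩

theorem fill {j : ℕ} (hj : j < numArr) {e : Tm → Tm → Tm → Tm}
    (he : ∀ x' i a h, x ≤ x' → Wf x' 21 i → Wf x' 21 a → Wf x' 21 h → Wf x' d (e i a h)) :
    CWf x (d + 24) (CTm.fill p r j e) := fun y hy hl =>
  ⟨rfl, by omega, Wf.op _ Wf.N Wf.H y hy (show y + 21 ≤ _ by omega), by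
    have hi : Wf (y + 1) 0 (fun _ => .var y) := fun z hz _ => show y < z by omega
    have hi' := hi.up (Nat.zero_le 21)
    exact ⟨hj, hi (y + 1) le_rfl (by omega), he (y + 1) _ _ _ (by omega) hi' (Wf.op _ hi' Wf.H)
      (Wf.mod hi' Wf.H) (y + 1) le_rfl (by omega)⟩⟩

theorem bump : CWf x d CTm.bump :=
  seq (store (by norm_num) Wf.lev (Wf.op _ Wf.dig (Wf.c 1))) (store (by norm_num) (Wf.c 0) (Wf.c 0))

theorem mono {d' : ℕ} {a : CTm} (hd : d ≤ d') (ha : CWf x d a) : CWf x d' a :=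
  fun y hy hl => ha y hy (by omega)

theorem step (x : ℕ) : CWf x 201 (CTm.step p r) :=
  ite (Wf.lt Wf.lev ((Wf.levels (d := 0)).up (by omega)))
    (ite (Wf.lt Wf.dig (Wf.op _ (Wf.c 2) (Wf.G.up (by omega))))
      (ite (Wf.eq (Wf.mod Wf.dig (Wf.c 2)) (Wf.c 0))
        (seq ((fill (d := 177) (by norm_num) fun _ _ _ _ _ hi ha hh =>
          (Wf.newU hi ha hh).up (by omega)).mono (by omega)) bump)
        (seq ((fill (d := 177) (by norm_num) fun _ _ _ _ _ hi ha hh =>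
          (Wf.newACC hi ha hh).up (by omega)).mono (by omega)) bump))
      (seq ((fill (d := 177) (by norm_num) fun _ _ _ _ _ hi ha hh =>
          (Wf.newMSG hi ha hh).up (by omega)).mono (by omega))
        (seq ((fill (d := 177) (by norm_num) fun _ _ _ _ _ hi ha hh =>
          (Wf.clearACC hi ha).up (by omega)).mono (by omega))
          (seq (store (by norm_num) Wf.lev (Wf.c 0))
            (store (by norm_num) (Wf.c 0) (Wf.op _ Wf.lev (Wf.c 1)))))))
    (store (by norm_num) (Wf.c 0) Wf.lev)

end CWf

end SatTW

namespace SatTW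

/-! ### The program -/

/-- The evaluation of the messages, with `p / r` of the bits of a code in the arrays. -/
def satProg (p r : ℕ) : Prog :=
  .seq ((Tm.inputLength 0).code nameLimit) (.seq (.move 0 nameLimit)
    (.seq ((Cm.loop 0 (Tm.events p r 0) (CTm.step p r 1)).code nameLimit)
      (.seq ((Ex.arr 1 (.const 0)).code nameLimit) (.move 0 nameLimit))))

section

variable {φ : CNF} {N : ℕ} (D : TreeDecomposition φ.incidenceGraph N)

theorem table_le {a b : ℕ} (R : Fin a → Fin b → Prop) {v : ℕ} (h : v ∈ table R) : v ≤ 1 := by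
  rw [table, List.mem_ofFn] at h
  obtain ⟨k, rfl⟩ := h
  exact bit_le _

theorem encode_getD_le (a : ℕ) : (encode φ D).getD a 0 ≤ φ.n + φ.m + N + 3 := by
  by_cases ha : a < (encode φ D).length
  · rw [List.getD_eq_getElem _ _ ha]
    have h := List.getElem_mem ha
    generalize (encode φ D)[a] = v at h
    simp only [encode, List.mem_append, List.mem_cons, List.not_mem_nil, or_false] at h
    rcases h with ((((h | h) | h) | h) | h) | h
    · omega
    all_goals
      have := table_le _ h
      omega
  · rw [List.getD_eq_default _ _ (not_lt.1 ha)]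
    exact Nat.zero_le _

theorem length_encode_le : (encode φ D).length ≤ (φ.n + φ.m + N + 3) ^ 2 := by
  rw [length_encode]
  nlinarith [Nat.zero_le (φ.n * φ.n), Nat.zero_le (φ.m * φ.m), Nat.zero_le (φ.n * N)]

end

theorem size_lt_two_pow {s k : ℕ} (h : k ≤ s ^ 2) : k < 2 ^ (8 * s ^ 2) :=
  h.trans_lt (Nat.lt_two_pow_self.trans_le (Nat.pow_le_pow_right (by norm_num) (by omega)))

theorem cells_lt_two_pow {s q : ℕ} (hs : 1 ≤ s) (hq : q ≤ s) : s * 2 ^ q < 2 ^ (8 * s ^ 2) := by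
  have h1 : s * 2 ^ q < 2 ^ s * 2 ^ q :=
    Nat.mul_lt_mul_of_pos_right Nat.lt_two_pow_self (Nat.two_pow_pos _)
  rw [← pow_add] at h1
  exact h1.trans_le (Nat.pow_le_pow_right (by norm_num) (by nlinarith))

/-- The bounds for the computation on an input of size `s` with arrays of length `s * 2 ^ q`. -/
def satBounds (κ s q len : ℕ) (hκ : 320 ≤ κ) (hs : 1 ≤ s) (hq : q ≤ s) (hlen : len ≤ s ^ 2) :
    Bounds where
  D := κ
  V := κ * (8 * s ^ 2)
  Y := len + s * 2 ^ q * numArr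
  hD := by
    have h1 : 1 ≤ s ^ 2 := Nat.one_le_pow _ _ hs
    exact Nat.lt_two_pow_self.le.trans (Nat.pow_le_pow_right (by norm_num) (by nlinarith))
  hY := by
    have h1 := size_lt_two_pow hlen
    have h2 := cells_lt_two_pow hs hq
    have h3 : 1 ≤ s ^ 2 := Nat.one_le_pow _ _ hs
    have h4 : len + s * 2 ^ q * numArr ≤ 2 ^ (8 * s ^ 2 + 5) := by
      rw [pow_add]
      show _ + _ * 16 ≤ _ * 32
      omega
    exact h4.trans (Nat.pow_le_pow_right (by norm_num) (by nlinarith))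

theorem count_le {κ κ₁ κ₂ κ₃ κ₄ T E : ℕ} (hT : 1 ≤ T) (h : κ₁ + κ₂ + κ₃ + κ₄ + 320 ≤ κ) :
    κ₁ * T ^ κ₁ + (2 + (κ₂ * T ^ κ₂ + 2 + E * (κ₃ * T ^ κ₃ + 4) + (κ₄ * T ^ κ₄ + 2))) ≤
      κ * T ^ κ * (E + 1) := by
  have e1 := coeff_pow_le (a := κ₁) hT (show κ₁ ≤ κ by omega)
  have e2 := coeff_pow_le (a := κ₂) hT (show κ₂ ≤ κ by omega)
  have e3 := coeff_pow_le (a := κ₃) hT (show κ₃ ≤ κ by omega)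
  have e4 := coeff_pow_le (a := κ₄) hT (show κ₄ ≤ κ by omega)
  have e5 : 1 ≤ T ^ κ := Nat.one_le_pow _ _ hT
  have e6 := Nat.mul_le_mul_right (T ^ κ) h
  have e7 : E * (κ₃ * T ^ κ₃ + 4) ≤ E * (κ * T ^ κ) := Nat.mul_le_mul_left _ (by nlinarith)
  nlinarith

/-- The constants of the four compiled pieces are merged into one `κ`. Each round of the outer loop
is one event, so after `k` rounds the arrays represent `k` iterations of `Model.step`, and the total
is the cost of a round, polynomial in `T`, times the number of events. -/
theorem satProg_run (p r : ℕ) (hpr : p ≤ r) : ∃ κ, ∀ (φ : CNF) (N : ℕ)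
    (D : TreeDecomposition φ.incidenceGraph N) (s q T : ℕ), s = φ.n + φ.m + N + 3 →
    q = p * D.width / r → T = s * 2 ^ q → ∃ σ t sp, Run (satProg p r) (initial φ D) σ t sp ∧
      (σ.reg 0 ≠ 0 ↔ φ.Satisfiable) ∧
      t ≤ κ * T ^ κ * (4 * 2 ^ (D.width + 1 - q)) ^ levels N * (κ * (8 * s ^ 2) + 1) ^ 2 ∧
      sp ≤ (κ + (s ^ 2 + T * 16)) * (2 * (κ * (8 * s ^ 2))) := by
  obtain ⟨κ₁, h₁⟩ := (Tm.inputLength 0).code_spec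
  obtain ⟨κ₂, h₂⟩ := (Tm.events p r 0).code_spec
  obtain ⟨κ₃, h₃⟩ := (CTm.step p r 1).code_spec
  obtain ⟨κ₄, h₄⟩ := (Ex.arr 1 (.const 0)).code_spec
  obtain ⟨κ, hκ⟩ : ∃ κ, κ = κ₁ + κ₂ + κ₃ + κ₄ + 320 := ⟨_, rfl⟩
  refine ⟨κ, fun φ N D s q T hs hq hT => ?_⟩
  have hlow : q = D.inst.low p r := by rw [hq, Inst.low, D.bits_sub_one]
  have hbits : D.inst.bits = D.width + 1 := by
    have := D.inst.bits_pos
    have := D.bits_sub_one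
    omega
  have hqlt := D.inst.low_lt hpr
  have hble : D.inst.bits ≤ φ.n + φ.m + 1 := D.valid.bits_le
  have hN : 0 < N := by
    obtain ⟨t⟩ := D.isTree.connected.nonempty
    exact t.pos
  have hs1 : 1 ≤ s := by omega
  have hqs : q ≤ s := by omega
  have hlen : (encode φ D).length ≤ s ^ 2 := by rw [hs]; exact length_encode_le D
  have hTs : s ≤ T := by rw [hT]; exact Nat.le_mul_of_pos_right _ (Nat.two_pow_pos _)
  have hTlt : T < 2 ^ (8 * s ^ 2) := by rw [hT]; exact cells_lt_two_pow hs1 hqs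
  have hent : ∀ a, (encode φ D).getD a 0 < 2 ^ (8 * s ^ 2) := fun a =>
    size_lt_two_pow ((encode_getD_le D a).trans (by rw [← hs]; nlinarith))
  have hβ1 : 1 ≤ 8 * s ^ 2 := by nlinarith
  obtain ⟨b, hb⟩ : ∃ b, b = satBounds κ s q (encode φ D).length (by omega) hs1 hqs hlen := ⟨_, rfl⟩
  have hbD : b.D = κ := by rw [hb]; rfl
  have hbV : b.V = κ * (8 * s ^ 2) := by rw [hb]; rfl
  have hbY : b.Y = (encode φ D).length + T * numArr := by rw [hb, hT]; rfl
  have hβV : 8 * s ^ 2 ≤ b.V := by rw [hbV]; exact Nat.le_mul_of_pos_left _ (by omega)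
  let ctx : ℕ → Ctx := fun base =>
    ⟨b, 8 * s ^ 2, T, T, base, (encode φ D).length, fun a => (encode φ D).getD a 0⟩
  have hctx : ∀ base, base ≤ (encode φ D).length → ∀ κ', κ' ≤ κ → (ctx base).Ok κ' :=
    fun base hbase κ' hκ' =>
      ⟨hβ1, hs1.trans hTs, hTlt, size_lt_two_pow (hbase.trans hlen),
        (Nat.mul_le_mul_right _ hκ').trans hbV.ge, fun a _ => hent a⟩
  have hinp : ∀ base, Input (ctx base) D.inst.n D.inst.m D.inst.N D.inst.pos D.inst.neg
      (adjN D.tree) D.inst.bag := fun base =>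
    D.input (hs ▸ hTs) (by rw [← hs]) rfl rfl
  -- the length of the input
  have hw0 : (initial φ D).Within b.D b.V b.Y := by
    refine ⟨fun _ _ => rfl, fun _ => Nat.two_pow_pos _, fun a ha => ?_, fun a => ?_⟩
    · rw [initial_mem, List.getD_eq_default _ _ (by omega)]
    · rw [initial_mem]
      exact (hent a).trans_le (Nat.pow_le_pow_right (by norm_num) hβV)
  -- Before the length of the input is known, register `0` contains `0`. The arrays are then taken
  -- to start at address `0` and to consist of the input cells themselves; the first expression
  -- reads only the input.
  have hrep0 : Represents (ctx 0) 0 (fun _ => 0)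
      (fun j i => (encode φ D).getD (0 + (i * numArr + j)) 0) (initial φ D) :=
    ⟨hw0, rfl, fun _ h => absurd h (Nat.not_lt_zero _), fun _ h => absurd h (Nat.not_lt_zero _),
      fun a _ => initial_mem D a, fun _ _ _ => initial_mem D _, fun _ _ _ => hent _⟩
  have hl := (hinp 0).inputLength_spec (A := fun j i => (encode φ D).getD (0 + (i * numArr + j)) 0)
    (w := ⟨0, fun _ => 0⟩) _ le_rfl
  obtain ⟨-, σ₁, hx₁, hm₁, hr₁, hl₁, -⟩ := h₁ (ctx 0) _ _ 0 nameLimit _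
    (hctx 0 (Nat.zero_le _) _ (by omega)) (Wf.inputLength (x := 0) (d := 0) 0 le_rfl (by decide))
    (by decide) le_rfl (by show _ + _ ≤ b.D; rw [hbD]; unfold nameLimit; omega) hrep0 hl.1
  rw [hl.2] at hr₁
  obtain ⟨σ₂, hx₂, hm₂, hr₂⟩ := Exec.move hx₁.1 (i := 0) (j := nameLimit)
    (by show 0 < b.D; omega) (by decide)
  -- the evaluation
  have hm2 : σ₂.mem = (initial φ D).mem := hm₂.trans hm₁
  obtain ⟨cx, hcx⟩ : ∃ cx, cx = ctx (encode φ D).length := ⟨_, rfl⟩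
  have hok : ∀ κ', κ' ≤ κ → cx.Ok κ' := by rw [hcx]; exact hctx _ le_rfl
  have hD : cx.b.D = κ := by rw [hcx]; exact hbD
  have hfits : cx.Fits := by rw [hcx]; exact ⟨le_rfl, hbY.ge⟩
  have hcT : cx.T = T := by rw [hcx]
  have hb' : cx.b = b := by rw [hcx]
  -- Now the arrays start right behind the input, where the memory is zero; this is the initial
  -- working state of the evaluation.
  have hrep : Represents cx 0 (fun _ => 0) (fun _ _ => 0) σ₂ := by
    rw [hcx]
    refine ⟨hx₂.1, ?_, fun _ h => absurd h (Nat.not_lt_zero _),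
      fun _ h => absurd h (Nat.not_lt_zero _), fun a _ => ?_, fun j _ i => ?_,
      fun _ _ _ => Nat.two_pow_pos _⟩
    · rw [hr₂, if_pos rfl, hr₁]
    · rw [hm2]; exact initial_mem D a
    · rw [hm2, initial_mem, List.getD_eq_default]
      exact Nat.le_add_right _ _
  have hS : Setup cx D.inst D.tree p r :=
    ⟨D.valid, D.isTree, by rw [hcx]; exact hinp _, rfl, hpr, by
      rw [← hlow, hcT, hT, hs]; exact le_rfl, by rw [hcx]⟩
  have hE := hS.events_spec (A := fun _ _ => 0) (w := ⟨0, fun _ => 0⟩) _ le_rfl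
  obtain ⟨E, hEdef⟩ : ∃ E, E = hS.model.events (levels D.inst.N) := ⟨_, rfl⟩
  rw [← hEdef] at hE
  have hElt : E < 2 ^ cx.β := hEdef ▸ hS.events_lt _ (levels_le _)
  have hEle : E + 1 ≤ (4 * 2 ^ (D.width + 1 - q)) ^ levels N := by
    have := hS.model.events_lt (Nat.two_pow_pos _) (levels D.inst.N)
    rw [← hEdef] at this
    rw [hlow, ← hbits]
    exact this
  let F : ℕ → (ℕ → ℕ → ℕ) → ℕ → ℕ → ℕ := fun i B =>
    (CTm.step p r 1).run cx.I (upd (fun _ => 0) 0 i) B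
  have hstep : ∀ k A s', Sim D.inst (2 ^ D.inst.low p r) (2 ^ (D.inst.bits - D.inst.low p r)) A s' →
      (CTm.step p r 1).Safe cx.I cx.len cx.β cx.T cx.X (upd (fun _ => 0) 0 k) A ∧
      Sim D.inst (2 ^ D.inst.low p r) (2 ^ (D.inst.bits - D.inst.low p r)) (F k A)
        (hS.model.step s') := fun k A s' hA =>
    hS.step_spec (w := ⟨1, upd (fun _ => 0) 0 k⟩) hA _ le_rfl
  have hsim : ∀ k, Sim D.inst (2 ^ D.inst.low p r) (2 ^ (D.inst.bits - D.inst.low p r))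
      (iterN k (fun _ _ => 0) F) (hS.model.step^[k] (Work.init _)) := by
    intro k
    induction k with
    | zero => exact Sim.init
    | succ k ih =>
      rw [iterN_succ, Function.iterate_succ_apply']
      exact (hstep k _ _ ih).2
  have hn : ExSpec cx κ₂ (κ₂ * cx.T ^ κ₂) 0 nameLimit ((Tm.events p r 0).code nameLimit)
      ((Tm.events p r 0).ev cx.I (fun _ _ => 0) fun _ => 0) σ₂ :=
    h₂ cx _ _ 0 nameLimit _ (hok _ (by omega)) (Wf.events (x := 0) 0 le_rfl (by decide))
      (by decide) le_rfl (by rw [hD]; unfold nameLimit; omega) hrep hE.1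
  -- The number of events may far exceed `T`, but it is below `2 ^ β`, which is all that
  -- `Cm.loop_spec` requires.
  have hloop := Cm.loop_spec κ₂ (Tm.events p r 0) (CTm.step p r 1) cx (fun _ _ => 0) (fun _ => 0)
    0 nameLimit (κ₃ * cx.T ^ κ₃) σ₂ (hok _ (by omega)) (by decide) le_rfl
    (by rw [hD]; unfold nameLimit; omega) hrep (by rw [hE.2]; exact hElt) hn
    fun k τ _ hτ => h₃ cx _ _ 1 (nameLimit + 1) τ (hok _ (by omega)) hfits
      (CWf.step 1 1 le_rfl (by decide)) (by decide) (Nat.le_succ _)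
      (by rw [hD]; unfold nameLimit; omega) hτ (hstep k _ _ (hsim k)).1
  rw [hE.2] at hloop
  obtain ⟨σ₃, hx₃, hrep₃, -⟩ := hloop
  -- the answer
  obtain ⟨-, σ₄, hx₄, -, hr₄, -, -⟩ := h₄ cx _ _ 0 nameLimit _ (hok _ (by omega))
    (by exact ⟨by decide, trivial⟩) (by decide) le_rfl (by rw [hD]; unfold nameLimit; omega) hrep₃
    trivial
  obtain ⟨σ₅, hx₅, -, hr₅⟩ := Exec.move hx₄.1 (i := 0) (j := nameLimit)
    (by rw [hD]; omega) (by decide)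
  rw [hb'] at hx₃ hx₄ hx₅
  obtain ⟨-, t, sp, hrun, ht, hsp⟩ := hx₁.seq (hx₂.seq (hx₃.seq (hx₄.seq hx₅)))
  refine ⟨σ₅, t, sp, hrun, ?_, ht.trans ?_, hsp.trans ?_⟩
  · rw [hr₅, if_pos rfl, hr₄, D.satisfiable_iff]
    have hfin : (Cm.loop 0 (Tm.events p r 0) (CTm.step p r 1)).run cx.I (fun _ => 0) (fun _ _ => 0) =
        iterN E (fun _ _ => 0) F := congrArg (iterN · _ F) hE.2
    rw [hfin]
    exact hS.answer hN (hEdef ▸ hsim E)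
  · show _ * (b.V + 1) ^ 2 ≤ _
    rw [hbV, hcT]
    exact Nat.mul_le_mul_right _ ((count_le (hs1.trans hTs) hκ.ge).trans
      (Nat.mul_le_mul_left _ hEle))
  · show (b.D + b.Y) * (2 * b.V) ≤ _
    rw [hbD, hbV, hbY]
    exact Nat.mul_le_mul_right _ (Nat.add_le_add_left (Nat.add_le_add_right hlen _) _)

end SatTW

namespace SatTW

/-! ### Running time and space -/

theorem levels_le_log (N : ℕ) : levels N ≤ Nat.log 2 N + 1 := by
  rw [levels, ← Finset.sum_filter_add_sum_filter_not (Finset.range N) fun i => i < Nat.log 2 N + 1]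
  rw [Finset.sum_eq_zero (s := Finset.filter (fun i => ¬ i < _) _)]
  · refine (add_zero _).trans_le ((Finset.sum_le_card_nsmul _ _ 1 fun i _ => ?_).trans ?_)
    · split <;> omega
    · rw [smul_eq_mul, mul_one]
      refine (Finset.card_le_card (t := Finset.range (Nat.log 2 N + 1)) fun i hi => ?_).trans
        (Finset.card_range _).le
      exact Finset.mem_range.2 (Finset.mem_filter.1 hi).2
  · intro i hi
    rw [if_neg fun h => (Finset.mem_filter.1 hi).2 (Nat.lt_succ_of_le (Nat.le_log_of_pow_le (by norm_num) h))]

/-- A fraction `p / r` of the bits that is affordable for the space and sufficient for the time. -/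
theorem exists_fraction {ε : ℝ} (h0 : 0 < ε) (h1 : ε < 1) : ∃ p r : ℕ, 0 < r ∧ p ≤ r ∧
    (p / r : ℝ) ≤ 2 * ε ∧ 1 - (p / r : ℝ) < 1.441 * (1 - ε) := by
  -- The lower end `1.441 ε - 0.441` is `1 - 1.441 (1 - ε)`, from the time; the upper end `2 ε` is
  -- from the space. The interval is nonempty since `0 < ε < 1`, and a rational point in it gives a
  -- strict inequality for the time.
  obtain ⟨a, ha, ha'⟩ := exists_rat_btwn (show max 0 (1.441 * ε - 0.441) < min 1 (2 * ε) from
    max_lt (lt_min one_pos (by linarith)) (lt_min (by linarith) (by linarith)))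
  obtain ⟨ha0, ha1⟩ := max_lt_iff.1 ha
  obtain ⟨ha2, ha3⟩ := lt_min_iff.1 ha'
  have hnum : 0 ≤ a.num := Rat.num_nonneg.2 (by exact_mod_cast ha0.le)
  have hcast : ((a.num.toNat : ℕ) : ℝ) = a.num := by
    exact_mod_cast congrArg (Int.cast : ℤ → ℝ) (Int.toNat_of_nonneg hnum)
  have hdiv : ((a.num.toNat : ℕ) / (a.den : ℕ) : ℝ) = a := by rw [hcast, ← Rat.cast_def]
  have hden : (0 : ℝ) < a.den := by exact_mod_cast a.pos
  refine ⟨a.num.toNat, a.den, a.pos, ?_, by rw [hdiv]; exact ha3.le, by rw [hdiv]; linarith⟩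
  rw [← hdiv, div_lt_one hden] at ha2
  exact_mod_cast ha2.le

theorem low_cast_le {p r w : ℕ} : ((p * w / r : ℕ) : ℝ) ≤ p / r * w := by
  refine Nat.cast_div_le.trans (le_of_eq ?_)
  push_cast
  ring

/-- One unit of the `2` comes from `w + 1` bits for width `w`, the other from rounding down `p * w /
r`. -/
theorem high_cast_le {p r w : ℕ} (hr : 0 < r) (h : p ≤ r) :
    ((w + 1 - p * w / r : ℕ) : ℝ) ≤ (1 - p / r) * w + 2 := by
  have h1 : p * w / r ≤ w + 1 :=
    (Nat.div_le_of_le_mul (Nat.mul_le_mul_right _ h)).trans (Nat.le_succ _)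
  have h2 : p * w < r * (p * w / r + 1) := Nat.lt_mul_div_succ _ hr
  have hr' : (0 : ℝ) < r := by exact_mod_cast hr
  have h3 : (p * w : ℝ) < r * (((p * w / r : ℕ) : ℝ) + 1) := by exact_mod_cast h2
  have h4 : (p / r * w : ℝ) < ((p * w / r : ℕ) : ℝ) + 1 := by
    rw [div_mul_eq_mul_div, div_lt_iff₀ hr']
    linarith
  rw [Nat.cast_sub h1]
  push_cast
  linarith

/-- The main term is `(1 - a) w l`. The cost `K q ≤ K w` of a round and the term `(1 - a) w ≤ w`,
due to `L ≤ l + 1`, are linear in `w` without the factor `l`; together they are at most `(K + 1) w`,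
which the gap `c - (1 - a)` pays for once `l` is large. The remainder `4 l + 4` becomes the
polynomial factor `16 N ^ 4`. -/
theorem time_exponent_le {a c K w l L e q : ℝ} (hw : 0 ≤ w) (hK : 0 ≤ K) (ha : 0 ≤ a)
    (hq : q ≤ a * w) (ha1 : a ≤ 1) (hL : L ≤ l + 1) (hL0 : 0 ≤ L) (he : e ≤ (1 - a) * w + 2)
    (hc : K + 1 ≤ (c - (1 - a)) * l) : K * q + (e + 2) * L ≤ c * w * l + 4 * l + 4 := by
  have h1 : K * q ≤ K * w := mul_le_mul_of_nonneg_left (hq.trans (by nlinarith)) hK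
  have h2 : (e + 2) * L ≤ ((1 - a) * w + 4) * L := mul_le_mul_of_nonneg_right (by linarith) hL0
  have h3 : ((1 - a) * w + 4) * L ≤ ((1 - a) * w + 4) * (l + 1) :=
    mul_le_mul_of_nonneg_left hL (by nlinarith [mul_nonneg (sub_nonneg.2 ha1) hw])
  have h4 := mul_le_mul_of_nonneg_right hc hw
  have h5 := mul_nonneg ha hw
  nlinarith

theorem time_le {κ q w N p r L : ℕ} {c : ℝ} (hr : 0 < r) (hpr : p ≤ r) (hq : q = p * w / r)
    (hN : 0 < N) (hL : (L : ℝ) ≤ Real.logb 2 N + 1)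
    (hc : (κ : ℝ) + 1 ≤ (c - (1 - p / r)) * Real.logb 2 N) :
    (2 : ℝ) ^ (κ * q) * (4 * 2 ^ (w + 1 - q)) ^ L ≤ 16 * N ^ 4 * (2 : ℝ) ^ (c * w * Real.logb 2 N) := by
  have hN' : (0 : ℝ) < N := by exact_mod_cast hN
  have hr' : (0 : ℝ) < r := by exact_mod_cast hr
  have h := time_exponent_le (a := p / r) (c := c) (K := κ) (w := w) (l := Real.logb 2 N) (L := L)
    (e := (w + 1 - q : ℕ)) (q := q) (by positivity) (by positivity) (by positivity)
    (by rw [hq]; exact low_cast_le) ((div_le_one hr').2 (by exact_mod_cast hpr)) hL (by positivity)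
    (by rw [hq]; exact high_cast_le hr hpr) hc
  have h2 : (2 : ℝ) ^ (κ * q) * (4 * 2 ^ (w + 1 - q)) ^ L =
      (2 : ℝ) ^ ((κ : ℝ) * q + (((w + 1 - q : ℕ) : ℝ) + 2) * L) := by
    rw [show (κ : ℝ) * q + (((w + 1 - q : ℕ) : ℝ) + 2) * L =
      ((κ * q + ((w + 1 - q) + 2) * L : ℕ) : ℝ) by push_cast; ring, Real.rpow_natCast, pow_add,
      pow_mul _ _ L, pow_add _ _ 2]
    ring
  rw [h2]
  refine (Real.rpow_le_rpow_of_exponent_le (by norm_num) h).trans (le_of_eq ?_)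
  rw [Real.rpow_add (by norm_num), Real.rpow_add (by norm_num), mul_comm 4 (Real.logb _ _),
    Real.rpow_mul (y := Real.logb 2 N) (z := 4) (by norm_num), Real.rpow_logb (by norm_num) (by norm_num) hN']
  norm_num
  ring

theorem time_monomial_le (κ s q M : ℕ) (hs : 1 ≤ s) :
    κ * (s * 2 ^ q) ^ κ * M * (κ * (8 * s ^ 2) + 1) ^ 2 ≤
      κ * (8 * κ + 1) ^ 2 * s ^ (κ + 4) * (2 ^ (κ * q) * M) := by
  have h1 : κ * (8 * s ^ 2) + 1 ≤ (8 * κ + 1) * s ^ 2 := by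
    have := Nat.one_le_pow 2 s hs
    nlinarith
  refine (Nat.mul_le_mul_left _ (Nat.pow_le_pow_left h1 2)).trans (le_of_eq ?_)
  rw [mul_pow, ← pow_mul 2 q, mul_comm q]
  ring

theorem space_monomial_le (κ s q : ℕ) (hs : 1 ≤ s) :
    (κ + (s ^ 2 + s * 2 ^ q * 16)) * (2 * (κ * (8 * s ^ 2))) ≤ (κ + 17) * (16 * κ) * s ^ 4 * 2 ^ q := by
  have h1 := Nat.one_le_two_pow (n := q)
  have h2 : s ≤ s ^ 2 := by nlinarith
  have h3 : 1 ≤ s ^ 2 * 2 ^ q := Nat.one_le_iff_ne_zero.2 (by positivity)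
  have h4 : s * 2 ^ q ≤ s ^ 2 * 2 ^ q := Nat.mul_le_mul_right _ h2
  have h5 : s ^ 2 ≤ s ^ 2 * 2 ^ q := Nat.le_mul_of_pos_right _ (by omega)
  have h6 : κ + (s ^ 2 + s * 2 ^ q * 16) ≤ (κ + 17) * (s ^ 2 * 2 ^ q) := by nlinarith
  refine (Nat.mul_le_mul_right _ h6).trans (le_of_eq ?_)
  ring

end SatTW

theorem mainTheorem2 (ε : ℝ) (hε0 : 0 < ε) (hε1 : ε < 1) :
    ∃ (P : SatTW.Prog) (N₀ C k : ℕ),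
      ∀ (φ : SatTW.CNF) (N : ℕ) (D : SatTW.TreeDecomposition φ.incidenceGraph N),
        D.maxDegree ≤ 3 →
        ∃ (σ : SatTW.State) (t s : ℕ),
          SatTW.Run P (SatTW.initial φ D) σ t s ∧
          (σ.reg 0 ≠ 0 ↔ φ.Satisfiable) ∧
          (N₀ ≤ N →
            (t : ℝ) ≤ C * ((φ.size + N : ℕ) : ℝ) ^ k *
              (D.maxDegree : ℝ) ^ (1.441 * (1 - ε) * (D.width : ℝ) * Real.logb 2 (N : ℝ))) ∧
          (s : ℝ) ≤ C * ((φ.size + N : ℕ) : ℝ) ^ k * (2 : ℝ) ^ (2 * ε * (D.width : ℝ)) := by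
  obtain ⟨p, r, hr, hpr, hspace, htime⟩ := SatTW.exists_fraction hε0 hε1
  obtain ⟨κ, h⟩ := SatTW.satProg_run p r hpr
  obtain ⟨δ, hδ⟩ : ∃ δ, δ = 1.441 * (1 - ε) - (1 - (p / r : ℝ)) := ⟨_, rfl⟩
  have hδ0 : 0 < δ := by linarith
  obtain ⟨M, hM⟩ := exists_nat_ge (((κ : ℝ) + 1) / δ)
  obtain ⟨C₁, hC₁⟩ : ∃ C₁, C₁ = κ * (8 * κ + 1) ^ 2 * 4 ^ (κ + 4) * 16 := ⟨_, rfl⟩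
  obtain ⟨C₂, hC₂⟩ : ∃ C₂, C₂ = (κ + 17) * (16 * κ) * 4 ^ 4 := ⟨_, rfl⟩
  -- `N ≥ 2 ^ M` makes `log N` at least `(κ + 1) / δ`, as the absorption of the terms linear in the
  -- width requires, and `N ≥ 3` gives `d ≥ 2`. The exponent `κ + 8` is `κ + 4` from the input size
  -- in the cost of a round, plus `4` from `16 N ^ 4`.
  refine ⟨SatTW.satProg p r, 2 ^ M + 3, C₁ + C₂, κ + 8, fun φ N D _ => ?_⟩
  obtain ⟨σ, t, sp, hrun, hans, ht, hsp⟩ := h φ N D _ _ _ rfl rfl rfl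
  have hN : 0 < N := by
    obtain ⟨t⟩ := D.isTree.connected.nonempty
    exact t.pos
  have hN1 : (1 : ℝ) ≤ N := by exact_mod_cast hN
  generalize hq : p * D.width / r = q at *
  obtain ⟨s, hs⟩ : ∃ s, s = φ.n + φ.m + N + 3 := ⟨_, rfl⟩
  obtain ⟨z, hz⟩ : ∃ z, z = φ.size + N := ⟨_, rfl⟩
  have hsize : φ.size = φ.m + φ.n := rfl
  have hs1 : 1 ≤ s := by omega
  -- `s = z + 3`, and `z ≥ 1` because a tree has a node; this turns the additive constant into the
  -- powers of `4` in `C₁` and `C₂`.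
  have hsz : s ≤ 4 * z := by omega
  have hz1 : 1 ≤ z := by omega
  rw [← hs] at ht hsp
  rw [← hz]
  have hz1' : (1 : ℝ) ≤ z := by exact_mod_cast hz1
  have hC : (C₁ : ℝ) ≤ (C₁ + C₂ : ℕ) := by exact_mod_cast Nat.le_add_right _ _
  have hC' : (C₂ : ℝ) ≤ (C₁ + C₂ : ℕ) := by exact_mod_cast Nat.le_add_left _ _
  refine ⟨σ, t, sp, hrun, hans, fun hNM => ?_, ?_⟩
  · have hd : (2 : ℝ) ≤ D.maxDegree := by
      exact_mod_cast SatTW.two_le_maxDegree D.isTree ((Nat.le_add_left 3 _).trans hNM)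
    have hlog : ((κ : ℝ) + 1) / δ ≤ Real.logb 2 N := by
      refine hM.trans ?_
      rw [Real.le_logb_iff_rpow_le (by norm_num) (by linarith), Real.rpow_natCast]
      exact_mod_cast (Nat.le_add_right _ 3).trans hNM
    have hL : (SatTW.levels N : ℝ) ≤ Real.logb 2 N + 1 := by
      have h1 : (SatTW.levels N : ℝ) ≤ Nat.log 2 N + 1 := by exact_mod_cast SatTW.levels_le_log N
      have h2 := Real.natLog_le_logb N 2
      push_cast at h2
      linarith
    have hlog0 : 0 ≤ Real.logb 2 (N : ℝ) := Real.logb_nonneg (by norm_num) hN1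
    have hkey := SatTW.time_le (c := 1.441 * (1 - ε)) hr hpr hq.symm hN hL
      (by rw [← hδ]; rwa [div_le_iff₀ hδ0, mul_comm] at hlog)
    have hbase : (2 : ℝ) ^ (1.441 * (1 - ε) * (D.width : ℝ) * Real.logb 2 (N : ℝ)) ≤
        (D.maxDegree : ℝ) ^ (1.441 * (1 - ε) * (D.width : ℝ) * Real.logb 2 (N : ℝ)) :=
      Real.rpow_le_rpow (by norm_num) hd
        (mul_nonneg (mul_nonneg (mul_nonneg (by norm_num) (by linarith)) (by positivity)) hlog0)
    have ht' := ht.trans (SatTW.time_monomial_le κ s q _ hs1)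
    have ht'' : (t : ℝ) ≤ κ * (8 * κ + 1) ^ 2 * s ^ (κ + 4) *
        ((2 : ℝ) ^ (κ * q) * (4 * 2 ^ (D.width + 1 - q)) ^ SatTW.levels N) := by exact_mod_cast ht'
    have hs4 : (s : ℝ) ^ (κ + 4) ≤ 4 ^ (κ + 4) * z ^ (κ + 4) := by
      rw [← mul_pow]
      exact pow_le_pow_left₀ (by positivity) (by exact_mod_cast hsz) _
    have hNz : (N : ℝ) ^ 4 ≤ z ^ 4 :=
      pow_le_pow_left₀ (by positivity) (by exact_mod_cast (by omega : N ≤ z)) _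
    calc (t : ℝ) ≤ _ := ht''
      _ ≤ κ * (8 * κ + 1) ^ 2 * (4 ^ (κ + 4) * z ^ (κ + 4)) * (16 * z ^ 4 *
          (D.maxDegree : ℝ) ^ (1.441 * (1 - ε) * (D.width : ℝ) * Real.logb 2 (N : ℝ))) := by
        refine mul_le_mul (mul_le_mul_of_nonneg_left hs4 (by positivity)) (hkey.trans ?_)
          (by positivity) (by positivity)
        exact mul_le_mul (mul_le_mul_of_nonneg_left hNz (by norm_num)) hbase (by positivity)
          (by positivity)
      _ = C₁ * (z : ℝ) ^ (κ + 8) *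
          (D.maxDegree : ℝ) ^ (1.441 * (1 - ε) * (D.width : ℝ) * Real.logb 2 (N : ℝ)) := by
        rw [hC₁]
        push_cast
        ring
      _ ≤ _ := by gcongr
  · have hsp' := hsp.trans (SatTW.space_monomial_le κ s q hs1)
    have hsp'' : (sp : ℝ) ≤ (κ + 17) * (16 * κ) * s ^ 4 * (2 : ℝ) ^ q := by exact_mod_cast hsp'
    have hs4 : (s : ℝ) ^ 4 ≤ 4 ^ 4 * z ^ 4 := by
      rw [← mul_pow]
      exact pow_le_pow_left₀ (by positivity) (by exact_mod_cast hsz) _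
    have hz4 : (z : ℝ) ^ 4 ≤ z ^ (κ + 8) := pow_le_pow_right₀ hz1' (by omega)
    have h2q : (2 : ℝ) ^ q ≤ (2 : ℝ) ^ (2 * ε * (D.width : ℝ)) := by
      rw [← Real.rpow_natCast]
      refine Real.rpow_le_rpow_of_exponent_le (by norm_num) ?_
      rw [← hq]
      exact SatTW.low_cast_le.trans (mul_le_mul_of_nonneg_right hspace (by positivity))
    calc (sp : ℝ) ≤ _ := hsp''
      _ ≤ (κ + 17) * (16 * κ) * (4 ^ 4 * z ^ (κ + 8)) * (2 : ℝ) ^ (2 * ε * (D.width : ℝ)) := by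
        refine mul_le_mul (mul_le_mul_of_nonneg_left (hs4.trans ?_) (by positivity)) h2q
          (by positivity) (by positivity)
        exact mul_le_mul_of_nonneg_left hz4 (by norm_num)
      _ = C₂ * (z : ℝ) ^ (κ + 8) * (2 : ℝ) ^ (2 * ε * (D.width : ℝ)) := by
        rw [hC₂]
        push_cast
        ring
      _ ≤ _ := by gcongr
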